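/- **Setting.** Fix $p\ge 0$. For each $N$ let $E=E_N\in\{0,1\}^{N\times N}$ be the symmetric adjacency matrix of a network on $N$ units, with $E_{ii}=1$ and, for all large $N$, every $n_i=\sum_{j\ne i}E_{ij}$ positive. Put $S_{1i}(V)=n_i^{-1}\sum_{j\neq i}E_{ij}V_j$, applied columnwise to matrices. Let $\varphi=(\beta,\gamma,\alpha,\sigma_y^2,\sigma_{b^Y}^2,\sigma_m^2,\sigma_{b^M}^2)\in\mathbb R^K$ with $\beta=(\beta_0,\dots,\beta_4,\boldsymbol\beta_5,\boldsymbol\beta_6)$, $\gamma=(\gamma_0,\gamma_1,\gamma_2,\boldsymbol\gamma_3,\boldsymbol\gamma_4)$ and $\boldsymbol\beta_5,\boldsymbol\beta_6,\boldsymbol\gamma_3,\boldsymbol\gamma_4,\alpha\in\mathbb R^p$. Under $\varphi$ the data $(C,A,M,Y)$ of the network (the REN-SEM) are generated as follows. The confounders $C=(C_1,\dots,C_N)$, $C_i\in\mathbb R^p$, have an arbitrary law that does not depend on $\varphi$ (possibly a point mass). Given $C$, the exposures $A_i$ are independent Bernoulli variables with success probability $\pi(C_i,\alpha)=e^{\alpha^TC_i}/(1+e^{\alpha^TC_i})$.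 Finally $$M_i=\gamma_0+\gamma_1A_i+\gamma_2S_{1i}(A)+\boldsymbol\gamma_3^TC_i+\boldsymbol\gamma_4^TS_{1i}(C)+E_{i\cdot}^Tb^M+\epsilon_i^M,$$ $$Y_i=\beta_0+\beta_1A_i+\beta_2S_{1i}(A)+\beta_3M_i+\beta_4S_{1i}(M)+\boldsymbol\beta_5^TC_i+\boldsymbol\beta_6^TS_{1i}(C)+E_{i\cdot}^Tb^Y+\epsilon_i^Y,$$ where $b^M,\epsilon^M,b^Y,\epsilon^Y$ are independent, independent of $(C,A)$, and centred normal with covariances $\sigma_{b^M}^2I_N,\ \sigma_m^2I_N,\ \sigma_{b^Y}^2I_N,\ \sigma_y^2I_N$. Write $P_\varphi,\mathbb E_\varphi$ for probability and expectation under $\varphi$. Let $X_m,X_y$ be the design matrices of these two linear models, $\Sigma_y=\sigma_y^2I_N+\sigma_{b^Y}^2EE^T$ and $\Sigma_m=\sigma_m^2I_N+\sigma_{b^M}^2EE^T$. The log-likelihood given $C$, with the random effects integrated out, is $$\begin{aligned}l_N(\varphi)={}&-\tfrac N2\log 2\pi-\tfrac12\log|\Sigma_y|-\tfrac12(Y-X_y\beta)^T\Sigma_y^{-1}(Y-X_y\beta)\\&-\tfrac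 N2\log 2\pi-\tfrac12\log|\Sigma_m|-\tfrac12(M-X_m\gamma)^T\Sigma_m^{-1}(M-X_m\gamma)\\&+\sum_{i}A_i\log\frac{\pi(C_i,\alpha)}{1-\pi(C_i,\alpha)}+\sum_i\log(1-\pi(C_i,\alpha)).\end{aligned}$$ Let $J_N(\varphi)=-\nabla^2l_N(\varphi)$ and let $B_N(\varphi)=\mathbb E_\varphi J_N(\varphi)$ be the Fisher information. For $\Phi=(\varphi_1,\dots,\varphi_K)$ let $J_N(\Phi)$ be the matrix whose $k$-th row is the $k$-th row of $J_N(\varphi_k)$. $B_N^{1/2}$ is the symmetric square root and $\|\cdot\|_F$ the Frobenius norm. Let $\Theta\subset\mathbb R^K$ be compact, with all four variance components positive on $\Theta$, let the true parameter $\varphi_0$ be an interior point of $\Theta$, and let $\widehat\varphi_N$ be a (measurable) maximum likelihood estimator, that is, a maximizer of $l_N$ over $\Theta$. **Assumptions.** 1. For all large $N$, $B_N(\varphi)$ exists, is positive definite for every $\varphi\in\Theta$ and is continuous on $\Theta$; and $\lim_{N\to\infty}\sup_{\varphi\in\Theta}\|B_N^{-1}(\varphi)\|_F=0$. 2. $\lim_{N\to\infty}\sup_{\varphi\in\Theta}\mathbb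 E_\varphi\|B_N^{-1/2}(\varphi)J_N(\varphi)B_N^{-1/2}(\varphi)-I_K\|_F^2=0$. 3. For all $\epsilon,\eta>0$, as $N\to\infty$: (i) $\sup\{\|B_N^{-1/2}(\varphi)B_N^{1/2}(\varphi')-I_K\|_F:\varphi,\varphi'\in\Theta,\ \|B_N^{1/2}(\varphi)^T(\varphi-\varphi')\|\le\epsilon\}\to0$; (ii) for every $\varphi\in\Theta$, $$P_\varphi\Big[\sup\big\{\|B_N^{-1/2}(\varphi)\{J_N(\Phi)-J_N(\varphi)\}B_N^{-1/2}(\varphi)\|_F:\varphi_k\in\Theta,\ \|B_N(\varphi)(\varphi-\varphi_k)\|\le\epsilon,\ 1\le k\le K\big\}>\eta\Big]\to0.$$ **Theorem.** Under these assumptions the MLE is weakly consistent and asymptotically normal: under $P_{\varphi_0}$, as $N\to\infty$, $$\widehat\varphi_N\xrightarrow{p}\varphi_0\qquad\text{and}\qquad B_N^{1/2}(\varphi_0)(\widehat\varphi_N-\varphi_0)\xrightarrow{d}\mathcal N(0,I_K).$$ -/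

import Mathlib

open MeasureTheory ProbabilityTheory Filter Topology
open scoped ENNReal Matrix MatrixOrder

namespace RENSEM

noncomputable section

/-! ### Networks -/

/-- The adjacency matrix of a network: `E i j = 1` if `i` and `j` share an edge, `E i i = 1`,
and `E i j = 0` otherwise. -/
def adjacency {N : ℕ} (G : SimpleGraph (Fin N)) : Matrix (Fin N) (Fin N) ℝ :=
  open Classical in Matrix.of fun i j => if i = j ∨ G.Adj i j then 1 else 0

/-- The number `n_i = ∑_{j ≠ i} E_ij` of first-degree neighbours of `i`. -/
def nbrCount {N : ℕ} (G : SimpleGraph (Fin N)) (i : Fin N) : ℝ :=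
  ∑ j ∈ Finset.univ.erase i, adjacency G i j

/-- The neighbourhood average `S_{1i}(V) = n_i⁻¹ ∑_{j ≠ i} E_ij V_j`. -/
def nbrAvg {N : ℕ} (G : SimpleGraph (Fin N)) (V : Fin N → ℝ) (i : Fin N) : ℝ :=
  (nbrCount G i)⁻¹ * ∑ j ∈ Finset.univ.erase i, adjacency G i j * V j

/-! ### Parameters -/

/-- Indices of `β = (β₀, β₁, β₂, β₃, β₄, β₅, β₆)` with `β₅, β₆ ∈ ℝᵖ`. -/
abbrev BetaIdx (p : ℕ) : Type := Fin 5 ⊕ (Fin p ⊕ Fin p)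

/-- Indices of `γ = (γ₀, γ₁, γ₂, γ₃, γ₄)` with `γ₃, γ₄ ∈ ℝᵖ`. -/
abbrev GammaIdx (p : ℕ) : Type := Fin 3 ⊕ (Fin p ⊕ Fin p)

/-- Indices of the grand parameter `φ = (β, γ, α, (σ_y², σ_{bY}², σ_m², σ_{bM}²))`. -/
abbrev ParamIdx (p : ℕ) : Type := BetaIdx p ⊕ (GammaIdx p ⊕ (Fin p ⊕ Fin 4))

/-- The space `ℝᴷ` of parameters, `K = 12 + 5 p`. -/
abbrev Param (p : ℕ) : Type := EuclideanSpace ℝ (ParamIdx p)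

variable {N p : ℕ}

def beta (φ : Param p) (k : BetaIdx p) : ℝ := φ (Sum.inl k)
def gamma (φ : Param p) (k : GammaIdx p) : ℝ := φ (Sum.inr (Sum.inl k))
def alpha (φ : Param p) (k : Fin p) : ℝ := φ (Sum.inr (Sum.inr (Sum.inl k)))
/-- The four variance components `σ_y², σ_{bY}², σ_m², σ_{bM}²`, in this order. -/
def variances (φ : Param p) (k : Fin 4) : ℝ := φ (Sum.inr (Sum.inr (Sum.inr k)))
def varY (φ : Param p) : ℝ := variances φ 0
def varBY (φ : Param p) : ℝ := variances φ 1
def varM (φ : Param p) : ℝ := variances φ 2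
def varBM (φ : Param p) : ℝ := variances φ 3

/-! ### The structural equations -/

/-- Propensity `P(A_i = 1 | C_i) = exp(αᵀ C_i) / (1 + exp(αᵀ C_i))`. -/
def propensity (φ : Param p) (c : Fin p → ℝ) : ℝ :=
  Real.exp (alpha φ ⬝ᵥ c) / (1 + Real.exp (alpha φ ⬝ᵥ c))

/-- The design matrix `X_m = (1, A, Ẽ A, C, Ẽ C)` of the mediator model. -/
def designM (G : SimpleGraph (Fin N)) (C : Fin N → Fin p → ℝ) (A : Fin N → ℝ) :
    Matrix (Fin N) (GammaIdx p) ℝ :=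
  Matrix.of fun i => Sum.elim ![1, A i, nbrAvg G A i]
    (Sum.elim (fun k => C i k) (fun k => nbrAvg G (fun j => C j k) i))

/-- The design matrix `X_y = (1, A, Ẽ A, M, Ẽ M, C, Ẽ C)` of the outcome model. -/
def designY (G : SimpleGraph (Fin N)) (C : Fin N → Fin p → ℝ) (A M : Fin N → ℝ) :
    Matrix (Fin N) (BetaIdx p) ℝ :=
  Matrix.of fun i => Sum.elim ![1, A i, nbrAvg G A i, M i, nbrAvg G M i]
    (Sum.elim (fun k => C i k) (fun k => nbrAvg G (fun j => C j k) i))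

/-- Exposures: `A_i = 1` if `U_i ≤ P(A_i = 1 | C_i)` and `A_i = 0` otherwise. For independent
uniform `U_i`, the exposures given `C` are independent Bernoulli variables with the propensities
as success probabilities. -/
def exposure (φ : Param p) (C : Fin N → Fin p → ℝ) (U : Fin N → unitInterval) : Fin N → ℝ :=
  fun i => if (U i : ℝ) ≤ propensity φ (C i) then 1 else 0

/-- Mediators: `M_i = γ₀ + γ₁ A_i + γ₂ S_{1i}(A) + γ₃ᵀ C_i + γ₄ᵀ S_{1i}(C) + E_{i·}ᵀ b^M + ε_i^M`. -/
def mediator (G : SimpleGraph (Fin N)) (φ : Param p) (C : Fin N → Fin p → ℝ)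
    (A bM eM : Fin N → ℝ) : Fin N → ℝ :=
  designM G C A *ᵥ gamma φ + adjacency G *ᵥ bM + eM

/-- Outcomes: `Y_i = β₀ + β₁ A_i + β₂ S_{1i}(A) + β₃ M_i + β₄ S_{1i}(M) + β₅ᵀ C_i + β₆ᵀ S_{1i}(C)
+ E_{i·}ᵀ b^Y + ε_i^Y`. -/
def outcome (G : SimpleGraph (Fin N)) (φ : Param p) (C : Fin N → Fin p → ℝ)
    (A M bY eY : Fin N → ℝ) : Fin N → ℝ :=
  designY G C A M *ᵥ beta φ + adjacency G *ᵥ bY + eY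

/-- The observed data `(C, A, M, Y)` of a network of size `N` with `p` confounders per unit. -/
abbrev Data (N p : ℕ) : Type :=
  (Fin N → Fin p → ℝ) × (Fin N → ℝ) × (Fin N → ℝ) × (Fin N → ℝ)

/-- The exogenous variables `(C, U, (b^M, ε^M), (b^Y, ε^Y))`. -/
abbrev Noise (N p : ℕ) : Type :=
  (Fin N → Fin p → ℝ) × (Fin N → unitInterval) ×
    ((Fin N → ℝ) × (Fin N → ℝ)) × ((Fin N → ℝ) × (Fin N → ℝ))

/-- The law `MVN(0, σ² I_N)`. -/
def isoGaussian (N : ℕ) (σ2 : ℝ) : Measure (Fin N → ℝ) :=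
  Measure.pi fun _ => gaussianReal 0 σ2.toNNReal

/-- The law of the exogenous variables: confounders with law `ν`, exposure noises uniform, random
effects and errors centred Gaussian, all of them independent. -/
def noiseLaw (ν : Measure (Fin N → Fin p → ℝ)) (φ : Param p) : Measure (Noise N p) :=
  ν.prod ((Measure.pi fun _ => volume).prod
    (((isoGaussian N (varBM φ)).prod (isoGaussian N (varM φ))).prod
      ((isoGaussian N (varBY φ)).prod (isoGaussian N (varY φ)))))

/-- The data generated from the exogenous variables by the structural equations. -/
def generate (G : SimpleGraph (Fin N)) (φ : Param p) (w : Noise N p) : Data N p :=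
  let C := w.1
  let A := exposure φ C w.2.1
  let M := mediator G φ C A w.2.2.1.1 w.2.2.1.2
  let Y := outcome G φ C A M w.2.2.2.1 w.2.2.2.2
  (C, A, M, Y)

/-- The law of the data under the parameter `φ`, when the confounders have law `ν`. -/
def dataLaw (G : SimpleGraph (Fin N)) (ν : Measure (Fin N → Fin p → ℝ)) (φ : Param p) :
    Measure (Data N p) :=
  (noiseLaw ν φ).map (generate G φ)

theorem measurable_generate (G : SimpleGraph (Fin N)) (φ : Param p) :
    Measurable (generate G φ) := by
  have hA : Measurable fun w : Noise N p => exposure φ w.1 w.2.1 := by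
    refine measurable_pi_lambda _ fun i => ?_
    refine Measurable.ite ?_ measurable_const measurable_const
    refine measurableSet_le (by fun_prop) ?_
    unfold propensity dotProduct
    fun_prop
  have hM : Measurable fun w : Noise N p =>
      mediator G φ w.1 (exposure φ w.1 w.2.1) w.2.2.1.1 w.2.2.1.2 := by
    refine measurable_pi_lambda _ fun i => ?_
    have hA' : ∀ j, Measurable fun w : Noise N p => exposure φ w.1 w.2.1 j :=
      fun j => (measurable_pi_apply j).comp hA
    simp only [mediator, designM, nbrAvg, Matrix.mulVec, dotProduct, Pi.add_apply,
      Matrix.of_apply, Fintype.sum_sum_type, Sum.elim_inl, Sum.elim_inr, Fin.sum_univ_succ,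
      Matrix.cons_val_zero, Matrix.cons_val_succ, Fin.sum_univ_zero]
    fun_prop
  have hY : Measurable fun w : Noise N p =>
      outcome G φ w.1 (exposure φ w.1 w.2.1)
        (mediator G φ w.1 (exposure φ w.1 w.2.1) w.2.2.1.1 w.2.2.1.2) w.2.2.2.1 w.2.2.2.2 := by
    refine measurable_pi_lambda _ fun i => ?_
    have hA' : ∀ j, Measurable fun w : Noise N p => exposure φ w.1 w.2.1 j :=
      fun j => (measurable_pi_apply j).comp hA
    have hM' : ∀ j, Measurable fun w : Noise N p =>
        mediator G φ w.1 (exposure φ w.1 w.2.1) w.2.2.1.1 w.2.2.1.2 j :=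
      fun j => (measurable_pi_apply j).comp hM
    simp only [outcome, designY, nbrAvg, Matrix.mulVec, dotProduct, Pi.add_apply,
      Matrix.of_apply, Fintype.sum_sum_type, Sum.elim_inl, Sum.elim_inr, Fin.sum_univ_succ,
      Matrix.cons_val_zero, Matrix.cons_val_succ, Fin.sum_univ_zero]
    fun_prop
  exact measurable_fst.prodMk (hA.prodMk (hM.prodMk hY))

instance isProbabilityMeasure_isoGaussian (N : ℕ) (σ2 : ℝ) :
    IsProbabilityMeasure (isoGaussian N σ2) := by
  unfold isoGaussian; infer_instance

instance isProbabilityMeasure_noiseLaw (ν : Measure (Fin N → Fin p → ℝ))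
    [IsProbabilityMeasure ν] (φ : Param p) : IsProbabilityMeasure (noiseLaw ν φ) := by
  unfold noiseLaw; infer_instance

instance isProbabilityMeasure_dataLaw (G : SimpleGraph (Fin N))
    (ν : Measure (Fin N → Fin p → ℝ)) [IsProbabilityMeasure ν] (φ : Param p) :
    IsProbabilityMeasure (dataLaw G ν φ) :=
  Measure.isProbabilityMeasure_map (measurable_generate G φ).aemeasurable

/-! ### Likelihood -/

/-- `Σ_y = σ_y² I + σ_{bY}² E Eᵀ`. -/
def covY (G : SimpleGraph (Fin N)) (φ : Param p) : Matrix (Fin N) (Fin N) ℝ :=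
  varY φ • 1 + varBY φ • (adjacency G * (adjacency G)ᵀ)

/-- `Σ_m = σ_m² I + σ_{bM}² E Eᵀ`. -/
def covM (G : SimpleGraph (Fin N)) (φ : Param p) : Matrix (Fin N) (Fin N) ℝ :=
  varM φ • 1 + varBM φ • (adjacency G * (adjacency G)ᵀ)

/-- The logarithm of the density of `MVN(μ, S)` at the point with residual `r = y - μ`. -/
def gaussianLogLik (S : Matrix (Fin N) (Fin N) ℝ) (r : Fin N → ℝ) : ℝ :=
  -(N / 2 : ℝ) * Real.log (2 * Real.pi) - 1 / 2 * Real.log S.det - 1 / 2 * (r ⬝ᵥ (S⁻¹ *ᵥ r))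

/-- The marginal log-likelihood of the data given the confounders, the random effects being
integrated out. -/
def logLik (G : SimpleGraph (Fin N)) (x : Data N p) (φ : Param p) : ℝ :=
  let C := x.1
  let A := x.2.1
  let M := x.2.2.1
  let Y := x.2.2.2
  gaussianLogLik (covY G φ) (Y - designY G C A M *ᵥ beta φ)
    + gaussianLogLik (covM G φ) (M - designM G C A *ᵥ gamma φ)
    + (∑ i, A i * Real.log (propensity φ (C i) / (1 - propensity φ (C i)))
      + ∑ i, Real.log (1 - propensity φ (C i)))

/-- The second partial derivative `∂² f / ∂φ_k ∂φ_l` at `φ`. -/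
def secondPartial (f : Param p → ℝ) (φ : Param p) (k l : ParamIdx p) : ℝ :=
  fderiv ℝ (fun ψ => fderiv ℝ f ψ (EuclideanSpace.single l 1)) φ (EuclideanSpace.single k 1)

/-- The observed information `J_N(φ)`, the negative Hessian of the log-likelihood. -/
def obsInfo (G : SimpleGraph (Fin N)) (x : Data N p) (φ : Param p) :
    Matrix (ParamIdx p) (ParamIdx p) ℝ :=
  Matrix.of fun k l => -secondPartial (logLik G x) φ k l

/-- The mosaic observed information: its `k`-th row is the `k`-th row of `J_N(φ_k)`. -/
def obsInfoMosaic (G : SimpleGraph (Fin N)) (x : Data N p) (Φ : ParamIdx p → Param p) :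
    Matrix (ParamIdx p) (ParamIdx p) ℝ :=
  Matrix.of fun k l => obsInfo G x (Φ k) k l

/-- The Fisher information `B_N(φ)`, the expectation of `J_N(φ)` when the data have parameter
`φ`. -/
def fisherInfo (G : SimpleGraph (Fin N)) (ν : Measure (Fin N → Fin p → ℝ)) (φ : Param p) :
    Matrix (ParamIdx p) (ParamIdx p) ℝ :=
  Matrix.of fun k l => ∫ x, obsInfo G x φ k l ∂(dataLaw G ν φ)

/-- The symmetric square root `B_N(φ)^{1/2}`. -/
def fisherSqrt (G : SimpleGraph (Fin N)) (ν : Measure (Fin N → Fin p → ℝ)) (φ : Param p) :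
    Matrix (ParamIdx p) (ParamIdx p) ℝ :=
  CFC.sqrt (fisherInfo G ν φ)

/-- The Frobenius norm `√(tr (Hᵀ H))`. -/
def frob {ι : Type*} [Fintype ι] (H : Matrix ι ι ℝ) : ℝ := Real.sqrt (Hᵀ * H).trace

/-- The log-likelihood is maximized over `Θ` at `θ`. -/
def IsMLE (G : SimpleGraph (Fin N)) (Θ : Set (Param p)) (x : Data N p) (θ : Param p) : Prop :=
  θ ∈ Θ ∧ ∀ φ ∈ Θ, logLik G x φ ≤ logLik G x θ

/-! ### Regularity conditions on a sequence of networks -/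

/-- For large networks the Fisher information exists, is positive definite and is continuous on
`Θ`; its inverse tends to `0` uniformly on `Θ`. -/
structure InformationGrowth (G : ∀ N, SimpleGraph (Fin N))
    (ν : ∀ N, Measure (Fin N → Fin p → ℝ)) (Θ : Set (Param p)) : Prop where
  integrable : ∀ᶠ N in atTop, ∀ φ ∈ Θ, ∀ k l,
    Integrable (fun x => obsInfo (G N) x φ k l) (dataLaw (G N) (ν N) φ)
  posDef : ∀ᶠ N in atTop, ∀ φ ∈ Θ, (fisherInfo (G N) (ν N) φ).PosDef
  continuousOn : ∀ᶠ N in atTop, ContinuousOn (fisherInfo (G N) (ν N)) Θ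
  tendsto : Tendsto
    (fun N => ⨆ φ ∈ Θ, ENNReal.ofReal (frob (fisherInfo (G N) (ν N) φ)⁻¹)) atTop (𝓝 0)

/-- `sup_{φ ∈ Θ} 𝔼_φ ‖B_N(φ)^{-1/2} J_N(φ) B_N(φ)^{-1/2} - I‖_F² → 0`. -/
def InformationConvergence (G : ∀ N, SimpleGraph (Fin N))
    (ν : ∀ N, Measure (Fin N → Fin p → ℝ)) (Θ : Set (Param p)) : Prop :=
  Tendsto (fun N => ⨆ φ ∈ Θ, ∫⁻ x, ENNReal.ofReal
      (frob ((fisherSqrt (G N) (ν N) φ)⁻¹ * obsInfo (G N) x φ *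
        (fisherSqrt (G N) (ν N) φ)⁻¹ - 1) ^ 2) ∂(dataLaw (G N) (ν N) φ))
    atTop (𝓝 0)

/-- Local stability of the Fisher information and of the observed information. In `observed`,
the event says that the supremum over all admissible `φ_1, …, φ_K` exceeds `η`. -/
structure InformationStability (G : ∀ N, SimpleGraph (Fin N))
    (ν : ∀ N, Measure (Fin N → Fin p → ℝ)) (Θ : Set (Param p)) : Prop where
  fisher : ∀ ε : ℝ, 0 < ε → Tendsto
    (fun N => ⨆ φ ∈ Θ, ⨆ φ' ∈ Θ,
      ⨆ (_ : ‖Matrix.toEuclideanLin (fisherSqrt (G N) (ν N) φ)ᵀ (φ - φ')‖ ≤ ε),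
        ENNReal.ofReal (frob ((fisherSqrt (G N) (ν N) φ)⁻¹ * fisherSqrt (G N) (ν N) φ' - 1)))
    atTop (𝓝 0)
  observed : ∀ ε : ℝ, 0 < ε → ∀ η : ℝ, 0 < η → ∀ φ ∈ Θ, Tendsto
    (fun N => dataLaw (G N) (ν N) φ {x | ∃ Φ : ParamIdx p → Param p,
      (∀ k, Φ k ∈ Θ ∧ ‖Matrix.toEuclideanLin (fisherInfo (G N) (ν N) φ) (φ - Φ k)‖ ≤ ε) ∧
      η < frob ((fisherSqrt (G N) (ν N) φ)⁻¹ *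
        (obsInfoMosaic (G N) x Φ - obsInfo (G N) x φ) * (fisherSqrt (G N) (ν N) φ)⁻¹)})
    atTop (𝓝 0)

end

end RENSEM

namespace RENSEM

/-! ### Elementary inequalities for the Gaussian log-likelihood -/

/-! Put u = B_N(φ₀)^{1/2}(φ − φ₀) and regard the log-likelihood ratio as a random function ℓ_N(u) on
the local parameter set. Two properties (`IsLANBlock`) carry the proof. With probability close to 1,
ℓ_N(u) ≤ A − ‖u‖ on the whole local set; and ℓ_N(u) = ⟨S_N, u⟩ − ‖u‖²/2 + o(1) uniformly on balls.
The first makes the normalized maximizer tight, hence the estimator consistent because B_N^{-1} → 0.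
The second, after completing the square, makes the normalized maximizer equal to S_N up to o(1)
(`IsLANBlock.whp_norm_argmax_sub_score_le`). It remains to see that S_N is asymptotically standard
normal.

The likelihood factors into an exposure, a mediator and an outcome part, and the Fisher information
is block diagonal accordingly. Each factor is treated with its own quadratic form q, and the three
forms add up to ‖u‖².

For the two Gaussian factors, the covariances s I + t E Eᵀ share one eigenbasis. After rotation and
whitening, the log-likelihood ratio is exactly `gdev` of white noise, where the relative variance
changes w are linear in u and nonrandom, and the mean changes x are linear in u. Convergence of the
information says that `gquad` is close to q. The drift is at most a negative multiple of q
(`gdev_le`). The noise must be O(√q) uniformly over parameters far from φ₀: its denominators have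
the form σ a_i + τ (1 − a_i), and a geometric expansion (`geomSup`) takes σ and τ out of the random
sums, so that second moments suffice.

For the logistic factor, the score is linear and the remainder `bernRem` is convex in u. The
remainder is an integral of informations at intermediate parameters. These depend on the confounders
only, whose law is the same under all parameters; so convergence of the information at the
intermediate parameter, together with stability of the Fisher information, gives the limit q/2 at
each u. Convexity then gives uniformity on balls and linear growth outside them.

For normality of S_N the conditioning follows the causal order. The characteristic function of each
part of the score, given the past, is close to exp(−q/2) with deterministic q: by an explicit
formula for the Gaussian parts, and through the moment generating function, which is exactly the
exponential of `bernRem`, for the exposures. Deterministic factors multiply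
(`CondNormal.tendsto_add`) and give exp(−‖a‖²/2). -/

theorem sq_sub_one_le_log_add_inv {r M : ℝ} (hr : 0 < r) (hM : 1 ≤ M) (hrM : r ≤ M) :
    (r - 1) ^ 2 / (4 * M ^ 2) ≤ Real.log r - 1 + 1 / r := by
  -- Applying log y ≤ y − 1 to y = 1/r would only give nonnegativity. Applied to y = 1/√r it leaves
  -- the square (1 − 1/√r)².
  set s := Real.sqrt r with hs
  have hs0 : 0 < s := Real.sqrt_pos.2 hr
  have hrs : r = s ^ 2 := (Real.sq_sqrt hr.le).symm
  have hsM : s ≤ M := by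
    nlinarith [sq_nonneg (s - 1), sq_nonneg (M - 1)]
  have hlog : Real.log r = -(2 * Real.log (1 / s)) := by
    rw [hrs, Real.log_pow, one_div, Real.log_inv]; push_cast; ring
  have h1 : Real.log (1 / s) ≤ 1 / s - 1 := Real.log_le_sub_one_of_pos (by positivity)
  have h2 : (r - 1) ^ 2 / (4 * M ^ 2) ≤ (1 - 1 / s) ^ 2 := by
    have : (1 - 1 / s) ^ 2 = (r - 1) ^ 2 / (s * (s + 1)) ^ 2 := by
      rw [hrs]; field_simp; ring
    rw [this]
    apply div_le_div_of_nonneg_left (sq_nonneg _) (by positivity)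
    have : s * (s + 1) = r + s := by rw [hrs]; ring
    rw [this]
    nlinarith [hr, hs0]
  have h3 : 1 / r = (1 / s) ^ 2 := by rw [hrs]; field_simp
  rw [h3]
  nlinarith

/-- The quadratic terms of log(1 + w) and 1/(1 + w) are −w²/2 and w². Each expansion leaves a cubic
remainder of at most 2|w|³. -/
theorem abs_log_add_inv_sub_le {w : ℝ} (hw : |w| ≤ 1 / 2) :
    |Real.log (1 + w) - 1 + 1 / (1 + w) - w ^ 2 / 2| ≤ 4 * |w| ^ 3 := by
  have hw1 : |-w| < 1 := by rw [abs_neg]; linarith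
  have h := Real.abs_log_sub_add_sum_range_le hw1 2
  simp only [Finset.sum_range_succ, Finset.sum_range_zero, abs_neg, sub_neg_eq_add] at h
  norm_num at h
  have hpos : 0 < 1 + w := by have := (abs_le.1 hw).1; linarith
  have hinv : 1 / (1 + w) = 1 - w + w ^ 2 - w ^ 3 / (1 + w) := by field_simp; ring
  have h2 : |w| ^ 3 / (1 - |w|) ≤ 2 * |w| ^ 3 := by
    rw [div_le_iff₀ (by linarith)]
    nlinarith [pow_nonneg (abs_nonneg w) 3]
  have h3 : |w ^ 3 / (1 + w)| ≤ 2 * |w| ^ 3 := by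
    rw [abs_div, abs_pow, abs_of_pos hpos, div_le_iff₀ hpos]
    have := (abs_le.1 hw).1
    nlinarith [pow_nonneg (abs_nonneg w) 3]
  have e : Real.log (1 + w) - 1 + 1 / (1 + w) - w ^ 2 / 2
      = (-w + w ^ 2 / 2 + Real.log (1 + w)) - w ^ 3 / (1 + w) := by rw [hinv]; ring
  rw [e]
  calc _ ≤ |(-w + w ^ 2 / 2 + Real.log (1 + w))| + |w ^ 3 / (1 + w)| := abs_sub _ _
    _ ≤ 2 * |w| ^ 3 + 2 * |w| ^ 3 := add_le_add (h.trans h2) h3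
    _ = _ := by ring

/-! ### Deviation of a whitened Gaussian log-likelihood -/

section GaussianBlock

variable {ι : Type*} [Fintype ι]

/-- Log-likelihood ratio of `N(x, 1 + w)` coordinates against standard normal ones, at `z`. -/
noncomputable def gdev (w x z : ι → ℝ) : ℝ :=
  -(1 / 2) * ∑ i, (Real.log (1 + w i) + (z i - x i) ^ 2 / (1 + w i) - z i ^ 2)

/-- The derivative of `gdev` at the origin. -/
noncomputable def gscore (w x z : ι → ℝ) : ℝ := ∑ i, ((z i ^ 2 - 1) / 2 * w i + z i * x i)

/-- This is the variance of `gscore` for standard normal z, since (z² − 1)/2 has variance 1/2 and is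
uncorrelated with z. -/
noncomputable def gquad (w x : ι → ℝ) : ℝ := ∑ i, (w i ^ 2 / 2 + x i ^ 2)

theorem gquad_nonneg (w x : ι → ℝ) : 0 ≤ gquad w x :=
  Finset.sum_nonneg fun i _ => by positivity

/-- Splitting (z − x)² as 1 + (z² − 1) − 2zx + x² separates a deterministic drift, bounded through
`sq_sub_one_le_log_add_inv`, from two centred noise sums. The noise keeps the denominators 1 + w_i;
`geomSup` is made to control them. -/
theorem gdev_le {w x z : ι → ℝ} {m M : ℝ} (hm : 0 < m) (hM : 1 ≤ M)
    (hlo : ∀ i, m ≤ 1 + w i) (hhi : ∀ i, 1 + w i ≤ M) :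
    gdev w x z ≤ -(1 / (8 * M ^ 2)) * gquad w x
      + |∑ i, ((z i ^ 2 - 1) * w i) / (1 + w i)| + |∑ i, (z i * x i) / (1 + w i)| := by
  have key : gdev w x z ≤ ∑ i, (-(1 / (8 * M ^ 2)) * (w i ^ 2 / 2 + x i ^ 2)
      + 1 / 2 * (((z i ^ 2 - 1) * w i) / (1 + w i)) + (z i * x i) / (1 + w i)) := by
    rw [gdev, Finset.mul_sum]
    refine Finset.sum_le_sum fun i _ => ?_
    have hr : 0 < 1 + w i := hm.trans_le (hlo i)
    have h1 := sq_sub_one_le_log_add_inv hr hM (hhi i)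
    have h2 : x i ^ 2 / M ≤ x i ^ 2 / (1 + w i) :=
      div_le_div_of_nonneg_left (sq_nonneg _) hr (hhi i)
    have h3 : x i ^ 2 / (4 * M ^ 2) ≤ x i ^ 2 / M :=
      div_le_div_of_nonneg_left (sq_nonneg _) (by linarith) (by nlinarith)
    have e : -(1 / 2) * (Real.log (1 + w i) + (z i - x i) ^ 2 / (1 + w i) - z i ^ 2)
        = -(1 / 2) * (Real.log (1 + w i) - 1 + 1 / (1 + w i)) - 1 / 2 * (x i ^ 2 / (1 + w i))
          + 1 / 2 * (((z i ^ 2 - 1) * w i) / (1 + w i)) + (z i * x i) / (1 + w i) := by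
      field_simp; ring
    rw [e]
    have h4 : 1 / (8 * M ^ 2) * (w i ^ 2 / 2 + x i ^ 2)
        ≤ 1 / 2 * ((1 + w i - 1) ^ 2 / (4 * M ^ 2)) + 1 / 2 * (x i ^ 2 / (4 * M ^ 2)) := by
      have : (1 + w i - 1) ^ 2 = w i ^ 2 := by ring
      rw [this]
      have hw : 0 ≤ w i ^ 2 / (16 * M ^ 2) := by positivity
      have : 1 / (8 * M ^ 2) * (w i ^ 2 / 2 + x i ^ 2) = 1 / 2 * (w i ^ 2 / (4 * M ^ 2))
        + 1 / 2 * (x i ^ 2 / (4 * M ^ 2)) - w i ^ 2 / (16 * M ^ 2) := by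
          field_simp; ring
      linarith
    linarith
  refine key.trans ?_
  rw [Finset.sum_add_distrib, Finset.sum_add_distrib, ← Finset.mul_sum, ← Finset.mul_sum]
  have h5 := le_abs_self (∑ i, ((z i ^ 2 - 1) * w i) / (1 + w i))
  have h6 := le_abs_self (∑ i, (z i * x i) / (1 + w i))
  have h7 := abs_nonneg (∑ i, ((z i ^ 2 - 1) * w i) / (1 + w i))
  unfold gquad
  linarith

/-- Once the score is removed, the remaining noise carries one more factor w_i, so its variance
vanishes when max |w_i| does. The products are written so that they are bilinear in the direction.
-/
theorem abs_gdev_sub_le {w x z : ι → ℝ} {r : ℝ} (hr : r ≤ 1 / 2) (hw : ∀ i, |w i| ≤ r) :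
    |gdev w x z - gscore w x z + gquad w x / 2| ≤ 6 * r * gquad w x
      + |∑ i, ((z i ^ 2 - 1) * (w i * w i)) / (1 + w i)|
      + |∑ i, (z i * (x i * w i)) / (1 + w i)| := by
  have e : gdev w x z - gscore w x z + gquad w x / 2
      = (∑ i, (-(1 / 2) * (Real.log (1 + w i) - 1 + 1 / (1 + w i) - w i ^ 2 / 2)
          + 1 / 2 * (x i ^ 2 * w i / (1 + w i))))
        - 1 / 2 * (∑ i, ((z i ^ 2 - 1) * (w i * w i)) / (1 + w i))
        - ∑ i, (z i * (x i * w i)) / (1 + w i) := by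
    rw [gdev, gscore, gquad, Finset.mul_sum, Finset.mul_sum, Finset.sum_div,
      ← Finset.sum_sub_distrib, ← Finset.sum_sub_distrib, ← Finset.sum_sub_distrib,
      ← Finset.sum_add_distrib]
    refine Finset.sum_congr rfl fun i _ => ?_
    have : 0 < 1 + w i := by have := (abs_le.1 ((hw i).trans hr)).1; linarith
    field_simp; ring
  have b : |∑ i, (-(1 / 2) * (Real.log (1 + w i) - 1 + 1 / (1 + w i) - w i ^ 2 / 2)
          + 1 / 2 * (x i ^ 2 * w i / (1 + w i)))| ≤ 6 * r * gquad w x := by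
    rw [gquad, Finset.mul_sum]
    refine (Finset.abs_sum_le_sum_abs _ _).trans (Finset.sum_le_sum fun i _ => ?_)
    have h1 := abs_log_add_inv_sub_le ((hw i).trans hr)
    have hpos : 0 < 1 + w i := by have := (abs_le.1 ((hw i).trans hr)).1; linarith
    have h2 : |x i ^ 2 * w i / (1 + w i)| ≤ 2 * r * x i ^ 2 := by
      rw [abs_div, abs_mul, abs_of_pos hpos, abs_of_nonneg (sq_nonneg _), div_le_iff₀ hpos]
      have := (abs_le.1 ((hw i).trans hr)).1
      have h := hw i
      have h' := (abs_nonneg _).trans h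
      have : x i ^ 2 * |w i| ≤ x i ^ 2 * r := by gcongr
      nlinarith [mul_nonneg h' (sq_nonneg (x i))]
    have h3 : |w i| ^ 3 ≤ r * w i ^ 2 := by
      rw [pow_succ, sq_abs, mul_comm]; gcongr; exact hw i
    calc _ ≤ |-(1 / 2) * (Real.log (1 + w i) - 1 + 1 / (1 + w i) - w i ^ 2 / 2)|
          + |1 / 2 * (x i ^ 2 * w i / (1 + w i))| := abs_add_le _ _
      _ ≤ 1 / 2 * (4 * (r * w i ^ 2)) + 1 / 2 * (2 * r * x i ^ 2) := by
        rw [abs_mul, abs_mul, abs_neg, abs_of_pos (by norm_num : (0:ℝ) < 1 / 2)]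
        gcongr
        exact h1.trans (by gcongr)
      _ ≤ _ := by
        have h' := (abs_nonneg _).trans (hw i)
        nlinarith [mul_nonneg h' (sq_nonneg (x i)), mul_nonneg h' (sq_nonneg (w i))]
  rw [e]
  have h1 := abs_sub ((∑ i, (-(1 / 2) * (Real.log (1 + w i) - 1 + 1 / (1 + w i) - w i ^ 2 / 2)
          + 1 / 2 * (x i ^ 2 * w i / (1 + w i))))
        - 1 / 2 * (∑ i, ((z i ^ 2 - 1) * (w i * w i)) / (1 + w i)))
        (∑ i, (z i * (x i * w i)) / (1 + w i))
  have h2 := abs_sub (∑ i, (-(1 / 2) * (Real.log (1 + w i) - 1 + 1 / (1 + w i) - w i ^ 2 / 2)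
          + 1 / 2 * (x i ^ 2 * w i / (1 + w i))))
        (1 / 2 * (∑ i, ((z i ^ 2 - 1) * (w i * w i)) / (1 + w i)))
  rw [abs_mul (1 / 2), abs_of_pos (by norm_num : (0:ℝ) < 1 / 2)] at h2
  have h3 := abs_nonneg (∑ i, ((z i ^ 2 - 1) * (w i * w i)) / (1 + w i))
  linarith

/-! ### Uniform bounds over two variance components -/

/-- A bound, uniform in `σ, τ`, for `∑ v_i / (σ a_i + τ (1 - a_i))`. -/
noncomputable def geomSup (θ : ℝ) (a v : ι → ℝ) : ℝ≥0∞ :=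
  ∑' k : ℕ, ENNReal.ofReal (θ ^ k) *
    (‖∑ i, v i * a i ^ k‖ₑ + ‖∑ i, v i * (1 - a i) ^ k‖ₑ)

/-- Expanding 1/(1 − s a_i) in a geometric series turns the dependence on s into scalar factors s^k
≤ θ^k. The sums that remain do not involve s. -/
theorem enorm_sum_div_le_tsum {θ s : ℝ} {a v : ι → ℝ} (hθ0 : 0 ≤ s) (hs : s ≤ θ) (hθ : θ < 1)
    (ha : ∀ i, a i ∈ Set.Icc (0 : ℝ) 1) :
    ‖∑ i, v i / (1 - s * a i)‖ₑ ≤ ∑' k : ℕ, ENNReal.ofReal (θ ^ k) * ‖∑ i, v i * a i ^ k‖ₑ := by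
  have hlt : ∀ i, |s * a i| < 1 := fun i => by
    rw [abs_of_nonneg (mul_nonneg hθ0 (ha i).1)]
    exact (mul_le_of_le_one_right hθ0 (ha i).2).trans_lt (hs.trans_lt hθ)
  have h1 : HasSum (fun k : ℕ => ∑ i, v i * (s * a i) ^ k) (∑ i, v i / (1 - s * a i)) := by
    refine hasSum_sum fun i _ => ?_
    rw [div_eq_mul_inv]
    exact (hasSum_geometric_of_abs_lt_one (hlt i)).mul_left _
  rw [← h1.tsum_eq]
  refine (enorm_tsum_le_tsum_enorm).trans (ENNReal.tsum_le_tsum fun k => ?_)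
  have : ∑ i, v i * (s * a i) ^ k = s ^ k * ∑ i, v i * a i ^ k := by
    rw [Finset.mul_sum]; exact Finset.sum_congr rfl fun i _ => by ring
  rw [this, enorm_mul, Real.enorm_of_nonneg (by positivity)]
  gcongr

/-- The larger of σ and τ is factored out, so that the ratio left in the series lies in [0, 1 −
m/M]. The series is in powers of a_i if σ ≤ τ and in powers of 1 − a_i otherwise; `geomSup` adds
both cases. -/
theorem enorm_sum_div_le_geomSup {m M σ τ : ℝ} {a v ρ : ι → ℝ} (hm : 0 < m)
    (hσ : σ ∈ Set.Icc m M) (hτ : τ ∈ Set.Icc m M) (ha : ∀ i, a i ∈ Set.Icc (0 : ℝ) 1)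
    (hρ : ∀ i, ρ i = σ * a i + τ * (1 - a i)) :
    ‖∑ i, v i / ρ i‖ₑ ≤ ENNReal.ofReal (1 / m) * geomSup (1 - m / M) a v := by
  have hM : 0 < M := hm.trans_le (hσ.1.trans hσ.2)
  have main : ∀ (σ τ : ℝ) (b : ι → ℝ), τ ∈ Set.Icc m M → σ ∈ Set.Icc m M → σ ≤ τ →
      (∀ i, b i ∈ Set.Icc (0 : ℝ) 1) → (∀ i, ρ i = σ * b i + τ * (1 - b i)) →
      ‖∑ i, v i / ρ i‖ₑ ≤ ENNReal.ofReal (1 / m) *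
        ∑' k : ℕ, ENNReal.ofReal ((1 - m / M) ^ k) * ‖∑ i, v i * b i ^ k‖ₑ := by
    intro σ τ b hτ hσ hle hb hρ
    have hτ0 : 0 < τ := hm.trans_le hτ.1
    have e : ∑ i, v i / ρ i = 1 / τ * ∑ i, v i / (1 - (1 - σ / τ) * b i) := by
      rw [Finset.mul_sum]
      refine Finset.sum_congr rfl fun i _ => ?_
      have : ρ i = τ * (1 - (1 - σ / τ) * b i) := by rw [hρ]; field_simp; ring
      rw [this, one_div, div_mul_eq_div_div, div_eq_inv_mul (v i) τ, mul_div_assoc]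
    rw [e, enorm_mul, Real.enorm_of_nonneg (by positivity)]
    gcongr
    · exact hτ.1
    · refine enorm_sum_div_le_tsum ?_ ?_ ?_ hb
      · rw [sub_nonneg, div_le_one hτ0]; exact hle
      · have : m / M ≤ σ / τ := div_le_div₀ (hm.le.trans hσ.1) hσ.1 hτ0 hτ.2
        linarith
      · have : 0 < m / M := by positivity
        linarith
  rcases le_total σ τ with h | h
  · refine (main σ τ a hτ hσ h ha hρ).trans ?_
    unfold geomSup
    gcongr
    exact le_self_add
  · refine (main τ σ (fun i => 1 - a i) hσ hτ h
      (fun i => ⟨by linarith [(ha i).2], by linarith [(ha i).1]⟩)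
      (fun i => by rw [hρ]; ring)).trans ?_
    unfold geomSup
    gcongr
    exact le_add_self

end GaussianBlock

end RENSEM


namespace RENSEM

/-! ### Convergence of moment generating functions -/

/-- Fatou's lemma for weak convergence, from the portmanteau inequality on open sets. -/
theorem integrable_sq_of_tendsto {μs : ℕ → ProbabilityMeasure ℝ} {μ : ProbabilityMeasure ℝ}
    (h : Tendsto μs atTop (𝓝 μ)) {f : ℝ → ℝ} (hf : Continuous f) {C : ℝ}
    (hint : ∀ n, Integrable (fun x => f x ^ 2) (μs n : Measure ℝ))
    (hC : ∀ n, ∫ x, f x ^ 2 ∂(μs n : Measure ℝ) ≤ C) :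
    Integrable (fun x => f x ^ 2) (μ : Measure ℝ) ∧ ∫ x, f x ^ 2 ∂(μ : Measure ℝ) ≤ C := by
  have h1 : ∫⁻ x, ENNReal.ofReal (f x ^ 2) ∂(μ : Measure ℝ) ≤ ENNReal.ofReal C := by
    refine (lintegral_le_liminf_lintegral_of_forall_isOpen_measure_le_liminf_measure
      (μs := fun n => (μs n : Measure ℝ)) (f := fun x => f x ^ 2)
      (by fun_prop) (fun x => sq_nonneg _)
      fun G hG => ProbabilityMeasure.le_liminf_measure_open_of_tendsto h hG).trans ?_
    refine Filter.liminf_le_of_frequently_le' (Frequently.of_forall fun n => ?_)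
    rw [← ofReal_integral_eq_lintegral_ofReal (hint n) (ae_of_all _ fun x => sq_nonneg _)]
    exact ENNReal.ofReal_le_ofReal (hC n)
  have hi : Integrable (fun x => f x ^ 2) (μ : Measure ℝ) := by
    refine ⟨by fun_prop, ?_⟩
    rw [hasFiniteIntegral_iff_ofReal (ae_of_all _ fun x => sq_nonneg _)]
    exact h1.trans_lt ENNReal.ofReal_lt_top
  refine ⟨hi, ?_⟩
  have hC0 : 0 ≤ C := (integral_nonneg fun x => sq_nonneg (f x)).trans (hC 0)
  rw [← ofReal_integral_eq_lintegral_ofReal hi (ae_of_all _ fun x => sq_nonneg _)] at h1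
  exact (ENNReal.ofReal_le_ofReal_iff hC0).1 h1

/-- Bounded second moments give uniform integrability: truncating f at height K costs at most C/K,
for all the measures and for the limit. The truncated function is bounded and continuous. -/
theorem tendsto_integral_of_sq_bounded {μs : ℕ → ProbabilityMeasure ℝ} {μ : ProbabilityMeasure ℝ}
    (h : Tendsto μs atTop (𝓝 μ)) {f : ℝ → ℝ} (hf : Continuous f) (h0 : ∀ x, 0 ≤ f x) {C : ℝ}
    (hint : ∀ n, Integrable (fun x => f x ^ 2) (μs n : Measure ℝ))
    (hC : ∀ n, ∫ x, f x ^ 2 ∂(μs n : Measure ℝ) ≤ C) :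
    Tendsto (fun n => ∫ x, f x ∂(μs n : Measure ℝ)) atTop (𝓝 (∫ x, f x ∂(μ : Measure ℝ))) := by
  obtain ⟨hi, hCμ⟩ := integrable_sq_of_tendsto h hf hint hC
  have hC0 : 0 ≤ C := (integral_nonneg fun x => sq_nonneg (f x)).trans (hC 0)
  have trunc : ∀ (ν : ProbabilityMeasure ℝ), Integrable (fun x => f x ^ 2) (ν : Measure ℝ) →
      ∫ x, f x ^ 2 ∂(ν : Measure ℝ) ≤ C → ∀ K : ℝ, 0 < K →
      |∫ x, f x ∂(ν : Measure ℝ) - ∫ x, min (f x) K ∂(ν : Measure ℝ)| ≤ C / K := by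
    intro ν hν hνC K hK
    have hfi : Integrable f (ν : Measure ℝ) := by
      refine (hν.add (integrable_const 1)).mono' (by fun_prop) (ae_of_all _ fun x => ?_)
      rw [Real.norm_of_nonneg (h0 x)]
      simp only [Pi.add_apply]
      nlinarith [sq_nonneg (f x - 1)]
    have hmi : Integrable (fun x => min (f x) K) (ν : Measure ℝ) :=
      hfi.inf (integrable_const K)
    rw [← integral_sub hfi hmi]
    refine (abs_integral_le_integral_abs).trans ?_
    calc _ ≤ ∫ x, f x ^ 2 / K ∂(ν : Measure ℝ) := by
          refine integral_mono (hfi.sub hmi).abs (hν.div_const _) fun x => ?_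
          rcases le_total (f x) K with hx | hx
          · simp only [min_eq_left hx, sub_self, abs_zero]; positivity
          · simp only [min_eq_right hx]
            rw [abs_of_nonneg (by linarith), le_div_iff₀ hK]
            nlinarith [h0 x]
      _ ≤ _ := by rw [integral_div]; gcongr
  rw [Metric.tendsto_atTop]
  intro ε hε
  set K := 4 * (C + 1) / ε with hKdef
  have hK : 0 < K := by positivity
  have hCK : C / K ≤ ε / 4 := by
    rw [hKdef, div_div_eq_mul_div, div_le_iff₀ (by positivity)]
    nlinarith
  let g : BoundedContinuousFunction ℝ ℝ := BoundedContinuousFunction.ofNormedAddCommGroup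
    (fun x => min (f x) K) (by fun_prop) K (fun x => by
      rw [Real.norm_of_nonneg (le_min (h0 x) hK.le)]; exact min_le_right _ _)
  have hg := (ProbabilityMeasure.tendsto_iff_forall_integral_tendsto.1 h) g
  obtain ⟨n0, hn0⟩ := (Metric.tendsto_atTop.1 hg) (ε / 4) (by positivity)
  refine ⟨n0, fun n hn => ?_⟩
  have h1 := trunc (μs n) (hint n) (hC n) K hK
  have h2 := trunc μ hi hCμ K hK
  have h3 : |∫ x, min (f x) K ∂(μs n : Measure ℝ) - ∫ x, min (f x) K ∂(μ : Measure ℝ)| < ε / 4 :=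
    hn0 n hn
  rw [Real.dist_eq]
  rw [abs_le] at h1 h2
  rw [abs_lt] at h3 ⊢
  constructor <;> linarith [h1.1, h1.2, h2.1, h2.2, h3.1, h3.2]

/-- Continuity extends the identity of moment generating functions from the rationals to the line,
and analytic continuation carries it to the imaginary axis. The case q = 0 is allowed. -/
theorem charFun_eq_of_mgf_rat {μ : Measure ℝ} [IsProbabilityMeasure μ]
    (hint : ∀ t : ℝ, Integrable (fun x => Real.exp (t * x)) μ) {q : ℝ} (hq : 0 ≤ q)
    (h : ∀ r : ℚ, mgf id μ r = Real.exp ((r : ℝ) ^ 2 * q / 2)) :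
    charFun μ 1 = Real.exp (-q / 2) := by
  have hmgf : mgf id μ = mgf id (gaussianReal 0 q.toNNReal) := by
    have hc : Continuous (mgf id μ) := continuous_mgf hint
    have hg : ∀ t, mgf id (gaussianReal 0 q.toNNReal) t = Real.exp (t ^ 2 * q / 2) := fun t => by
      rw [mgf_gaussianReal (μ := 0) (v := q.toNNReal) (by simp)]
      simp only [zero_mul, zero_add, Real.coe_toNNReal _ hq]; ring_nf
    have hc' : Continuous fun t : ℝ => Real.exp (t ^ 2 * q / 2) := by fun_prop
    refine (hc.ext_on Rat.denseRange_cast (g := fun t : ℝ => Real.exp (t ^ 2 * q / 2)) hc' ?_).trans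
      (funext fun t => (hg t).symm)
    rintro _ ⟨r, rfl⟩
    exact h r
  have hset : integrableExpSet id μ = Set.univ := by
    ext t; simpa [integrableExpSet] using hint t
  have := eqOn_complexMGF_of_mgf (μ := μ) hmgf (x := ((1 : ℝ) : ℂ) * Complex.I)
    (by simp [hset])
  rw [complexMGF_id_mul_I, complexMGF_id_mul_I, charFun_gaussianReal] at this
  rw [this]
  push_cast
  simp only [Real.coe_toNNReal _ hq]
  congr 1
  simp; ring

/-- The variances q_n need not converge. Every subsequence has a further one along which both the
laws and the variances converge, because the laws are tight and [0, R] is compact; the limit law is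
then identified by its moment generating function. -/
theorem tendsto_charFun_of_tendsto_mgf {μ : ℕ → Measure ℝ} [∀ n, IsProbabilityMeasure (μ n)]
    {q : ℕ → ℝ} {R : ℝ} (hq : ∀ n, q n ∈ Set.Icc 0 R)
    (hint : ∀ n (t : ℝ), Integrable (fun x => Real.exp (t * x)) (μ n))
    (hmgf : ∀ r : ℚ, Tendsto (fun n => mgf id (μ n) r - Real.exp ((r : ℝ) ^ 2 * q n / 2)) atTop
      (𝓝 0)) :
    Tendsto (fun n => charFun (μ n) 1 - Real.exp (-q n / 2)) atTop (𝓝 0) := by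
  refine tendsto_of_subseq_tendsto fun ns hns => ?_
  -- uniform bounds of the moment generating functions
  have bdd : ∀ r : ℚ, ∃ C : ℝ, ∀ n, mgf id (μ n) r ≤ C := by
    intro r
    obtain ⟨C, hC⟩ := (hmgf r).bddAbove_range
    refine ⟨C + Real.exp ((r : ℝ) ^ 2 * R / 2), fun n => ?_⟩
    have h1 : mgf id (μ n) r - Real.exp ((r : ℝ) ^ 2 * q n / 2) ≤ C := hC ⟨n, rfl⟩
    have h2 : Real.exp ((r : ℝ) ^ 2 * q n / 2) ≤ Real.exp ((r : ℝ) ^ 2 * R / 2) := by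
      have := (hq n).2
      gcongr
    linarith
  let S : Set (ProbabilityMeasure ℝ) := Set.range fun n => ⟨μ n, inferInstance⟩
  -- Tightness comes from the exponential Chebyshev bounds at t = 1 and t = −1.
  have htight : IsTightMeasureSet {((ν : ProbabilityMeasure ℝ) : Measure ℝ) | ν ∈ S} := by
    obtain ⟨C1, hC1⟩ := bdd 1
    obtain ⟨C2, hC2⟩ := bdd (-1)
    refine isTightMeasureSet_of_tendsto_measure_norm_gt ?_
    have hlim : Tendsto (fun r : ℝ => ENNReal.ofReal ((C1 + C2) * Real.exp (-r))) atTop (𝓝 0) := by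
      rw [← ENNReal.ofReal_zero]
      refine ENNReal.tendsto_ofReal ?_
      simpa using (Real.tendsto_exp_neg_atTop_nhds_zero).const_mul (C1 + C2)
    refine tendsto_of_tendsto_of_tendsto_of_le_of_le tendsto_const_nhds hlim
      (fun _ => zero_le) fun r => ?_
    refine iSup₂_le ?_
    rintro _ ⟨_, ⟨n, rfl⟩, rfl⟩
    have hsub : {x : ℝ | r < ‖x‖} ⊆ {x | r ≤ id x} ∪ {x | id x ≤ -r} := by
      intro x hx
      rcases lt_abs.1 (show r < |x| from hx) with h | h
      · exact Or.inl h.le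
      · exact Or.inr (show x ≤ -r by linarith)
    have e1 := measure_ge_le_exp_mul_mgf (μ := μ n) (X := id) (t := 1) r zero_le_one
      (hint n 1)
    have e2 := measure_le_le_exp_mul_mgf (μ := μ n) (X := id) (t := -1) (-r) (by norm_num)
      (hint n (-1))
    have h1 := hC1 n
    have h2 := hC2 n
    push_cast at h1 h2
    have : (μ n).real {x : ℝ | r < ‖x‖} ≤ (C1 + C2) * Real.exp (-r) := by
      refine (measureReal_mono hsub).trans ((measureReal_union_le _ _).trans ?_)
      refine (add_le_add e1 e2).trans ?_
      have := Real.exp_pos (-r)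
      have e3 : Real.exp (-1 * r) = Real.exp (-r) := by ring_nf
      have e4 : Real.exp (- -1 * -r) = Real.exp (-r) := by ring_nf
      rw [e3, e4]
      nlinarith
    change μ n {x : ℝ | r < ‖x‖} ≤ _
    rw [← ofReal_measureReal]
    exact ENNReal.ofReal_le_ofReal this
  have hcompact := isCompact_closure_of_isTightMeasureSet htight
  have hprod : IsCompact (closure S ×ˢ Set.Icc (0 : ℝ) R) := hcompact.prod isCompact_Icc
  let x : ℕ → ProbabilityMeasure ℝ × ℝ := fun n => (⟨μ (ns n), inferInstance⟩, q (ns n))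
  let _ : MetricSpace (ProbabilityMeasure ℝ) := TopologicalSpace.metrizableSpaceMetric _
  obtain ⟨⟨ν, q0⟩, hmem, φ, hφ, hlim⟩ := hprod.tendsto_subseq (x := x)
    (fun n => ⟨subset_closure ⟨ns n, rfl⟩, hq _⟩)
  refine ⟨φ, ?_⟩
  have hlim1 : Tendsto (fun n => (x (φ n)).1) atTop (𝓝 ν) :=
    (continuous_fst.tendsto _).comp hlim
  have hlim2 : Tendsto (fun n => q (ns (φ n))) atTop (𝓝 q0) :=
    (continuous_snd.tendsto _).comp hlim
  have hsub : Tendsto (fun n => ns (φ n)) atTop atTop := hns.comp hφ.tendsto_atTop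
  -- The bound on the moment generating function at 2r is a second-moment bound for exp(r y), as the
  -- truncation lemma requires.
  have hsq : ∀ (t x : ℝ), Real.exp (t * x) ^ 2 = Real.exp (2 * t * x) := fun t x => by
    rw [← Real.exp_nat_mul]; push_cast; ring_nf
  have hintsq : ∀ (r : ℚ) n, Integrable (fun y => Real.exp (r * y) ^ 2)
      ((x (φ n)).1 : Measure ℝ) := fun r n => by
    simp_rw [hsq]; exact hint _ _
  have hintν : ∀ t : ℝ, Integrable (fun y => Real.exp (t * y)) (ν : Measure ℝ) := by
    have hr : ∀ r : ℚ, Integrable (fun y => Real.exp (2 * r * y)) (ν : Measure ℝ) := by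
      intro r
      obtain ⟨C, hC⟩ := bdd (2 * r)
      have := (integrable_sq_of_tendsto hlim1 (f := fun y => Real.exp (r * y)) (by fun_prop)
        (hintsq r) (C := C) (fun n => by
          have := hC (ns (φ n)); simp_rw [hsq]; push_cast at this; exact this)).1
      simpa only [hsq] using this
    intro t
    obtain ⟨r, hr1⟩ := exists_rat_gt (|t|)
    refine ((hr (r / 2)).add (hr (-r / 2))).mono' (by fun_prop) (ae_of_all _ fun y => ?_)
    rw [Real.norm_of_nonneg (Real.exp_pos _).le]
    simp only [Pi.add_apply]
    push_cast
    have h1 : t * y ≤ |t| * |y| := by rw [← abs_mul]; exact le_abs_self _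
    have h2 : |t| * |y| ≤ r * |y| := by gcongr
    rcases le_total 0 y with hy | hy
    · rw [abs_of_nonneg hy] at h1 h2
      have : Real.exp (t * y) ≤ Real.exp (2 * (r / 2) * y) := Real.exp_le_exp.2 (by linarith)
      linarith [Real.exp_pos (2 * (-r / 2) * y)]
    · rw [abs_of_nonpos hy] at h1 h2
      have : Real.exp (t * y) ≤ Real.exp (2 * (-r / 2) * y) := Real.exp_le_exp.2 (by linarith)
      linarith [Real.exp_pos (2 * (r / 2) * y)]
  have hmgfν : ∀ r : ℚ, mgf id (ν : Measure ℝ) r = Real.exp ((r : ℝ) ^ 2 * q0 / 2) := by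
    intro r
    obtain ⟨C, hC⟩ := bdd (2 * r)
    have h1 : Tendsto (fun n => mgf id (μ (ns (φ n))) r) atTop (𝓝 (mgf id (ν : Measure ℝ) r)) :=
      tendsto_integral_of_sq_bounded hlim1 (f := fun y => Real.exp (r * y)) (by fun_prop)
        (fun _ => (Real.exp_pos _).le) (hintsq r) (C := C) (fun n => by
          have := hC (ns (φ n)); simp_rw [hsq]; push_cast at this; exact this)
    have h2 : Tendsto (fun n => mgf id (μ (ns (φ n))) r) atTop
        (𝓝 (Real.exp ((r : ℝ) ^ 2 * q0 / 2))) := by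
      have h3 := ((hmgf r).comp hsub).add
        ((Real.continuous_exp.tendsto _).comp ((hlim2.const_mul ((r : ℝ) ^ 2)).div_const 2))
      simpa [Function.comp_def] using h3
    exact tendsto_nhds_unique h1 h2
  have hchar := charFun_eq_of_mgf_rat hintν hmem.2.1 hmgfν
  have h4 := ProbabilityMeasure.tendsto_iff_tendsto_charFun.1 hlim1 1
  have h5 : Tendsto (fun n => ((Real.exp (-q (ns (φ n)) / 2) : ℝ) : ℂ)) atTop
      (𝓝 (Real.exp (-q0 / 2) : ℝ)) :=
    (Complex.continuous_ofReal.tendsto _).comp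
      ((Real.continuous_exp.tendsto _).comp (hlim2.neg.div_const 2))
  have h6 := h4.sub h5
  rw [hchar, sub_self] at h6
  exact h6

/-- If finitely many values of a moment generating function are close to those of `N(0, q)`, then
the characteristic function is close to that of `N(0, q)`. -/
theorem exists_finset_norm_charFun_sub_le (R : ℝ) {ε : ℝ} (hε : 0 < ε) :
    ∃ δ > (0 : ℝ), ∃ Λ : Finset ℚ, ∀ (μ : Measure ℝ) [IsProbabilityMeasure μ] (q : ℝ),
      q ∈ Set.Icc 0 R → (∀ t : ℝ, Integrable (fun x => Real.exp (t * x)) μ) →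
      (∀ r ∈ Λ, |mgf id μ r - Real.exp ((r : ℝ) ^ 2 * q / 2)| ≤ δ) →
      ‖charFun μ 1 - Real.exp (-q / 2)‖ ≤ ε := by
  -- If no δ and finite set worked, there would be for each n a bad law matching the first n
  -- rationals up to 1/(n + 1). Such a sequence contradicts the sequential statement.
  by_contra! hcon
  obtain ⟨e, he⟩ := exists_surjective_nat ℚ
  have := fun n : ℕ => hcon (1 / (n + 1)) (by positivity) ((Finset.range n).image e)
  choose μ hμ q hq hint hmgf hbad using this
  have hlim := tendsto_charFun_of_tendsto_mgf (μ := μ) hq hint fun r => by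
    obtain ⟨k, rfl⟩ := he r
    refine squeeze_zero_norm' ?_ (tendsto_one_div_add_atTop_nhds_zero_nat (𝕜 := ℝ))
    filter_upwards [eventually_gt_atTop k] with n hn
    exact hmgf n _ (Finset.mem_image_of_mem _ (Finset.mem_range.2 hn))
  obtain ⟨n, hn⟩ := ((tendsto_zero_iff_norm_tendsto_zero.1 hlim).eventually_lt_const hε).exists
  exact absurd hn (not_lt.2 (hbad n).le)

/-! ### Convex functions -/

/-- Convex functions which are close on a suitable finite set are close on a ball. -/
theorem exists_finset_abs_sub_le_of_convexOn {E : Type*} [NormedAddCommGroup E] [NormedSpace ℝ E]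
    [FiniteDimensional ℝ E] {R ε : ℝ} (hR : 0 < R) (hε : 0 < ε) :
    ∃ δ > (0 : ℝ), ∃ F : Finset E, ∀ f g : E → ℝ, ConvexOn ℝ Set.univ f → ConvexOn ℝ Set.univ g →
      (∀ u, 0 ≤ f u) → (∀ u, 0 ≤ g u) → (∀ u, g u ≤ ‖u‖ ^ 2) →
      (∀ u ∈ F, |f u - g u| ≤ δ) → ∀ u, ‖u‖ ≤ R → |f u - g u| ≤ ε := by
  classical
  have : ProperSpace E := FiniteDimensional.proper ℝ E
  -- A convex function is bounded on the hull of V by its maximum on V. A bound on the ball of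
  -- radius 2R makes it Lipschitz on the ball of radius R, with a constant that does not depend on
  -- the function.
  obtain ⟨V, hV, -⟩ :=
    (convex_closedBall (0 : E) (2 * R)).exists_subset_interior_convexHull_finset_of_isCompact
      (isCompact_closedBall _ _) (t := Set.univ) univ_mem
  obtain ⟨M0, hM0⟩ : ∃ M0 : ℝ, ∀ v ∈ V, ‖v‖ ≤ M0 := by
    obtain ⟨M0, h⟩ := (V.finite_toSet.image fun v => ‖v‖).bddAbove
    exact ⟨M0, fun v hv => h ⟨v, hv, rfl⟩⟩
  set M := M0 ^ 2 + 1 with hM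
  have hMpos : 0 < M := by positivity
  set L := 2 * M / (R / 2) with hL
  have hLpos : 0 < L := by positivity
  set r := ε / (4 * L) with hr
  have hrpos : 0 < r := by positivity
  -- With a common Lipschitz constant L, agreement on a net of mesh ε/(4L) decides the matter on the
  -- whole ball.
  obtain ⟨t, htR, htf, htc⟩ := (isCompact_closedBall (0 : E) R).finite_cover_balls hrpos
  refine ⟨min 1 (ε / 4), by positivity, V ∪ htf.toFinset, ?_⟩
  intro f g hf hg hf0 hg0 hgle hclose
  have hgM : ∀ v ∈ V, g v ≤ M := fun v hv => (hgle v).trans (by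
    have := hM0 v hv; have := norm_nonneg v; nlinarith)
  have bound : ∀ k : E → ℝ, ConvexOn ℝ Set.univ k → (∀ u, 0 ≤ k u) → (∀ v ∈ V, k v ≤ M) →
      ∀ u v, ‖u‖ ≤ R → ‖v‖ ≤ R → |k u - k v| ≤ L * ‖u - v‖ := by
    intro k hk hk0 hkV u v hu hv
    have hb : ∀ a, dist a 0 < 2 * R → |k a| ≤ M := fun a ha => by
      rw [abs_of_nonneg (hk0 a)]
      obtain ⟨y, hy, hay⟩ := hk.exists_ge_of_mem_convexHull (Set.subset_univ _)
        (interior_subset (hV (Metric.mem_closedBall.2 ha.le)))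
      exact hay.trans (hkV y hy)
    have hlip := (hk.subset (Set.subset_univ _)
      (convex_ball (0 : E) (2 * R))).lipschitzOnWith_of_abs_le (ε := R / 2) (by positivity) hb
    have := hlip.dist_le_mul u (by rw [mem_ball_zero_iff]; linarith) v
      (by rw [mem_ball_zero_iff]; linarith)
    rwa [Real.dist_eq, Real.coe_toNNReal _ hLpos.le, dist_eq_norm] at this
  have hfM : ∀ v ∈ V, f v ≤ M := fun v hv => by
    have h1 := (abs_le.1 (hclose v (Finset.mem_union_left _ hv))).2
    have h2 := hgle v
    have h3 : ‖v‖ ^ 2 ≤ M0 ^ 2 := by have := hM0 v hv; gcongr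
    have h4 := min_le_left 1 (ε / 4)
    linarith
  intro u hu
  obtain ⟨v, hvt, huv⟩ := Set.mem_iUnion₂.1 (htc (mem_closedBall_zero_iff.2 hu))
  rw [Metric.mem_ball, dist_eq_norm] at huv
  have hv : ‖v‖ ≤ R := mem_closedBall_zero_iff.1 (htR hvt)
  have h1 := bound f hf hf0 hfM u v hu hv
  have h2 := bound g hg hg0 hgM u v hu hv
  have h3 := (hclose v (Finset.mem_union_right _ (htf.mem_toFinset.2 hvt))).trans
    (min_le_right _ _)
  have h4 : L * ‖u - v‖ ≤ ε / 4 := by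
    calc L * ‖u - v‖ ≤ L * r := by gcongr
      _ = ε / 4 := by rw [hr]; field_simp
  rw [abs_le] at h1 h2 h3 ⊢
  constructor <;> linarith [h1.1, h1.2, h2.1, h2.2, h3.1, h3.2]

end RENSEM


namespace RENSEM

/-! ### Events of high probability along a sequence of probability spaces -/

section Events

variable {Ω : ℕ → Type*} [∀ N, MeasurableSpace (Ω N)]

/-- Eventually the event has (outer) probability at least `1 - δ`. -/
def ProbGe (P : ∀ N, Measure (Ω N)) (δ : ℝ≥0∞) (s : ∀ N, Set (Ω N)) : Prop :=
  ∀ᶠ N in atTop, P N (s N)ᶜ ≤ δ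

/-- The probability of the event tends to `1`. -/
def Whp (P : ∀ N, Measure (Ω N)) (s : ∀ N, Set (Ω N)) : Prop :=
  ∀ δ : ℝ≥0∞, 0 < δ → ProbGe P δ s

variable {P : ∀ N, Measure (Ω N)} {s t : ∀ N, Set (Ω N)} {δ δ' : ℝ≥0∞}

theorem ProbGe.mono (hs : ProbGe P δ s) (h : ∀ᶠ N in atTop, s N ⊆ t N) : ProbGe P δ t := by
  filter_upwards [hs, h] with N h1 h2
  exact (measure_mono (Set.compl_subset_compl.2 h2)).trans h1

theorem Whp.mono (hs : Whp P s) (h : ∀ᶠ N in atTop, s N ⊆ t N) : Whp P t :=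
  fun δ hδ => (hs δ hδ).mono h

theorem ProbGe.inter (hs : ProbGe P δ s) (ht : ProbGe P δ' t) :
    ProbGe P (δ + δ') fun N => s N ∩ t N := by
  filter_upwards [hs, ht] with N h1 h2
  rw [Set.compl_inter]
  exact (measure_union_le _ _).trans (add_le_add h1 h2)

theorem Whp.inter (hs : Whp P s) (ht : Whp P t) : Whp P fun N => s N ∩ t N := by
  intro δ hδ
  have h2 : 0 < δ / 2 := ENNReal.half_pos hδ.ne'
  simpa [ENNReal.add_halves] using (hs _ h2).inter (ht _ h2)

theorem Whp.univ : Whp P fun _ => Set.univ := fun δ _ => Eventually.of_forall fun N => by simp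

theorem Whp.biInter {κ : Type*} (F : Finset κ) {s : κ → ∀ N, Set (Ω N)}
    (h : ∀ k ∈ F, Whp P (s k)) : Whp P fun N => {w | ∀ k ∈ F, w ∈ s k N} := by
  classical
  induction F using Finset.induction_on with
  | empty => exact Whp.univ.mono (Eventually.of_forall fun N w _ => by simp)
  | insert a F ha ih =>
    refine ((h a (Finset.mem_insert_self _ _)).inter
      (ih fun k hk => h k (Finset.mem_insert_of_mem hk))).mono (Eventually.of_forall ?_)
    rintro N w ⟨h1, h2⟩ k hk
    rcases Finset.mem_insert.1 hk with rfl | hk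
    · exact h1
    · exact h2 k hk

theorem ProbGe.iInter {κ : Type*} [Fintype κ] {s : κ → ∀ N, Set (Ω N)}
    (h : ∀ k, ProbGe P δ (s k)) :
    ProbGe P (Fintype.card κ * δ) fun N => {w | ∀ k, w ∈ s k N} := by
  filter_upwards [eventually_all.2 h] with N hN
  have : {w | ∀ k, w ∈ s k N}ᶜ = ⋃ k, (s k N)ᶜ := by ext; simp
  rw [this]
  refine (measure_iUnion_fintype_le _ _).trans ?_
  refine (Finset.sum_le_sum fun k _ => hN k).trans ?_
  simp

theorem ProbGe.of_le (hs : ProbGe P δ s) (h : δ ≤ δ') : ProbGe P δ' s := by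
  filter_upwards [hs] with N h1 using h1.trans h

/-- Events of the first coordinate of a product space. -/
theorem ProbGe.prod_fst {Ω' : ℕ → Type*} [∀ N, MeasurableSpace (Ω' N)]
    {Q : ∀ N, Measure (Ω' N)} [∀ N, IsProbabilityMeasure (Q N)] :
    ProbGe (fun N => (P N).prod (Q N)) δ (fun N => {w | w.1 ∈ s N}) ↔ ProbGe P δ s := by
  refine eventually_congr (Eventually.of_forall fun N => ?_)
  have : {w : Ω N × Ω' N | w.1 ∈ s N}ᶜ = (s N)ᶜ ×ˢ Set.univ := by ext; simp
  rw [this, Measure.prod_prod]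
  simp

theorem Whp.prod_fst {Ω' : ℕ → Type*} [∀ N, MeasurableSpace (Ω' N)]
    {Q : ∀ N, Measure (Ω' N)} [∀ N, IsProbabilityMeasure (Q N)] :
    Whp (fun N => (P N).prod (Q N)) (fun N => {w | w.1 ∈ s N}) ↔ Whp P s :=
  forall₂_congr fun _ _ => ProbGe.prod_fst

end Events

/-! ### Moments of `geomSup` -/

section Moments

variable {ι : Type*} [Fintype ι]

theorem lintegral_enorm_sum_sq_pi {ρ : Measure ℝ} [IsProbabilityMeasure ρ] {g : ℝ → ℝ}
    (hg : MemLp g 2 ρ) (hg0 : ∫ y, g y ∂ρ = 0) (c : ι → ℝ) :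
    ∫⁻ z, ‖∑ i, c i * g (z i)‖ₑ ^ 2 ∂(Measure.pi fun _ : ι => ρ)
      = ENNReal.ofReal (Var[g; ρ] * ∑ i, c i ^ 2) := by
  have hmem : ∀ i, MemLp (fun z : ι → ℝ => c i * g (z i)) 2 (Measure.pi fun _ : ι => ρ) := fun i =>
    (hg.comp_measurePreserving (measurePreserving_eval (fun _ : ι => ρ) i)).const_mul (c i)
  have hsum : MemLp (fun z : ι → ℝ => ∑ i, c i * g (z i)) 2 (Measure.pi fun _ : ι => ρ) :=
    memLp_finsetSum _ fun i _ => hmem i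
  have hmean : ∫ z, ∑ i, c i * g (z i) ∂(Measure.pi fun _ : ι => ρ) = 0 := by
    rw [integral_finsetSum _ fun i _ => (hmem i).integrable one_le_two]
    refine Finset.sum_eq_zero fun i _ => ?_
    rw [integral_const_mul]
    have := integral_comp_eval (μ := fun _ : ι => ρ) (i := i) (f := g) hg.aestronglyMeasurable
    rw [this, hg0, mul_zero]
  have hvar := variance_sum_pi (μ := fun _ : ι => ρ) (X := fun i y => c i * g y)
    fun i => hg.const_mul (c i)
  have e : (∑ i, fun z : ι → ℝ => c i * g (z i)) = fun z => ∑ i, c i * g (z i) := by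
    ext z; simp
  rw [e, variance_of_integral_eq_zero hsum.aemeasurable hmean] at hvar
  have h1 : ∀ z : ι → ℝ, ‖∑ i, c i * g (z i)‖ₑ ^ 2
      = ENNReal.ofReal ((∑ i, c i * g (z i)) ^ 2) := fun z => by
    rw [← enorm_pow, Real.enorm_of_nonneg (sq_nonneg _)]
  simp_rw [h1]
  rw [← ofReal_integral_eq_lintegral_ofReal hsum.integrable_sq (ae_of_all _ fun z => sq_nonneg _),
    hvar]
  congr 1
  rw [Finset.mul_sum]
  refine Finset.sum_congr rfl fun i _ => ?_
  rw [variance_const_mul, mul_comm]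

/-- The bound |y| ≤ S + y²/S turns the second moment into a first-moment bound of order S. -/
theorem lintegral_enorm_sum_pi_le {ρ : Measure ℝ} [IsProbabilityMeasure ρ] {g : ℝ → ℝ}
    (hg : MemLp g 2 ρ) (hg0 : ∫ y, g y ∂ρ = 0) {c : ι → ℝ} {S : ℝ} (hS : 0 < S)
    (hc : ∑ i, c i ^ 2 ≤ S ^ 2) :
    ∫⁻ z, ‖∑ i, c i * g (z i)‖ₑ ∂(Measure.pi fun _ : ι => ρ)
      ≤ ENNReal.ofReal ((1 + Var[g; ρ]) * S) := by
  have hpt : ∀ z : ι → ℝ, ‖∑ i, c i * g (z i)‖ₑ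
      ≤ ENNReal.ofReal S + ENNReal.ofReal (1 / S) * ‖∑ i, c i * g (z i)‖ₑ ^ 2 := fun z => by
    rw [← enorm_pow, Real.enorm_of_nonneg (sq_nonneg _), ← ENNReal.ofReal_mul (by positivity),
      ← ENNReal.ofReal_add hS.le (by positivity), ← ofReal_norm, Real.norm_eq_abs]
    refine ENNReal.ofReal_le_ofReal ?_
    rw [← sq_abs, one_div, inv_mul_eq_div, ← sub_le_iff_le_add', le_div_iff₀ hS]
    nlinarith [sq_nonneg (|∑ i, c i * g (z i)| - S), abs_nonneg (∑ i, c i * g (z i))]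
  have hV : 0 ≤ Var[g; ρ] := variance_nonneg _ _
  calc _ ≤ ∫⁻ z, (ENNReal.ofReal S + ENNReal.ofReal (1 / S) * ‖∑ i, c i * g (z i)‖ₑ ^ 2)
        ∂(Measure.pi fun _ : ι => ρ) := lintegral_mono hpt
    _ = ENNReal.ofReal S
        + ENNReal.ofReal (1 / S) * ENNReal.ofReal (Var[g; ρ] * ∑ i, c i ^ 2) := by
      rw [lintegral_add_left measurable_const, lintegral_const_mul' _ _ ENNReal.ofReal_ne_top,
        lintegral_enorm_sum_sq_pi hg hg0]
      simp
    _ ≤ _ := by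
      rw [← ENNReal.ofReal_mul (by positivity), ← ENNReal.ofReal_add hS.le (by positivity)]
      refine ENNReal.ofReal_le_ofReal ?_
      have : 1 / S * (Var[g; ρ] * ∑ i, c i ^ 2) ≤ 1 / S * (Var[g; ρ] * S ^ 2) := by gcongr
      have e : 1 / S * (Var[g; ρ] * S ^ 2) = Var[g; ρ] * S := by field_simp
      linarith

theorem measurable_geomSup {Ω : Type*} [MeasurableSpace Ω] {θ : ℝ} {a : ι → ℝ} {v : Ω → ι → ℝ}
    (hv : ∀ i, Measurable fun w => v w i) : Measurable fun w => geomSup θ a (v w) := by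
  unfold geomSup
  fun_prop

/-- Multiplying the coefficients by a_i^k or (1 − a_i)^k does not increase their ℓ² norm. All terms
of the series therefore share one bound, and the geometric weights sum to 1/(1 − θ). -/
theorem lintegral_geomSup_le {ρ : Measure ℝ} [IsProbabilityMeasure ρ] {g : ℝ → ℝ}
    (hgm : Measurable g) (hg : MemLp g 2 ρ) (hg0 : ∫ y, g y ∂ρ = 0) {θ : ℝ} (hθ0 : 0 ≤ θ)
    (hθ : θ < 1) {a : ι → ℝ} (ha : ∀ i, a i ∈ Set.Icc (0 : ℝ) 1) {c : ι → ℝ} {S : ℝ} (hS : 0 < S)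
    (hc : ∑ i, c i ^ 2 ≤ S ^ 2) :
    ∫⁻ z, geomSup θ a (fun i => g (z i) * c i) ∂(Measure.pi fun _ : ι => ρ)
      ≤ ENNReal.ofReal (2 / (1 - θ) * (1 + Var[g; ρ]) * S) := by
  have hV : 0 ≤ Var[g; ρ] := variance_nonneg _ _
  have hterm : ∀ (b : ι → ℝ), (∀ i, b i ∈ Set.Icc (0 : ℝ) 1) → ∀ k : ℕ,
      ∫⁻ z, ‖∑ i, g (z i) * c i * b i ^ k‖ₑ ∂(Measure.pi fun _ : ι => ρ)
        ≤ ENNReal.ofReal ((1 + Var[g; ρ]) * S) := fun b hb k => by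
    have e : ∀ z : ι → ℝ, ∑ i, g (z i) * c i * b i ^ k = ∑ i, (c i * b i ^ k) * g (z i) :=
      fun z => Finset.sum_congr rfl fun i _ => by ring
    simp_rw [e]
    refine lintegral_enorm_sum_pi_le hg hg0 hS (le_trans ?_ hc)
    refine Finset.sum_le_sum fun i _ => ?_
    rw [mul_pow]
    refine mul_le_of_le_one_right (sq_nonneg _) ?_
    exact pow_le_one₀ (pow_nonneg (hb i).1 _) (pow_le_one₀ (hb i).1 (hb i).2)
  unfold geomSup
  rw [lintegral_tsum fun k => by fun_prop]
  calc _ ≤ ∑' k : ℕ, ENNReal.ofReal (θ ^ k) * ENNReal.ofReal (2 * ((1 + Var[g; ρ]) * S)) := by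
        refine ENNReal.tsum_le_tsum fun k => ?_
        rw [lintegral_const_mul' _ _ ENNReal.ofReal_ne_top, lintegral_add_left (by fun_prop),
          two_mul, ENNReal.ofReal_add (by positivity) (by positivity)]
        gcongr
        · exact hterm a ha k
        · exact hterm (fun i => 1 - a i) (fun i => ⟨by linarith [(ha i).2], by linarith [(ha i).1]⟩) k
    _ = _ := by
      rw [ENNReal.tsum_mul_right, ← ENNReal.ofReal_tsum_of_nonneg (fun k => pow_nonneg hθ0 k)
        (summable_geometric_of_lt_one hθ0 hθ), tsum_geometric_of_lt_one hθ0 hθ,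
        ← ENNReal.ofReal_mul (inv_nonneg.2 (by linarith))]
      congr 1
      field_simp

/-- Conditional Chebyshev inequality for `geomSup`. -/
theorem prod_geomSup_lt_le {Ω : Type*} [MeasurableSpace Ω] {μ : Measure Ω}
    [IsProbabilityMeasure μ] {ρ : Measure ℝ} [IsProbabilityMeasure ρ] {g : ℝ → ℝ}
    (hgm : Measurable g) (hg : MemLp g 2 ρ) (hg0 : ∫ y, g y ∂ρ = 0) {θ : ℝ} (hθ0 : 0 ≤ θ)
    (hθ : θ < 1) {a : ι → ℝ} (ha : ∀ i, a i ∈ Set.Icc (0 : ℝ) 1) {c : Ω → ι → ℝ}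
    (hc : Measurable c) {S K : ℝ} (hS : 0 < S) (hK : 0 < K) :
    (μ.prod (Measure.pi fun _ : ι => ρ))
        {w | geomSup θ a (fun i => g (w.2 i) * c w.1 i) ≤ ENNReal.ofReal K}ᶜ
      ≤ μ {ω | ∑ i, c ω i ^ 2 ≤ S ^ 2}ᶜ
        + ENNReal.ofReal (2 / (1 - θ) * (1 + Var[g; ρ]) * S / K) := by
  set G : Set Ω := {ω | ∑ i, c ω i ^ 2 ≤ S ^ 2} with hG
  have hGm : MeasurableSet G := measurableSet_le (by fun_prop) measurable_const
  -- Setting the coefficients to zero off the good event makes the conditional bound valid for every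
  -- ω, so that the iterated integral can be bounded without exception.
  set c' : Ω → ι → ℝ := G.indicator c with hc'
  have hc'm : Measurable c' := hc.indicator hGm
  have hc'S : ∀ ω, ∑ i, c' ω i ^ 2 ≤ S ^ 2 := fun ω => by
    by_cases h : ω ∈ G
    · rw [hc', Set.indicator_of_mem h]; exact h
    · rw [hc', Set.indicator_of_notMem h]; simp; positivity
  have hmeas : Measurable fun w : Ω × (ι → ℝ) => geomSup θ a (fun i => g (w.2 i) * c' w.1 i) :=
    measurable_geomSup fun i => by fun_prop
  have hsub : {w : Ω × (ι → ℝ) | geomSup θ a (fun i => g (w.2 i) * c w.1 i) ≤ ENNReal.ofReal K}ᶜ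
      ⊆ Gᶜ ×ˢ Set.univ
        ∪ {w | ENNReal.ofReal K ≤ geomSup θ a (fun i => g (w.2 i) * c' w.1 i)} := by
    intro w hw
    by_cases h : w.1 ∈ G
    · right
      have : c' w.1 = c w.1 := by rw [hc', Set.indicator_of_mem h]
      have hw' : ¬geomSup θ a (fun i => g (w.2 i) * c w.1 i) ≤ ENNReal.ofReal K := hw
      change ENNReal.ofReal K ≤ geomSup θ a (fun i => g (w.2 i) * c' w.1 i)
      rw [this]
      exact (not_le.1 hw').le
    · left; exact ⟨h, trivial⟩
  refine (measure_mono hsub).trans ((measure_union_le _ _).trans (add_le_add ?_ ?_))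
  · rw [Measure.prod_prod]; simp
  · refine (meas_ge_le_lintegral_div hmeas.aemeasurable (by simpa using hK)
      ENNReal.ofReal_ne_top).trans ?_
    rw [ENNReal.ofReal_div_of_pos hK]
    gcongr
    rw [lintegral_prod _ hmeas.aemeasurable]
    calc _ ≤ ∫⁻ _, ENNReal.ofReal (2 / (1 - θ) * (1 + Var[g; ρ]) * S) ∂μ :=
          lintegral_mono fun ω => lintegral_geomSup_le hgm hg hg0 hθ0 hθ ha hS (hc'S ω)
      _ = _ := by simp

end Moments

end RENSEM


namespace RENSEM

/-! ### Local asymptotic normality of a block of the log-likelihood -/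

section Blocks

variable {κ : Type*} [Fintype κ]

/-- A part `ℓ` of a log-likelihood ratio with score `s` and quadratic form `q`, in normalized
coordinates `u`: global control over the parameter set `D`, and local expansion. -/
structure IsLANBlock {Ω : ℕ → Type*} [∀ N, MeasurableSpace (Ω N)] (P : ∀ N, Measure (Ω N))
    (D : ℕ → Set (EuclideanSpace ℝ κ)) (ℓ s : ∀ N, Ω N → EuclideanSpace ℝ κ → ℝ)
    (q : ℕ → EuclideanSpace ℝ κ → ℝ) : Prop where
  global : ∀ δ : ℝ≥0∞, 0 < δ → ∃ A : ℝ, ProbGe P δ fun N =>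
    {w | ∀ u ∈ D N, ℓ N w u ≤ A - Real.sqrt (q N u)}
  local' : ∀ R > 0, ∀ ε > 0, Whp P fun N =>
    {w | ∀ u, ‖u‖ ≤ R → |ℓ N w u - s N w u + q N u / 2| ≤ ε}

/-- The law of `N` independent standard normal variables. -/
noncomputable abbrev stdNormals (N : ℕ) : Measure (Fin N → ℝ) :=
  Measure.pi fun _ => gaussianReal 0 1

/-- Asymptotic regularity of a Gaussian linear model with two variance components, in whitened
coordinates: `w` is the linearized relative change of the variances, `x` that of the means. -/
structure IsGaussBlock {Ω : ℕ → Type*} [∀ N, MeasurableSpace (Ω N)] (P : ∀ N, Measure (Ω N))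
    (D : ℕ → Set (EuclideanSpace ℝ κ)) (w : ∀ N, EuclideanSpace ℝ κ →ₗ[ℝ] (Fin N → ℝ))
    (x : ∀ N, Ω N → EuclideanSpace ℝ κ →ₗ[ℝ] (Fin N → ℝ))
    (q : ℕ → EuclideanSpace ℝ κ → ℝ) : Prop where
  meas : ∀ N u, Measurable fun ω => x N ω u
  proj : ∀ᶠ N in atTop, ∀ u, ∃ u', ‖u'‖ ^ 2 = q N u ∧ q N u' = q N u ∧ w N u' = w N u ∧
    ∀ ω, x N ω u' = x N ω u
  q_le : ∀ᶠ N in atTop, ∀ u, q N u ≤ ‖u‖ ^ 2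
  quad : ∀ ε > 0, Whp P fun N => {ω | ∀ u, |gquad (w N u) (x N ω u) - q N u| ≤ ε * ‖u‖ ^ 2}
  small : ∀ ε > 0, ∀ᶠ N in atTop, ∀ u i, |w N u i| ≤ ε * ‖u‖
  range : ∃ m M : ℝ, 0 < m ∧ 1 ≤ M ∧ m ≤ M ∧ ∀ᶠ N in atTop, ∃ a : Fin N → ℝ,
    (∀ i, a i ∈ Set.Icc (0 : ℝ) 1) ∧ ∀ u ∈ D N, ∃ σ ∈ Set.Icc m M, ∃ τ ∈ Set.Icc m M,
      ∀ i, 1 + w N u i = σ * a i + τ * (1 - a i)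
  ball : ∀ R, ∀ᶠ N in atTop, ∀ u, ‖u‖ ≤ R → u ∈ D N

theorem memLp_id_stdNormal : MemLp (fun y : ℝ => y) 2 (gaussianReal 0 1) :=
  memLp_id_gaussianReal' 2 (by simp)

theorem memLp_sq_sub_one_stdNormal : MemLp (fun y : ℝ => y ^ 2 - 1) 2 (gaussianReal 0 1) := by
  have h4 : MemLp (fun y : ℝ => y) 4 (gaussianReal 0 1) := memLp_id_gaussianReal' 4 (by simp)
  have h2 : MemLp (fun y : ℝ => y ^ 2) 2 (gaussianReal 0 1) := by
    have : ENNReal.HolderTriple 4 4 2 := ⟨by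
      rw [← two_mul]
      have : (4 : ℝ≥0∞) = 2 * 2 := by norm_num
      rw [this, ENNReal.mul_inv (by simp) (by simp), ← mul_assoc,
        ENNReal.mul_inv_cancel (by simp) (by simp), one_mul]⟩
    have := h4.mul h4 (r := 2)
    simpa [pow_two, Pi.mul_def] using this
  exact h2.sub (memLp_const 1)

theorem integral_id_stdNormal : ∫ y : ℝ, y ∂(gaussianReal 0 1) = 0 := integral_id_gaussianReal

theorem integral_sq_stdNormal : ∫ y : ℝ, y ^ 2 ∂(gaussianReal 0 1) = 1 := by
  have h := variance_fun_id_gaussianReal (μ := 0) (v := 1)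
  rw [variance_of_integral_eq_zero (by fun_prop) integral_id_stdNormal] at h
  simpa using h

theorem integral_sq_sub_one_stdNormal : ∫ y : ℝ, (y ^ 2 - 1) ∂(gaussianReal 0 1) = 0 := by
  rw [integral_sub (memLp_id_stdNormal.integrable_sq) (integrable_const 1), integral_sq_stdNormal]
  simp

/-! ### Stochastic bounds for `geomSup`. -/

section Geom

variable {Ω : ℕ → Type*} [∀ N, MeasurableSpace (Ω N)] {P : ∀ N, Measure (Ω N)}
  [∀ N, IsProbabilityMeasure (P N)] {g : ℝ → ℝ} {θ : ℝ} {a : ∀ N, Fin N → ℝ}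
  {c : ∀ N, Ω N → Fin N → ℝ}

/-- Stochastic boundedness when the ℓ² norm of the coefficients is bounded. All larger thresholds
are included so that finitely many directions can share one. -/
theorem exists_probGe_geomSup (hgm : Measurable g) (hg : MemLp g 2 (gaussianReal 0 1))
    (hg0 : ∫ y, g y ∂(gaussianReal 0 1) = 0) (hθ0 : 0 ≤ θ) (hθ : θ < 1)
    (ha : ∀ᶠ N in atTop, ∀ i, a N i ∈ Set.Icc (0 : ℝ) 1) (hc : ∀ N, Measurable (c N)) {S : ℝ}
    (hS : 0 < S) (hcS : Whp P fun N => {ω | ∑ i, c N ω i ^ 2 ≤ S ^ 2}) {δ : ℝ≥0∞} (hδ : 0 < δ) :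
    ∃ K : ℝ, 0 < K ∧ ∀ K' ≥ K, ProbGe (fun N => (P N).prod (stdNormals N)) δ fun N =>
      {w | geomSup θ (a N) (fun i => g (w.2 i) * c N w.1 i) ≤ ENNReal.ofReal K'} := by
  have hV : 0 ≤ Var[g; gaussianReal 0 1] := variance_nonneg _ _
  set C := 2 / (1 - θ) * (1 + Var[g; gaussianReal 0 1]) * S with hC
  have hC0 : 0 < C := by
    have : 0 < 1 - θ := by linarith
    positivity
  have h2 : 0 < δ / 2 := ENNReal.half_pos hδ.ne'
  obtain ⟨η, hη0, hη⟩ : ∃ η : ℝ, 0 < η ∧ ENNReal.ofReal η ≤ δ / 2 := by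
    rcases eq_or_ne (δ / 2) ∞ with h | h
    · exact ⟨1, one_pos, by rw [h]; exact le_top⟩
    · exact ⟨(δ / 2).toReal, ENNReal.toReal_pos h2.ne' h, ENNReal.ofReal_toReal h |>.le⟩
  refine ⟨C / η, by positivity, fun K' hK' => ?_⟩
  have hK0 : 0 < K' := lt_of_lt_of_le (by positivity) hK'
  filter_upwards [ha, hcS _ h2] with N haN hN
  refine (prod_geomSup_lt_le hgm hg hg0 hθ0 hθ haN (hc N) hS hK0).trans ?_
  rw [← ENNReal.add_halves δ]
  refine add_le_add hN ((ENNReal.ofReal_le_ofReal ?_).trans hη)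
  rw [div_le_iff₀ hK0]
  rw [ge_iff_le, div_le_iff₀ hη0] at hK'
  linarith

theorem whp_geomSup (hgm : Measurable g) (hg : MemLp g 2 (gaussianReal 0 1))
    (hg0 : ∫ y, g y ∂(gaussianReal 0 1) = 0) (hθ0 : 0 ≤ θ) (hθ : θ < 1)
    (ha : ∀ᶠ N in atTop, ∀ i, a N i ∈ Set.Icc (0 : ℝ) 1) (hc : ∀ N, Measurable (c N))
    (hcS : ∀ S > 0, Whp P fun N => {ω | ∑ i, c N ω i ^ 2 ≤ S ^ 2}) {K : ℝ} (hK : 0 < K) :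
    Whp (fun N => (P N).prod (stdNormals N)) fun N =>
      {w | geomSup θ (a N) (fun i => g (w.2 i) * c N w.1 i) ≤ ENNReal.ofReal K} := by
  intro δ hδ
  have hV : 0 ≤ Var[g; gaussianReal 0 1] := variance_nonneg _ _
  have h2 : 0 < δ / 2 := ENNReal.half_pos hδ.ne'
  obtain ⟨η, hη0, hη⟩ : ∃ η : ℝ, 0 < η ∧ ENNReal.ofReal η ≤ δ / 2 := by
    rcases eq_or_ne (δ / 2) ∞ with h | h
    · exact ⟨1, one_pos, by rw [h]; exact le_top⟩
    · exact ⟨(δ / 2).toReal, ENNReal.toReal_pos h2.ne' h, ENNReal.ofReal_toReal h |>.le⟩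
  set C := 2 / (1 - θ) * (1 + Var[g; gaussianReal 0 1]) with hC
  have hC0 : 0 < C := by
    have : 0 < 1 - θ := by linarith
    positivity
  -- At this value of S the Chebyshev bound C·S/K is exactly η.
  have hS : 0 < K * η / C := by positivity
  filter_upwards [ha, hcS _ hS _ h2] with N haN hN
  refine (prod_geomSup_lt_le hgm hg hg0 hθ0 hθ haN (hc N) hS hK).trans ?_
  rw [← ENNReal.add_halves δ]
  refine add_le_add hN ((ENNReal.ofReal_le_ofReal (le_of_eq ?_)).trans hη)
  rw [← hC]
  field_simp

end Geom

theorem linearMap_apply_eq_sum {V : Type*} [AddCommGroup V] [Module ℝ V] [DecidableEq κ]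
    (L : EuclideanSpace ℝ κ →ₗ[ℝ] V) (u : EuclideanSpace ℝ κ) :
    L u = ∑ j, u j • L (EuclideanSpace.single j 1) := by
  conv_lhs => rw [← (EuclideanSpace.basisFun κ ℝ).sum_repr u]
  simp

theorem abs_apply_le_norm (u : EuclideanSpace ℝ κ) (j : κ) : |u j| ≤ ‖u‖ :=
  PiLp.norm_apply_le u j

/-- From coordinate directions to all directions, for sums linear in the direction. -/
theorem abs_sum_linear_div_le [DecidableEq κ] {N : ℕ} (L : EuclideanSpace ℝ κ →ₗ[ℝ] (Fin N → ℝ))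
    {ξ ρ : Fin N → ℝ} {B : ℝ}
    (hB : ∀ j, |∑ i, ξ i * L (EuclideanSpace.single j 1) i / ρ i| ≤ B)
    (u : EuclideanSpace ℝ κ) :
    |∑ i, ξ i * L u i / ρ i| ≤ ‖u‖ * (Fintype.card κ * B) := by
  have e : ∑ i, ξ i * L u i / ρ i
      = ∑ j, u j * ∑ i, ξ i * L (EuclideanSpace.single j 1) i / ρ i := by
    simp_rw [Finset.mul_sum]
    rw [Finset.sum_comm]
    refine Finset.sum_congr rfl fun i _ => ?_
    rw [linearMap_apply_eq_sum L u, Finset.sum_apply, Finset.mul_sum, Finset.sum_div]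
    refine Finset.sum_congr rfl fun j _ => ?_
    simp only [Pi.smul_apply, smul_eq_mul]
    ring
  rw [e]
  calc _ ≤ ∑ j : κ, ‖u‖ * B := by
        refine (Finset.abs_sum_le_sum_abs _ _).trans (Finset.sum_le_sum fun j _ => ?_)
        rw [abs_mul]
        exact mul_le_mul (abs_apply_le_norm u j) (hB j) (abs_nonneg _) (norm_nonneg _)
    _ = _ := by simp; ring

theorem abs_sum_bilinear_div_le [DecidableEq κ] {N : ℕ}
    (L L' : EuclideanSpace ℝ κ →ₗ[ℝ] (Fin N → ℝ)) {ξ ρ : Fin N → ℝ} {B : ℝ}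
    (hB : ∀ j k, |∑ i, ξ i * (L (EuclideanSpace.single j 1) i
      * L' (EuclideanSpace.single k 1) i) / ρ i| ≤ B) (u : EuclideanSpace ℝ κ) :
    |∑ i, ξ i * (L u i * L' u i) / ρ i| ≤ ‖u‖ ^ 2 * (Fintype.card κ ^ 2 * B) := by
  have h1 : ∀ j, |∑ i, (ξ i * L (EuclideanSpace.single j 1) i) * L' u i / ρ i|
      ≤ ‖u‖ * (Fintype.card κ * B) := fun j =>
    abs_sum_linear_div_le L' (fun k => by simpa only [mul_assoc] using hB j k) u
  have h2 := abs_sum_linear_div_le L (ξ := fun i => ξ i * L' u i) (ρ := ρ)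
    (B := ‖u‖ * (Fintype.card κ * B)) (fun j => by
      have := h1 j
      simp only [mul_right_comm] at this ⊢
      exact this) u
  refine (le_of_eq ?_).trans (h2.trans (le_of_eq (by ring)))
  congr 1
  exact Finset.sum_congr rfl fun i _ => by ring

theorem abs_sum_div_le_of_geomSup_le {ι : Type*} [Fintype ι] {m M σ τ K : ℝ} {a v ρ : ι → ℝ}
    (hm : 0 < m) (hK : 0 ≤ K)
    (hσ : σ ∈ Set.Icc m M) (hτ : τ ∈ Set.Icc m M) (ha : ∀ i, a i ∈ Set.Icc (0 : ℝ) 1)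
    (hρ : ∀ i, ρ i = σ * a i + τ * (1 - a i))
    (h : geomSup (1 - m / M) a v ≤ ENNReal.ofReal K) : |∑ i, v i / ρ i| ≤ 1 / m * K := by
  have h1 := (enorm_sum_div_le_geomSup (v := v) hm hσ hτ ha hρ).trans
    (mul_le_mul_right h _)
  rw [← ENNReal.ofReal_mul (by positivity), ← ofReal_norm, Real.norm_eq_abs] at h1
  exact (ENNReal.ofReal_le_ofReal_iff (by positivity)).1 h1

theorem sum_sq_le_gquad {ι : Type*} [Fintype ι] (w x : ι → ℝ) :
    ∑ i, x i ^ 2 ≤ gquad w x ∧ ∑ i, w i ^ 2 ≤ 2 * gquad w x := by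
  unfold gquad
  rw [Finset.mul_sum]
  exact ⟨Finset.sum_le_sum fun i _ => by nlinarith [sq_nonneg (w i)],
    Finset.sum_le_sum fun i _ => by nlinarith [sq_nonneg (x i)]⟩

/-! ### Local asymptotic normality of Gaussian blocks. -/

section GaussBlock

variable {Ω : ℕ → Type*} [∀ N, MeasurableSpace (Ω N)] {P : ∀ N, Measure (Ω N)}
  {D : ℕ → Set (EuclideanSpace ℝ κ)}
  {w : ∀ N, EuclideanSpace ℝ κ →ₗ[ℝ] (Fin N → ℝ)}
  {x : ∀ N, Ω N → EuclideanSpace ℝ κ →ₗ[ℝ] (Fin N → ℝ)} {q : ℕ → EuclideanSpace ℝ κ → ℝ}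

theorem IsGaussBlock.whp_sum_sq (h : IsGaussBlock P D w x q) :
    Whp P fun N => {ω | ∀ u, gquad (w N u) (x N ω u) ≤ 2 * ‖u‖ ^ 2} := by
  refine (h.quad 1 one_pos).mono ?_
  filter_upwards [h.q_le] with N hN ω hω u
  have h1 := (abs_le.1 (hω u)).2
  have h2 := hN u
  change _ ≤ _
  linarith

/-- Globally, a drift of order −q competes with noise of order √q; completing the square leaves a
constant minus √q. Locally, the remaining noise has coefficients w_j w_k and x_j w_k, whose ℓ² norms
vanish because max |w_i| → 0. In both parts the numerators are linear or bilinear in u, so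
coordinate directions suffice, and `geomSup` takes care of the dependence of the denominators on u.
-/
theorem IsGaussBlock.isLANBlock [∀ N, IsProbabilityMeasure (P N)] [DecidableEq κ]
    (h : IsGaussBlock P D w x q) :
    IsLANBlock (fun N => (P N).prod (stdNormals N)) D
      (fun N ω u => gdev (w N u) (x N ω.1 u) ω.2)
      (fun N ω u => gscore (w N u) (x N ω.1 u) ω.2) q := by
  obtain ⟨m, M, hm, hM, hmM, hrange⟩ := h.range
  have hM0 : 0 < M := by linarith
  have hθ0 : 0 ≤ 1 - m / M := by rw [sub_nonneg, div_le_one hM0]; exact hmM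
  have hθ1 : 1 - m / M < 1 := by have : 0 < m / M := by positivity
                                 linarith
  -- choose the coefficients `a`
  obtain ⟨a, ha⟩ : ∃ a : ∀ N, Fin N → ℝ, ∀ᶠ N in atTop, (∀ i, a N i ∈ Set.Icc (0 : ℝ) 1) ∧
      ∀ u ∈ D N, ∃ σ ∈ Set.Icc m M, ∃ τ ∈ Set.Icc m M,
        ∀ i, 1 + w N u i = σ * a N i + τ * (1 - a N i) := by
    classical
    refine ⟨fun N => if hN : ∃ a : Fin N → ℝ, (∀ i, a i ∈ Set.Icc (0 : ℝ) 1) ∧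
      ∀ u ∈ D N, ∃ σ ∈ Set.Icc m M, ∃ τ ∈ Set.Icc m M,
        ∀ i, 1 + w N u i = σ * a i + τ * (1 - a i) then hN.choose else 0, ?_⟩
    filter_upwards [hrange] with N hN
    rw [dif_pos hN]
    exact hN.choose_spec
  have ha1 : ∀ᶠ N in atTop, ∀ i, a N i ∈ Set.Icc (0 : ℝ) 1 := ha.mono fun N h => h.1
  have hsq := h.whp_sum_sq
  set e : κ → EuclideanSpace ℝ κ := fun j => EuclideanSpace.single j 1 with he
  have hnorm : ∀ j, ‖e j‖ = 1 := fun j => by simp [he]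
  have hW : ∀ j, Whp P fun N => {ω : Ω N | ∑ i, w N (e j) i ^ 2 ≤ (2 : ℝ) ^ 2} := fun j =>
    hsq.mono (Eventually.of_forall fun N ω hω => by
      have h1 := hω (e j)
      have h2 := (sum_sq_le_gquad (w N (e j)) (x N ω (e j))).2
      rw [hnorm] at h1
      rw [Set.mem_ofPred_eq]
      linarith)
  have hX : ∀ j, Whp P fun N => {ω : Ω N | ∑ i, x N ω (e j) i ^ 2 ≤ (2 : ℝ) ^ 2} := fun j =>
    hsq.mono (Eventually.of_forall fun N ω hω => by
      have h1 := hω (e j)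
      have h2 := (sum_sq_le_gquad (w N (e j)) (x N ω (e j))).1
      rw [hnorm] at h1
      rw [Set.mem_ofPred_eq]
      linarith)
  have prodSmall : ∀ (S : ℝ), 0 < S → ∀ j (v : ∀ N, Ω N → Fin N → ℝ),
      (Whp P fun N => {ω : Ω N | ∑ i, v N ω i ^ 2 ≤ (2 : ℝ) ^ 2}) →
      Whp P fun N => {ω : Ω N | ∑ i, (v N ω i * w N (e j) i) ^ 2 ≤ S ^ 2} := by
    intro S hS j v hv
    refine hv.mono ?_
    filter_upwards [h.small (S / 2) (by positivity)] with N hN ω hω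
    rw [Set.mem_ofPred_eq]
    calc ∑ i, (v N ω i * w N (e j) i) ^ 2 ≤ ∑ i, v N ω i ^ 2 * (S / 2) ^ 2 := by
          refine Finset.sum_le_sum fun i _ => ?_
          have h1 := hN (e j) i
          rw [hnorm, mul_one] at h1
          rw [mul_pow, ← sq_abs (w N (e j) i)]
          gcongr
      _ ≤ 2 ^ 2 * (S / 2) ^ 2 := by rw [← Finset.sum_mul]; gcongr; exact hω
      _ = _ := by ring
  have mg1 : Measurable fun y : ℝ => y ^ 2 - 1 := by fun_prop
  have mg2 : Measurable fun y : ℝ => y := measurable_id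
  refine ⟨?_, ?_⟩
  · intro δ hδ
    -- a common bound `K` for the fluctuations
    set n := Fintype.card κ with hn
    -- The probability budget is split into n events for the z² − 1 sums, n for the z sums, and one
    -- for the quadratic form.
    have hδ' : 0 < δ / (2 * n + 1) := ENNReal.div_pos hδ.ne' (by finiteness)
    choose K1 hK1 hP1 using fun j => exists_probGe_geomSup mg1 memLp_sq_sub_one_stdNormal
      integral_sq_sub_one_stdNormal hθ0 hθ1 ha1 (c := fun N _ => w N (e j))
      (fun N => measurable_const) two_pos (hW j) hδ'
    choose K2 hK2 hP2 using fun j => exists_probGe_geomSup mg2 memLp_id_stdNormal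
      integral_id_stdNormal hθ0 hθ1 ha1 (c := fun N ω => x N ω (e j))
      (fun N => h.meas N _) two_pos (hX j) hδ'
    set K := ∑ j, (K1 j + K2 j) with hK
    have hKj : ∀ j, K1 j ≤ K ∧ K2 j ≤ K := fun j => by
      have : K1 j + K2 j ≤ K := Finset.single_le_sum (f := fun j => K1 j + K2 j)
        (fun j _ => (add_pos (hK1 j) (hK2 j)).le) (Finset.mem_univ j)
      exact ⟨by linarith [hK2 j], by linarith [hK1 j]⟩
    have hK0 : 0 ≤ K := Finset.sum_nonneg fun j _ => (add_pos (hK1 j) (hK2 j)).le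
    have E1 := ProbGe.iInter fun j => hP1 j K (hKj j).1
    have E2 := ProbGe.iInter fun j => hP2 j K (hKj j).2
    have E3 := Whp.prod_fst (Q := fun N => stdNormals N) |>.2 (h.quad (1 / 2) (by norm_num)) _ hδ'
    have E := (E1.inter E2).inter E3
    set B := 2 * (n * (1 / m * K)) with hB
    set c := 1 / (16 * M ^ 2) with hc
    have hc0 : 0 < c := by positivity
    -- This is the maximum over y of (B + 1)y − c y². The extra 1 beyond the noise constant B leaves
    -- the term −y.
    refine ⟨(B + 1) ^ 2 / (4 * c), (E.of_le ?_).mono ?_⟩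
    · have : (Fintype.card κ : ℝ≥0∞) * (δ / (2 * n + 1)) + Fintype.card κ * (δ / (2 * n + 1))
          + δ / (2 * n + 1) = (2 * n + 1) * (δ / (2 * n + 1)) := by rw [← hn]; ring
      rw [this]
      exact ENNReal.mul_div_le
    · filter_upwards [ha, h.proj] with N haN hproj
      rintro ω ⟨⟨h1, h2⟩, h3⟩ u hu
      -- The block sees u only through u', whose norm is √q. Estimating at u' bounds the noise by a
      -- multiple of √q; at u it would only be a multiple of ‖u‖.
      obtain ⟨u', hu'1, hu'2, hwu, hxu⟩ := hproj u
      obtain ⟨σ, hσ, τ, hτ, hστ⟩ := haN.2 u hu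
      have hlo : ∀ i, m ≤ 1 + w N u i := fun i => by
        rw [hστ]; nlinarith [hσ.1, hτ.1, (haN.1 i).1, (haN.1 i).2]
      have hhi : ∀ i, 1 + w N u i ≤ M := fun i => by
        rw [hστ]; nlinarith [hσ.2, hτ.2, (haN.1 i).1, (haN.1 i).2]
      have b0 := gdev_le (x := x N ω.1 u) (z := ω.2) hm hM hlo hhi
      have b1 := abs_sum_linear_div_le (w N) (ξ := fun i => ω.2 i ^ 2 - 1)
        (ρ := fun i => 1 + w N u i) (B := 1 / m * K)
        (fun j => abs_sum_div_le_of_geomSup_le hm hK0 hσ hτ haN.1 hστ (h1 j)) u'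
      have b2 := abs_sum_linear_div_le (x N ω.1) (ξ := fun i => ω.2 i)
        (ρ := fun i => 1 + w N u i) (B := 1 / m * K)
        (fun j => abs_sum_div_le_of_geomSup_le hm hK0 hσ hτ haN.1 hστ (h2 j)) u'
      have b3 := (abs_le.1 (h3 u')).1
      rw [hwu, hxu] at b3
      rw [hwu] at b1
      rw [hxu] at b2
      rw [hu'2, hu'1] at b3
      have hsqrt : ‖u'‖ = Real.sqrt (q N u) := by rw [← hu'1, Real.sqrt_sq (norm_nonneg _)]
      set y := Real.sqrt (q N u)
      have hq : q N u = y ^ 2 := by rw [← hu'1, hsqrt]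
      rw [hsqrt] at b1 b2
      rw [hq] at b3
      have hquad : c * y ^ 2 ≤ 1 / (8 * M ^ 2) * gquad (w N u) (x N ω.1 u) := by
        have : c * y ^ 2 = 1 / (8 * M ^ 2) * (y ^ 2 / 2) := by rw [hc]; field_simp; ring
        rw [this]
        gcongr
        linarith
      have : (B + 1) * y - c * y ^ 2 ≤ (B + 1) ^ 2 / (4 * c) := by
        rw [le_div_iff₀ (by positivity)]
        nlinarith [sq_nonneg (2 * c * y - (B + 1))]
      have hBy : B * y = y * (n * (1 / m * K)) + y * (n * (1 / m * K)) := by rw [hB]; ring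
      change gdev (w N u) (x N ω.1 u) ω.2 ≤ _
      linarith
  · intro R hR ε hε
    set n := Fintype.card κ with hn
    -- The n² pairs of coordinates, the factor R² and the factor 1/m then contribute at most ε/8 for
    -- each noise sum.
    set K := m * ε / (8 * (n ^ 2 + 1) * R ^ 2) with hK
    have hK0 : 0 < K := by positivity
    have E1 := Whp.biInter (Finset.univ : Finset (κ × κ)) fun jk _ =>
      whp_geomSup (P := P) mg1 memLp_sq_sub_one_stdNormal integral_sq_sub_one_stdNormal hθ0 hθ1 ha1
        (c := fun N _ i => w N (e jk.1) i * w N (e jk.2) i) (fun N => measurable_const)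
        (fun S hS => prodSmall S hS jk.2 (fun N _ => w N (e jk.1)) (hW _)) hK0
    have E2 := Whp.biInter (Finset.univ : Finset (κ × κ)) fun jk _ =>
      whp_geomSup (P := P) mg2 memLp_id_stdNormal integral_id_stdNormal hθ0 hθ1 ha1
        (c := fun N ω i => x N ω (e jk.1) i * w N (e jk.2) i)
        (fun N => by
          have := h.meas N (e jk.1)
          exact measurable_pi_lambda _ fun i =>
            ((measurable_pi_apply i).comp this).mul_const _)
        (fun S hS => prodSmall S hS jk.2 (fun N ω => x N ω (e jk.1)) (hX _)) hK0
    have E3 := Whp.prod_fst (Q := fun N => stdNormals N) |>.2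
      (h.quad (ε / (2 * R ^ 2)) (by positivity))
    have E4 := Whp.prod_fst (Q := fun N => stdNormals N) |>.2 hsq
    -- The first bound keeps |w_i| ≤ 1/2 on the ball of radius R. The second makes the deterministic
    -- cubic error, at most 6ηR · 2R², at most ε/4.
    set η := min (1 / (2 * R)) (ε / (48 * R ^ 3)) with hη
    have hη0 : 0 < η := by positivity
    refine ((E1.inter E2).inter (E3.inter E4)).mono ?_
    filter_upwards [ha, h.ball R, h.small η hη0] with N haN hball hsmall
    rintro ω ⟨⟨h1, h2⟩, h3, h4⟩ u hu
    obtain ⟨σ, hσ, τ, hτ, hστ⟩ := haN.2 u (hball u hu)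
    have hr : η * R ≤ 1 / 2 := by
      calc η * R ≤ 1 / (2 * R) * R := by gcongr; exact min_le_left _ _
        _ = 1 / 2 := by field_simp
    have hr2 : η * R ≤ ε / (48 * R ^ 2) := by
      calc η * R ≤ ε / (48 * R ^ 3) * R := by gcongr; exact min_le_right _ _
        _ = _ := by field_simp
    have hw : ∀ i, |w N u i| ≤ η * R := fun i => (hsmall u i).trans (by gcongr)
    have b0 := abs_gdev_sub_le (x := x N ω.1 u) (z := ω.2) hr hw
    have b1 := abs_sum_bilinear_div_le (w N) (w N) (ξ := fun i => ω.2 i ^ 2 - 1)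
      (ρ := fun i => 1 + w N u i) (B := 1 / m * K)
      (fun j k => abs_sum_div_le_of_geomSup_le hm hK0.le hσ hτ haN.1 hστ
        (h1 (j, k) (Finset.mem_univ _))) u
    have b2 := abs_sum_bilinear_div_le (x N ω.1) (w N) (ξ := fun i => ω.2 i)
      (ρ := fun i => 1 + w N u i) (B := 1 / m * K)
      (fun j k => abs_sum_div_le_of_geomSup_le hm hK0.le hσ hτ haN.1 hστ
        (h2 (j, k) (Finset.mem_univ _))) u
    have hu2 : ‖u‖ ^ 2 ≤ R ^ 2 := by gcongr
    have b3 : |gquad (w N u) (x N ω.1 u) - q N u| ≤ ε / 2 := by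
      refine (h3 u).trans ?_
      calc ε / (2 * R ^ 2) * ‖u‖ ^ 2 ≤ ε / (2 * R ^ 2) * R ^ 2 := by gcongr
        _ = _ := by field_simp
    have b4 : gquad (w N u) (x N ω.1 u) ≤ 2 * R ^ 2 :=
      (h4 u : gquad (w N u) (x N ω.1 u) ≤ 2 * ‖u‖ ^ 2).trans (by linarith)
    have b5 : 6 * (η * R) * gquad (w N u) (x N ω.1 u) ≤ ε / 4 := by
      calc _ ≤ 6 * (ε / (48 * R ^ 2)) * (2 * R ^ 2) := by
            have := gquad_nonneg (w N u) (x N ω.1 u)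
            gcongr
        _ = _ := by field_simp; norm_num
    have b6 : ‖u‖ ^ 2 * (n ^ 2 * (1 / m * K)) ≤ ε / 8 := by
      calc _ ≤ R ^ 2 * ((n ^ 2 + 1) * (1 / m * K)) := by gcongr; linarith
        _ = _ := by rw [hK]; field_simp
    have b1' := b1.trans b6
    have b2' := b2.trans b6
    change |gdev (w N u) (x N ω.1 u) ω.2 - gscore (w N u) (x N ω.1 u) ω.2 + q N u / 2| ≤ ε
    have b7 := b0.trans (add_le_add (add_le_add b5 b1') b2')
    rw [abs_le] at b3 b7 ⊢
    constructor <;> linarith [b3.1, b3.2, b7.1, b7.2]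

end GaussBlock

end Blocks

end RENSEM


namespace RENSEM

/-! ### Conditional characteristic functions -/

/-- On the convex left half-plane the derivative of the exponential has modulus at most 1.
Characteristic functions can thus be compared through their exponents. -/
theorem norm_cexp_sub_cexp_le {a b : ℂ} (ha : a.re ≤ 0) (hb : b.re ≤ 0) :
    ‖Complex.exp a - Complex.exp b‖ ≤ ‖a - b‖ := by
  have hconv : Convex ℝ {z : ℂ | z.re ≤ 0} := convex_halfSpace_re_le 0
  have := hconv.norm_image_sub_le_of_norm_hasDerivWithin_le (f := Complex.exp) (f' := Complex.exp)
    (C := 1) (x := b) (y := a) (fun z _ => (Complex.hasDerivAt_exp z).hasDerivWithinAt)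
    (fun z hz => by
      rw [Complex.norm_exp]; exact Real.exp_le_one_iff.2 hz) hb ha
  simpa using this

/-- The exponent of the characteristic function of `(Y² - 1) w / 2 + x Y` for a standard
normal `Y`. -/
noncomputable def gaussExponent (w x : ℝ) : ℂ :=
  -(1 / 2) * Complex.log (1 - Complex.I * w) - Complex.I * w / 2 - x ^ 2 / (2 * (1 - Complex.I * w))

theorem one_sub_I_mul_re (w : ℝ) : (1 - Complex.I * w).re = 1 := by simp

theorem one_sub_I_mul_ne_zero (w : ℝ) : (1 - Complex.I * w) ≠ 0 := fun h => by
  have := one_sub_I_mul_re w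
  rw [h] at this; simp at this

theorem one_le_norm_one_sub_I_mul (w : ℝ) : 1 ≤ ‖1 - Complex.I * w‖ := by
  have := Complex.abs_re_le_norm (1 - Complex.I * w)
  rwa [one_sub_I_mul_re, abs_one] at this

/-- Since 1 − iw has real part 1, its modulus is at least 1 and its reciprocal has positive real
part. -/
theorem gaussExponent_re_nonpos (w x : ℝ) : (gaussExponent w x).re ≤ 0 := by
  have h1 : 0 ≤ (Complex.log (1 - Complex.I * w)).re := by
    rw [Complex.log_re]; exact Real.log_nonneg (one_le_norm_one_sub_I_mul w)
  have h2 : 0 ≤ ((x : ℂ) ^ 2 / (2 * (1 - Complex.I * w))).re := by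
    have : (x : ℂ) ^ 2 / (2 * (1 - Complex.I * w))
        = ((x ^ 2 / 2 : ℝ) : ℂ) * (1 - Complex.I * w)⁻¹ := by
      push_cast; rw [div_mul_eq_div_div, div_eq_mul_inv _ (1 - Complex.I * (w : ℂ))]
    rw [this, Complex.re_ofReal_mul, Complex.inv_re, one_sub_I_mul_re]
    have := Complex.normSq_nonneg (1 - Complex.I * w)
    positivity
  have e : (gaussExponent w x).re = -(1 / 2) * (Complex.log (1 - Complex.I * w)).re
      - ((x : ℂ) ^ 2 / (2 * (1 - Complex.I * w))).re := by
    unfold gaussExponent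
    rw [Complex.sub_re, Complex.sub_re]
    have h3 : (-(1 / 2 : ℂ) * Complex.log (1 - Complex.I * w)).re
        = -(1 / 2) * (Complex.log (1 - Complex.I * w)).re := by
      have : (-(1 / 2 : ℂ)) = ((-(1 / 2) : ℝ) : ℂ) := by push_cast; ring
      rw [this, Complex.re_ofReal_mul]
    have h4 : (Complex.I * w / 2).re = 0 := by simp
    rw [h3, h4]; ring
  rw [e]
  linarith

/-- The term iw/2 from the logarithm cancels the centring −iw/2. What is left at second order is
−(w²/2 + x²)/2, and every further term carries an additional factor w. -/
theorem norm_gaussExponent_add_le {w : ℝ} (x : ℝ) (hw : |w| ≤ 1 / 2) :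
    ‖gaussExponent w x + ((w ^ 2 / 2 + x ^ 2) / 2 : ℝ)‖ ≤ |w| * (w ^ 2 / 2 + x ^ 2) := by
  set z : ℂ := -(Complex.I * w) with hz
  have hnz : ‖z‖ = |w| := by simp [hz]
  have h1 := Complex.norm_log_sub_logTaylor_le 2 (z := z) (by rw [hnz]; linarith)
  have hT : Complex.logTaylor 3 z = z - z ^ 2 / 2 := by
    simp [Complex.logTaylor, Finset.sum_range_succ]; ring
  have e1 : (1 : ℂ) - Complex.I * w = 1 + z := by rw [hz]; ring
  have hz2 : z ^ 2 = -(w : ℂ) ^ 2 := by rw [hz, neg_sq, mul_pow, Complex.I_sq]; ring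
  have hne := one_sub_I_mul_ne_zero w
  have e : gaussExponent w x + ((w ^ 2 / 2 + x ^ 2) / 2 : ℝ)
      = -(1 / 2) * (Complex.log (1 + z) - Complex.logTaylor 3 z)
        - (x : ℂ) ^ 2 / 2 * (Complex.I * w / (1 - Complex.I * w)) := by
    rw [hT, hz2, ← e1, gaussExponent]
    push_cast
    have : (x : ℂ) ^ 2 / (2 * (1 - Complex.I * w)) = x ^ 2 / 2
        + (x : ℂ) ^ 2 / 2 * (Complex.I * w / (1 - Complex.I * w)) := by
      field_simp; ring
    rw [this, hz]; ring
  rw [e]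
  have h2 : ‖Complex.log (1 + z) - Complex.logTaylor 3 z‖ ≤ |w| ^ 3 := by
    refine h1.trans ?_
    rw [hnz]
    have : (1 - |w|)⁻¹ ≤ 2 := by
      rw [inv_le_comm₀ (by linarith) (by norm_num)]; linarith
    have h3 : |w| ^ 3 * (1 - |w|)⁻¹ ≤ |w| ^ 3 * 2 := by gcongr
    norm_num
    have := pow_nonneg (abs_nonneg w) 3
    linarith
  have h3 : ‖Complex.I * w / (1 - Complex.I * w)‖ ≤ |w| := by
    rw [norm_div]
    have : ‖Complex.I * (w : ℂ)‖ = |w| := by simp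
    rw [this]
    exact div_le_self (abs_nonneg _) (one_le_norm_one_sub_I_mul w)
  calc _ ≤ ‖-(1 / 2 : ℂ) * (Complex.log (1 + z) - Complex.logTaylor 3 z)‖
        + ‖(x : ℂ) ^ 2 / 2 * (Complex.I * w / (1 - Complex.I * w))‖ := norm_sub_le _ _
    _ ≤ 1 / 2 * |w| ^ 3 + x ^ 2 / 2 * |w| := by
      rw [norm_mul, norm_mul]
      have a1 : ‖(-(1 / 2 : ℂ))‖ = 1 / 2 := by simp
      have a2 : ‖(x : ℂ) ^ 2 / 2‖ = x ^ 2 / 2 := by simp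
      rw [a1, a2]
      gcongr
    _ ≤ _ := by
      have e3 : |w| ^ 3 = |w| * w ^ 2 := by rw [pow_succ, sq_abs, mul_comm]
      rw [e3]
      nlinarith [mul_nonneg (abs_nonneg w) (sq_nonneg x)]

theorem integral_cexp_stdNormal (w x : ℝ) :
    ∫ y : ℝ, Complex.exp (((y ^ 2 - 1) / 2 * w + y * x : ℝ) * Complex.I) ∂(gaussianReal 0 1)
      = Complex.exp (gaussExponent w x) := by
  have hne := one_sub_I_mul_ne_zero w
  set b : ℂ := 1 - Complex.I * w with hb
  have hre : (-(b / 2)).re < 0 := by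
    rw [Complex.neg_re, show b / 2 = ((1 / 2 : ℝ) : ℂ) * b by push_cast; ring,
      Complex.re_ofReal_mul, one_sub_I_mul_re]; norm_num
  rw [integral_gaussianReal_eq_integral_smul one_ne_zero]
  have e : ∀ y : ℝ, gaussianPDFReal 0 1 y •
      Complex.exp (((y ^ 2 - 1) / 2 * w + y * x : ℝ) * Complex.I)
      = ((√(2 * Real.pi))⁻¹ : ℝ) * Complex.exp (-(b / 2) * y ^ 2 + (Complex.I * x) * y
        + -(Complex.I * w / 2)) := fun y => by
    rw [gaussianPDFReal, Complex.real_smul]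
    push_cast
    simp only [mul_one, sub_zero]
    rw [mul_assoc, ← Complex.exp_add]
    congr 2
    rw [hb]; ring
  simp_rw [e]
  rw [integral_const_mul, integral_cexp_quadratic hre]
  have h2pi : (0 : ℝ) < 2 * Real.pi := by positivity
  -- Because b lies in the right half-plane, the principal logarithm of its inverse is minus that of
  -- b, so the square root takes the expected branch.
  have e2 : ((Real.pi : ℂ) / - -(b / 2)) ^ (1 / 2 : ℂ)
      = ((√(2 * Real.pi) : ℝ) : ℂ) * Complex.exp (-(1 / 2) * Complex.log b) := by
    have : (Real.pi : ℂ) / - -(b / 2) = ((2 * Real.pi : ℝ) : ℂ) * b⁻¹ := by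
      push_cast; field_simp
    rw [this, Complex.cpow_def_of_ne_zero
        (mul_ne_zero (by exact_mod_cast h2pi.ne') (inv_ne_zero hne)),
      Complex.log_ofReal_mul h2pi (inv_ne_zero hne), Complex.log_inv _ (by
        intro h
        have := Complex.arg_eq_pi_iff.1 h
        rw [hb, one_sub_I_mul_re] at this; linarith [this.1])]
    rw [add_mul, Complex.exp_add]
    congr 1
    · rw [Real.sqrt_eq_rpow, Real.rpow_def_of_pos h2pi]
      push_cast; rfl
    · ring_nf
  rw [e2, ← mul_assoc, ← mul_assoc, ← Complex.ofReal_mul, inv_mul_cancel₀ (by positivity),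
    Complex.ofReal_one, one_mul, ← Complex.exp_add]
  congr 1
  rw [gaussExponent, ← hb, mul_pow, Complex.I_sq]
  field_simp
  ring

section

variable {ι : Type*} [Fintype ι]

theorem integral_cexp_gscore (w x : ι → ℝ) :
    ∫ z, Complex.exp (gscore w x z * Complex.I) ∂(Measure.pi fun _ : ι => gaussianReal 0 1)
      = Complex.exp (∑ i, gaussExponent (w i) (x i)) := by
  have e : ∀ z : ι → ℝ, Complex.exp (gscore w x z * Complex.I)
      = ∏ i, Complex.exp (((z i ^ 2 - 1) / 2 * w i + z i * x i : ℝ) * Complex.I) := fun z => by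
    rw [← Complex.exp_sum, gscore, Complex.ofReal_sum, Finset.sum_mul]
  simp_rw [e]
  rw [integral_fintype_prod_eq_prod
    (f := fun i (y : ℝ) => Complex.exp (((y ^ 2 - 1) / 2 * w i + y * x i : ℝ) * Complex.I)),
    Complex.exp_sum]
  exact Finset.prod_congr rfl fun i _ => integral_cexp_stdNormal _ _

theorem norm_integral_cexp_gscore_sub_le {w x : ι → ℝ} {r q : ℝ} (hr : r ≤ 1 / 2)
    (hw : ∀ i, |w i| ≤ r) (hq : 0 ≤ q) :
    ‖∫ z, Complex.exp (gscore w x z * Complex.I) ∂(Measure.pi fun _ : ι => gaussianReal 0 1)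
      - Real.exp (-q / 2)‖ ≤ r * gquad w x + |gquad w x - q| / 2 := by
  rw [integral_cexp_gscore, Complex.ofReal_exp]
  have h1 : (∑ i, gaussExponent (w i) (x i)).re ≤ 0 := by
    rw [Complex.re_sum]; exact Finset.sum_nonpos fun i _ => gaussExponent_re_nonpos _ _
  have h2 : (((-q / 2 : ℝ) : ℂ)).re ≤ 0 := by rw [Complex.ofReal_re]; linarith
  refine (norm_cexp_sub_cexp_le h1 h2).trans ?_
  have e : ∑ i, gaussExponent (w i) (x i) - ((-q / 2 : ℝ) : ℂ)
      = ∑ i, (gaussExponent (w i) (x i) + ((w i ^ 2 / 2 + x i ^ 2) / 2 : ℝ))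
        - ((gquad w x - q) / 2 : ℝ) := by
    rw [Finset.sum_add_distrib, ← Complex.ofReal_sum, ← Finset.sum_div, ← gquad]
    push_cast; ring
  rw [e]
  refine (norm_sub_le _ _).trans (add_le_add ?_ ?_)
  · rw [gquad, Finset.mul_sum]
    refine (norm_sum_le _ _).trans (Finset.sum_le_sum fun i _ => ?_)
    exact (norm_gaussExponent_add_le _ ((hw i).trans hr)).trans
      (mul_le_mul_of_nonneg_right (hw i) (by positivity))
  · rw [Complex.norm_real, Real.norm_eq_abs, abs_div, abs_two]

end

/-! ### Conditional characteristic functions and their deterministic limits. -/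

section CharStep

variable {Ω Z : ℕ → Type*} [∀ N, MeasurableSpace (Ω N)] [∀ N, MeasurableSpace (Z N)]
  {P : ∀ N, Measure (Ω N)} {Q : ∀ N, Measure (Z N)}

/-- The conditional characteristic function at `1` of the variable `s`, given the first
coordinate, approaches that of `N(0, q)`. -/
def CondNormal (P : ∀ N, Measure (Ω N)) (Q : ∀ N, Measure (Z N)) (s : ∀ N, Ω N → Z N → ℝ)
    (q : ℕ → ℝ) : Prop :=
  ∀ ε > 0, Whp P fun N =>
    {ω | ‖∫ z, Complex.exp (s N ω z * Complex.I) ∂(Q N) - Real.exp (-q N / 2)‖ ≤ ε}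

theorem norm_integral_le_of_le_on {α : Type*} [MeasurableSpace α] {μ : Measure α}
    [IsProbabilityMeasure μ] {F : α → ℂ} {B ε : ℝ} (hB : ∀ x, ‖F x‖ ≤ B)
    (hε : 0 ≤ ε) {G : Set α} (hG : ∀ x ∈ G, ‖F x‖ ≤ ε) :
    ‖∫ x, F x ∂μ‖ ≤ ε + B * μ.real Gᶜ := by
  set T := toMeasurable μ Gᶜ with hT
  have hTm : MeasurableSet T := measurableSet_toMeasurable _ _
  have hB0 : 0 ≤ B := by
    obtain ⟨x⟩ := nonempty_of_isProbabilityMeasure μ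
    exact (norm_nonneg _).trans (hB x)
  have hint : Integrable (fun x => ε + T.indicator (fun _ => B) x) μ :=
    (integrable_const ε).add ((integrable_const B).indicator hTm)
  refine (norm_integral_le_of_norm_le hint (ae_of_all _ fun x => ?_)).trans (le_of_eq ?_)
  · by_cases hx : x ∈ T
    · rw [Set.indicator_of_mem hx]; linarith [hB x]
    · have : x ∈ G := by
        by_contra h
        exact hx (subset_toMeasurable _ _ h)
      rw [Set.indicator_of_notMem hx, add_zero]
      exact hG x this
  · rw [integral_add (integrable_const _) ((integrable_const B).indicator hTm),
      integral_indicator_const _ hTm, measureReal_def, hT, measure_toMeasurable, measureReal_def]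
    simp [mul_comm]

/-- By Fubini the inner integral is the conditional characteristic function. Up to a small error on
an event of high probability it is a constant, which can be taken out of the integral against the
bounded Φ. -/
theorem CondNormal.tendsto [∀ N, IsProbabilityMeasure (P N)] [∀ N, IsProbabilityMeasure (Q N)]
    {s : ∀ N, Ω N → Z N → ℝ} {q : ℕ → ℝ} (h : CondNormal P Q s q)
    (hs : ∀ N, Measurable (Function.uncurry (s N))) (hq : ∀ᶠ N in atTop, 0 ≤ q N)
    {Φ : ∀ N, Ω N → ℂ} (hΦm : ∀ N, Measurable (Φ N)) (hΦ : ∀ N ω, ‖Φ N ω‖ ≤ 1) :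
    Tendsto (fun N => ∫ ω, Φ N ω.1 * Complex.exp (s N ω.1 ω.2 * Complex.I) ∂((P N).prod (Q N))
      - (∫ ω, Φ N ω ∂(P N)) * Real.exp (-q N / 2)) atTop (𝓝 0) := by
  rw [tendsto_zero_iff_norm_tendsto_zero, Metric.tendsto_atTop']
  intro ε hε
  -- The integrand is at most 2 on the bad event, so the total is at most ε/2 + 2ε/5 < ε.
  obtain ⟨n0, hn0⟩ := eventually_atTop.1
    ((h (ε / 2) (by positivity) (ENNReal.ofReal (ε / 5)) (by simpa using by positivity)).and hq)
  refine ⟨n0, fun N hN => ?_⟩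
  obtain ⟨hN1, hN2⟩ := hn0 N hN.le
  have hexp : ∀ ω z, ‖Complex.exp (s N ω z * Complex.I)‖ = 1 := fun ω z =>
    Complex.norm_exp_ofReal_mul_I _
  have hs' : Measurable fun ω : Ω N × Z N => Complex.exp (s N ω.1 ω.2 * Complex.I) := by
    have : Measurable fun ω : Ω N × Z N => s N ω.1 ω.2 := hs N
    fun_prop
  have hm : Measurable fun ω : Ω N × Z N => Φ N ω.1 * Complex.exp (s N ω.1 ω.2 * Complex.I) :=
    ((hΦm N).comp measurable_fst).mul hs'
  have hint : Integrable (fun ω : Ω N × Z N => Φ N ω.1 * Complex.exp (s N ω.1 ω.2 * Complex.I))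
      ((P N).prod (Q N)) := by
    refine Integrable.of_bound hm.aestronglyMeasurable 1 (ae_of_all _ fun ω => ?_)
    rw [norm_mul, hexp, mul_one]
    exact hΦ N _
  have hΦint : Integrable (Φ N) (P N) :=
    Integrable.of_bound (hΦm N).aestronglyMeasurable 1 (ae_of_all _ (hΦ N))
  set g : Ω N → ℂ := fun ω => ∫ z, Complex.exp (s N ω z * Complex.I) ∂(Q N) with hg
  have hgle : ∀ ω, ‖g ω‖ ≤ 1 := fun ω => by
    refine (norm_integral_le_of_norm_le_const (ae_of_all _ fun z => (hexp ω z).le)).trans ?_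
    simp
  have hgm : Measurable g := (hs'.stronglyMeasurable.integral_prod_right').measurable
  have hq1 : ‖((Real.exp (-q N / 2) : ℝ) : ℂ)‖ ≤ 1 := by
    rw [Complex.norm_real, Real.norm_of_nonneg (Real.exp_pos _).le]
    exact Real.exp_le_one_iff.2 (by linarith)
  have e : ∫ ω, Φ N ω.1 * Complex.exp (s N ω.1 ω.2 * Complex.I) ∂((P N).prod (Q N))
      - (∫ ω, Φ N ω ∂(P N)) * Real.exp (-q N / 2)
      = ∫ ω, Φ N ω * (g ω - Real.exp (-q N / 2)) ∂(P N) := by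
    rw [integral_prod _ hint]
    simp_rw [integral_const_mul, mul_sub]
    rw [integral_sub, integral_mul_const]
    · refine Integrable.of_bound ((hΦm N).mul hgm).aestronglyMeasurable 1 (ae_of_all _ fun ω => ?_)
      rw [norm_mul]
      exact mul_le_one₀ (hΦ N ω) (norm_nonneg _) (hgle ω)
    · exact hΦint.mul_const _
  rw [e, dist_zero_right, norm_norm]
  have hF : ∀ ω, ‖Φ N ω * (g ω - Real.exp (-q N / 2))‖ ≤ ‖g ω - Real.exp (-q N / 2)‖ := fun ω => by
    rw [norm_mul]
    exact mul_le_of_le_one_left (norm_nonneg _) (hΦ N ω)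
  have hfin := norm_integral_le_of_le_on (μ := P N) (B := 2) (ε := ε / 2)
    (F := fun ω => Φ N ω * (g ω - Real.exp (-q N / 2)))
    (fun ω => (hF ω).trans ((norm_sub_le _ _).trans (by linarith [hgle ω])))
    (by positivity) (G := {ω | ‖g ω - Real.exp (-q N / 2)‖ ≤ ε / 2})
    (fun ω hω => (hF ω).trans hω)
  have : (P N).real {ω | ‖g ω - Real.exp (-q N / 2)‖ ≤ ε / 2}ᶜ ≤ ε / 5 :=
    ENNReal.toReal_le_of_le_ofReal (by positivity) hN1
  linarith

/-- The characteristic function of `gscore` given the past is explicit. It is close to exp(−q/2) as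
soon as max |w_i| is small and `gquad` is close to q. -/
theorem IsGaussBlock.condNormal {κ : Type*} [Fintype κ] {D : ℕ → Set (EuclideanSpace ℝ κ)}
    {w : ∀ N, EuclideanSpace ℝ κ →ₗ[ℝ] (Fin N → ℝ)}
    {x : ∀ N, Ω N → EuclideanSpace ℝ κ →ₗ[ℝ] (Fin N → ℝ)} {q : ℕ → EuclideanSpace ℝ κ → ℝ}
    (h : IsGaussBlock P D w x q) (u : EuclideanSpace ℝ κ) :
    CondNormal P (fun N => stdNormals N) (fun N ω z => gscore (w N u) (x N ω u) z)
      fun N => q N u := by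
  intro ε hε
  set y := ‖u‖ + 1 with hy
  have hy0 : 0 < y := by positivity
  set η := min (1 / (2 * y)) (ε / (4 * y ^ 3)) with hη
  have hη0 : 0 < η := by positivity
  refine (h.whp_sum_sq.inter (h.quad (ε / (2 * y ^ 2)) (by positivity))).mono ?_
  filter_upwards [h.small η hη0, h.proj] with N hsmall hproj
  rintro ω ⟨h1, h2⟩
  have hq0 : 0 ≤ q N u := by obtain ⟨u', h, -⟩ := hproj u; rw [← h]; positivity
  have huy : ‖u‖ ≤ y := by rw [hy]; linarith
  have hr : η * y ≤ 1 / 2 := by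
    calc η * y ≤ 1 / (2 * y) * y := by gcongr; exact min_le_left _ _
      _ = 1 / 2 := by field_simp
  have hr2 : η * y ≤ ε / (4 * y ^ 2) := by
    calc η * y ≤ ε / (4 * y ^ 3) * y := by gcongr; exact min_le_right _ _
      _ = _ := by field_simp
  have hu2 : ‖u‖ ^ 2 ≤ y ^ 2 := by gcongr
  refine (norm_integral_cexp_gscore_sub_le hr (fun i => (hsmall u i).trans (by gcongr)) hq0).trans ?_
  have b1 : gquad (w N u) (x N ω u) ≤ 2 * y ^ 2 := (h1 u).trans (by linarith)
  have b2 : |gquad (w N u) (x N ω u) - q N u| ≤ ε / 2 := by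
    refine (h2 u).trans ?_
    calc ε / (2 * y ^ 2) * ‖u‖ ^ 2 ≤ ε / (2 * y ^ 2) * y ^ 2 := by gcongr
      _ = _ := by field_simp
  have b3 : η * y * gquad (w N u) (x N ω u) ≤ ε / (4 * y ^ 2) * (2 * y ^ 2) := by
    have := gquad_nonneg (w N u) (x N ω u)
    gcongr
  have b4 : ε / (4 * y ^ 2) * (2 * y ^ 2) = ε / 2 := by field_simp; norm_num
  linarith

end CharStep

end RENSEM


namespace RENSEM

/-! ### Logistic regression -/

/-- The cumulant function of the Bernoulli family. -/
noncomputable def softplus (t : ℝ) : ℝ := Real.log (1 + Real.exp t)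

theorem sigmoid_eq_div (t : ℝ) : Real.sigmoid t = Real.exp t / (1 + Real.exp t) := by
  rw [Real.sigmoid_def, Real.exp_neg]
  field_simp
  ring

theorem hasDerivAt_softplus (t : ℝ) : HasDerivAt softplus (Real.sigmoid t) t := by
  have h := ((Real.hasDerivAt_exp t).const_add 1).log (by positivity)
  rwa [← sigmoid_eq_div] at h

theorem continuous_softplus : Continuous softplus :=
  continuous_iff_continuousAt.2 fun t => (hasDerivAt_softplus t).continuousAt

theorem continuous_sigmoid : Continuous Real.sigmoid := differentiable_sigmoid.continuous

/-- The remainder of the first-order expansion of `softplus` at `t`. -/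
noncomputable def softplusRem (t x : ℝ) : ℝ := softplus (t + x) - softplus t - Real.sigmoid t * x

theorem continuous_softplusRem : Continuous fun p : ℝ × ℝ => softplusRem p.1 p.2 := by
  unfold softplusRem
  have := continuous_softplus
  have := continuous_sigmoid
  fun_prop

/-- Taylor's formula with integral remainder. This form is needed because the integrand is the
Bernoulli information at an intermediate parameter, where the information conditions can be applied.
-/
theorem softplusRem_eq_integral (t x : ℝ) :
    softplusRem t x = ∫ r in (0 : ℝ)..1, (1 - r) *
      (Real.sigmoid (t + r * x) * (1 - Real.sigmoid (t + r * x)) * x ^ 2) := by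
  have hder : ∀ r : ℝ, HasDerivAt
      (fun r => softplus (t + r * x) + (1 - r) * x * Real.sigmoid (t + r * x))
      ((1 - r) * (Real.sigmoid (t + r * x) * (1 - Real.sigmoid (t + r * x)) * x ^ 2)) r := by
    intro r
    have h0 : HasDerivAt (fun r : ℝ => t + r * x) x r := by
      simpa using ((hasDerivAt_id r).mul_const x).const_add t
    have h1 := (hasDerivAt_softplus (t + r * x)).comp r h0
    have h2 := (Real.hasDerivAt_sigmoid (t + r * x)).comp r h0
    have h3 : HasDerivAt (fun r : ℝ => (1 - r) * x) (-x) r := by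
      simpa using ((hasDerivAt_id r).const_sub 1).mul_const x
    exact (h1.add (h3.mul h2)).congr_deriv (by simp only [Function.comp_apply]; ring_nf)
  have hcont : Continuous fun r : ℝ => (1 - r) *
      (Real.sigmoid (t + r * x) * (1 - Real.sigmoid (t + r * x)) * x ^ 2) := by
    have := continuous_sigmoid
    fun_prop
  rw [intervalIntegral.integral_eq_sub_of_hasDerivAt (fun r _ => hder r)
    (hcont.intervalIntegrable _ _)]
  simp [softplusRem]
  ring_nf

theorem softplusRem_nonneg (t x : ℝ) : 0 ≤ softplusRem t x := by
  rw [softplusRem_eq_integral]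
  refine intervalIntegral.integral_nonneg zero_le_one fun r hr => ?_
  have h1 := Real.sigmoid_nonneg (t + r * x)
  have h2 := Real.sigmoid_le_one (t + r * x)
  have h3 : 0 ≤ 1 - r := by linarith [hr.2]
  have h4 : 0 ≤ 1 - Real.sigmoid (t + r * x) := by linarith
  positivity

theorem convexOn_softplus : ConvexOn ℝ Set.univ softplus := by
  have hd : deriv softplus = Real.sigmoid := funext fun t => (hasDerivAt_softplus t).deriv
  refine Monotone.convexOn_univ_of_deriv (fun t => (hasDerivAt_softplus t).differentiableAt) ?_
  rw [hd]
  exact Real.sigmoid_monotone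

/-- As `softplus` is the cumulant function, its first-order remainder is the logarithm of the moment
generating function of a centred Bernoulli variable. -/
theorem exp_softplusRem (t x : ℝ) :
    Real.exp (softplusRem t x) = Real.sigmoid t * Real.exp ((1 - Real.sigmoid t) * x)
      + (1 - Real.sigmoid t) * Real.exp (-(Real.sigmoid t * x)) := by
  have h1 : ∀ t, Real.exp (softplus t) = 1 + Real.exp t := fun t =>
    Real.exp_log (by positivity)
  have h2 : 1 - Real.sigmoid t = 1 / (1 + Real.exp t) := by
    rw [sigmoid_eq_div]; field_simp; ring
  have h3 : Real.exp ((1 - Real.sigmoid t) * x) = Real.exp x * Real.exp (-(Real.sigmoid t * x)) := by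
    rw [← Real.exp_add]; ring_nf
  rw [h3, softplusRem, Real.exp_sub, Real.exp_sub, h1, h1, Real.exp_add, h2, Real.exp_neg]
  conv_rhs => rw [sigmoid_eq_div]
  field_simp
  rw [sigmoid_eq_div]
  ring_nf

section

variable {ι : Type*} [Fintype ι]

noncomputable def bernRem (θ x : ι → ℝ) : ℝ := ∑ i, softplusRem (θ i) (x i)

/-- The score of independent Bernoulli variables with logits `θ`, in direction `x`. -/
noncomputable def bernScore (θ x : ι → ℝ) (U : ι → unitInterval) : ℝ :=
  ∑ i, ((if (U i : ℝ) ≤ Real.sigmoid (θ i) then 1 else 0) - Real.sigmoid (θ i)) * x i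

theorem bernRem_nonneg (θ x : ι → ℝ) : 0 ≤ bernRem θ x :=
  Finset.sum_nonneg fun _ _ => softplusRem_nonneg _ _

theorem convexOn_bernRem {V : Type*} [AddCommGroup V] [Module ℝ V] (θ : ι → ℝ)
    (L : V →ₗ[ℝ] (ι → ℝ)) : ConvexOn ℝ Set.univ fun u => bernRem θ (L u) := by
  refine ⟨convex_univ, fun u _ v _ a b ha hb hab => ?_⟩
  simp only [bernRem, smul_eq_mul, Finset.mul_sum]
  rw [← Finset.sum_add_distrib]
  refine Finset.sum_le_sum fun i _ => ?_
  have h := convexOn_softplus.2 (Set.mem_univ (θ i + L u i)) (Set.mem_univ (θ i + L v i)) ha hb hab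
  have e : a • (θ i + L u i) + b • (θ i + L v i) = θ i + L (a • u + b • v) i := by
    simp only [map_add, map_smul, Pi.add_apply, Pi.smul_apply, smul_eq_mul]
    have : θ i = (a + b) * θ i := by rw [hab, one_mul]
    linear_combination -this
  rw [e] at h
  have e2 : L (a • u + b • v) i = a * L u i + b * L v i := by simp
  have e3 : softplus (θ i) = a * softplus (θ i) + b * softplus (θ i) := by
    rw [← add_mul, hab, one_mul]
  simp only [softplusRem, smul_eq_mul] at h ⊢
  rw [e2] at h ⊢
  nlinarith

theorem integral_ite_le_unitInterval {p : ℝ} (hp : p ∈ Set.Icc (0 : ℝ) 1) (a b : ℝ) :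
    ∫ y : unitInterval, (if (y : ℝ) ≤ p then a else b) = p * a + (1 - p) * b := by
  have e : ∀ y : unitInterval, (if (y : ℝ) ≤ p then a else b)
      = b + (Set.Iic (⟨p, hp⟩ : unitInterval)).indicator (fun _ => a - b) y := fun y => by
    by_cases h : (y : ℝ) ≤ p
    · rw [if_pos h, Set.indicator_of_mem (show y ∈ Set.Iic (⟨p, hp⟩ : unitInterval) from h)]; ring
    · rw [if_neg h, Set.indicator_of_notMem (show y ∉ Set.Iic (⟨p, hp⟩ : unitInterval) from h)]
      ring
  simp_rw [e]
  rw [integral_add (integrable_const _) ((integrable_const _).indicator measurableSet_Iic),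
    integral_indicator_const _ measurableSet_Iic, measureReal_def, unitInterval.volume_Iic]
  simp [ENNReal.toReal_ofReal hp.1]
  ring

/-- Independence multiplies the identities `exp_softplusRem`. Control of `bernRem` alone therefore
yields both the tails and the limit law of the score. -/
theorem integral_exp_bernScore (θ x : ι → ℝ) :
    ∫ U, Real.exp (bernScore θ x U) ∂(Measure.pi fun _ : ι => (volume : Measure unitInterval))
      = Real.exp (bernRem θ x) := by
  have e : ∀ U : ι → unitInterval, Real.exp (bernScore θ x U)
      = ∏ i, (if (U i : ℝ) ≤ Real.sigmoid (θ i) then Real.exp ((1 - Real.sigmoid (θ i)) * x i)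
          else Real.exp (-(Real.sigmoid (θ i) * x i))) := fun U => by
    rw [bernScore, Real.exp_sum]
    refine Finset.prod_congr rfl fun i _ => ?_
    split_ifs
    · rfl
    · congr 1; ring_nf
  simp_rw [e]
  rw [integral_fintype_prod_eq_prod (f := fun i (y : unitInterval) =>
    if (y : ℝ) ≤ Real.sigmoid (θ i) then Real.exp ((1 - Real.sigmoid (θ i)) * x i)
          else Real.exp (-(Real.sigmoid (θ i) * x i))), bernRem, Real.exp_sum]
  refine Finset.prod_congr rfl fun i _ => ?_
  rw [integral_ite_le_unitInterval ⟨Real.sigmoid_nonneg _, Real.sigmoid_le_one _⟩,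
    exp_softplusRem]

theorem measurable_bernScore {Ω : Type*} [MeasurableSpace Ω] {θ x : Ω → ι → ℝ} (hθ : Measurable θ)
    (hx : Measurable x) :
    Measurable fun w : Ω × (ι → unitInterval) => bernScore (θ w.1) (x w.1) w.2 := by
  unfold bernScore
  refine Finset.measurable_sum _ fun i _ => ?_
  have h1 : Measurable fun w : Ω × (ι → unitInterval) => Real.sigmoid (θ w.1 i) :=
    continuous_sigmoid.measurable.comp (by fun_prop)
  refine ((Measurable.ite ?_ measurable_const measurable_const).sub h1).mul (by fun_prop)
  exact measurableSet_le (by fun_prop) h1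

theorem abs_bernScore_le (θ x : ι → ℝ) (U : ι → unitInterval) : |bernScore θ x U| ≤ ∑ i, |x i| := by
  refine (Finset.abs_sum_le_sum_abs _ _).trans (Finset.sum_le_sum fun i _ => ?_)
  rw [abs_mul]
  refine mul_le_of_le_one_left (abs_nonneg _) ?_
  have h1 := Real.sigmoid_nonneg (θ i)
  have h2 := Real.sigmoid_le_one (θ i)
  rw [abs_le]
  split_ifs <;> constructor <;> linarith

end

/-! ### Tails, expansion and conditional normality for logistic regression. -/

section BernBlock

variable {κ : Type*} [Fintype κ] {Ω : ℕ → Type*} [∀ N, MeasurableSpace (Ω N)]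

/-- The law of `N` independent uniform variables. -/
noncomputable abbrev uniforms (N : ℕ) : Measure (Fin N → unitInterval) :=
  Measure.pi fun _ => volume

/-- Asymptotic regularity of a logistic regression with logits `θ` and directions `x`. -/
structure IsBernBlock (P : ∀ N, Measure (Ω N)) (θ : ∀ N, Ω N → Fin N → ℝ)
    (x : ∀ N, Ω N → EuclideanSpace ℝ κ →ₗ[ℝ] (Fin N → ℝ))
    (q : ℕ → EuclideanSpace ℝ κ → ℝ) : Prop where
  meas_logit : ∀ N, Measurable (θ N)
  meas : ∀ N u, Measurable fun ω => x N ω u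
  proj : ∀ᶠ N in atTop, ∀ u, ∃ u', ‖u'‖ ^ 2 = q N u ∧ q N u' = q N u ∧ ∀ ω, x N ω u' = x N ω u
  q_le : ∀ᶠ N in atTop, ∀ u, q N u ≤ ‖u‖ ^ 2
  q_smul : ∀ᶠ N in atTop, ∀ (c : ℝ) u, q N (c • u) = c ^ 2 * q N u
  q_convex : ∀ᶠ N in atTop, ConvexOn ℝ Set.univ (q N)
  rem : ∀ u, ∀ ε > 0, Whp P fun N => {ω | |bernRem (θ N ω) (x N ω u) - q N u / 2| ≤ ε}

variable {P : ∀ N, Measure (Ω N)} {θ : ∀ N, Ω N → Fin N → ℝ}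
  {x : ∀ N, Ω N → EuclideanSpace ℝ κ →ₗ[ℝ] (Fin N → ℝ)} {q : ℕ → EuclideanSpace ℝ κ → ℝ}

theorem IsBernBlock.nonneg (h : IsBernBlock P θ x q) : ∀ᶠ N in atTop, ∀ u, 0 ≤ q N u := by
  filter_upwards [h.proj] with N hN u
  obtain ⟨u', hu, -⟩ := hN u
  rw [← hu]; positivity

theorem IsBernBlock.measurable_bernRem (h : IsBernBlock P θ x q) (N : ℕ)
    (u : EuclideanSpace ℝ κ) : Measurable fun ω => bernRem (θ N ω) (x N ω u) := by
  unfold bernRem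
  refine Finset.measurable_sum _ fun i _ => ?_
  exact continuous_softplusRem.measurable.comp
    (((measurable_pi_apply i).comp (h.meas_logit N)).prodMk
      ((measurable_pi_apply i).comp (h.meas N u)))

/-- The remainder is uniformly close to the quadratic form on balls. -/
theorem IsBernBlock.whp_bernRem (h : IsBernBlock P θ x q) {R ε : ℝ} (hR : 0 < R) (hε : 0 < ε) :
    Whp P fun N => {ω | ∀ u, ‖u‖ ≤ R → |bernRem (θ N ω) (x N ω u) - q N u / 2| ≤ ε} := by
  obtain ⟨δ, hδ, F, hF⟩ := exists_finset_abs_sub_le_of_convexOn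
    (E := EuclideanSpace ℝ κ) hR hε
  refine (Whp.biInter F fun u _ => h.rem u δ hδ).mono ?_
  filter_upwards [h.q_convex, h.nonneg, h.q_le] with N hconv h0 hle ω hω
  have hconv' : ConvexOn ℝ Set.univ fun u => q N u / 2 := by
    have := hconv.smul (c := (1 / 2 : ℝ)) (by norm_num)
    refine this.congr fun u _ => ?_
    simp only [smul_eq_mul]; ring
  exact hF _ _ (convexOn_bernRem (θ N ω) (x N ω)) hconv' (fun u => bernRem_nonneg _ _)
    (fun u => div_nonneg (h0 u) (by norm_num)) (fun u => by linarith [hle u, h0 u]) hω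

/-- Markov's inequality conditionally on the first coordinate, used only where the conditional mean
is under control. -/
theorem prod_le_of_lintegral_le {α β : Type*} [MeasurableSpace α] [MeasurableSpace β]
    {μ : Measure α} [IsProbabilityMeasure μ] {ν : Measure β} [IsProbabilityMeasure ν]
    {G : Set α} (hG : MeasurableSet G) {f : α × β → ℝ≥0∞} (hf : Measurable f) {B K : ℝ≥0∞}
    (hK : K ≠ 0) (hK' : K ≠ ∞) (hB : ∀ a ∈ G, ∫⁻ b, f (a, b) ∂ν ≤ B) :
    μ.prod ν {w | K ≤ f w} ≤ μ Gᶜ + B / K := by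
  have hsub : {w : α × β | K ≤ f w} ⊆ Gᶜ ×ˢ Set.univ
      ∪ {w | K ≤ (G ×ˢ Set.univ).indicator f w} := by
    intro w hw
    by_cases h : w.1 ∈ G
    · right
      change K ≤ (G ×ˢ Set.univ).indicator f w
      rw [Set.indicator_of_mem (show w ∈ G ×ˢ Set.univ from ⟨h, trivial⟩)]
      exact hw
    · exact Or.inl ⟨h, trivial⟩
  have hm : Measurable ((G ×ˢ (Set.univ : Set β)).indicator f) :=
    hf.indicator (hG.prod MeasurableSet.univ)
  refine (measure_mono hsub).trans ((measure_union_le _ _).trans (add_le_add ?_ ?_))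
  · rw [Measure.prod_prod]; simp
  · refine (meas_ge_le_lintegral_div hm.aemeasurable hK hK').trans ?_
    gcongr
    rw [lintegral_prod _ hm.aemeasurable]
    calc _ ≤ ∫⁻ _, B ∂μ := lintegral_mono fun a => by
          by_cases h : a ∈ G
          · refine (lintegral_mono fun b => ?_).trans (hB a h)
            exact Set.indicator_le_self _ _ _
          · have : ∀ b, (G ×ˢ (Set.univ : Set β)).indicator f (a, b) = 0 := fun b =>
              Set.indicator_of_notMem (fun hb => h hb.1) _
            simp [this]
      _ = B := by simp

theorem integrable_exp_bernScore {ι : Type*} [Fintype ι] (θ x : ι → ℝ) :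
    Integrable (fun U => Real.exp (bernScore θ x U))
      (Measure.pi fun _ : ι => (volume : Measure unitInterval)) := by
  have hm : Measurable fun U : ι → unitInterval => bernScore θ x U :=
    (measurable_bernScore (Ω := Unit) (θ := fun _ => θ) (x := fun _ => x)
      measurable_const measurable_const).comp (measurable_const (a := ()) |>.prodMk measurable_id)
  refine Integrable.of_bound (C := Real.exp (∑ i, |x i|)) (by fun_prop) (ae_of_all _ fun U => ?_)
  rw [Real.norm_of_nonneg (Real.exp_pos _).le]
  exact Real.exp_le_exp.2 ((le_abs_self _).trans (abs_bernScore_le θ x U))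

theorem bernScore_smul {ι : Type*} [Fintype ι] (θ x : ι → ℝ) (U : ι → unitInterval) (c : ℝ) :
    bernScore θ (c • x) U = c * bernScore θ x U := by
  simp only [bernScore, Finset.mul_sum, Pi.smul_apply, smul_eq_mul]
  exact Finset.sum_congr rfl fun i _ => by ring

theorem IsBernBlock.exists_bernScore_le [∀ N, IsProbabilityMeasure (P N)]
    (h : IsBernBlock P θ x q) (u : EuclideanSpace ℝ κ) {δ : ℝ≥0∞} (hδ : 0 < δ) :
    ∃ K : ℝ, 0 < K ∧ ∀ K' ≥ K, ProbGe (fun N => (P N).prod (uniforms N)) δ fun N =>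
      {w | bernScore (θ N w.1) (x N w.1 u) w.2 ≤ K'} := by
  have h2 : 0 < δ / 2 := ENNReal.half_pos hδ.ne'
  -- Where `bernRem` is within 1 of q/2 ≤ ‖u‖²/2, this bounds the conditional mean of the
  -- exponentiated score.
  set B := Real.exp (‖u‖ ^ 2 / 2 + 1) with hB
  have hlim : Tendsto (fun K : ℝ => ENNReal.ofReal (B * Real.exp (-K))) atTop (𝓝 0) := by
    rw [← ENNReal.ofReal_zero]
    refine ENNReal.tendsto_ofReal ?_
    simpa using (Real.tendsto_exp_neg_atTop_nhds_zero).const_mul B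
  obtain ⟨K, hK⟩ := ((ENNReal.tendsto_nhds_zero.1 hlim _ h2).and (eventually_gt_atTop 0)).exists
  refine ⟨K, hK.2, fun K' hK' => ?_⟩
  filter_upwards [h.rem u 1 one_pos _ h2, h.q_le] with N hN hq
  set G : Set (Ω N) := {ω | |bernRem (θ N ω) (x N ω u) - q N u / 2| ≤ 1} with hG
  have hGm : MeasurableSet G :=
    measurableSet_le (((h.measurable_bernRem N u).sub_const _).abs) measurable_const
  have hsm := measurable_bernScore (h.meas_logit N) (h.meas N u)
  have key := prod_le_of_lintegral_le (μ := P N) (ν := uniforms N) hGm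
    (f := fun w => ENNReal.ofReal (Real.exp (bernScore (θ N w.1) (x N w.1 u) w.2)))
    (by fun_prop) (B := ENNReal.ofReal B) (K := ENNReal.ofReal (Real.exp K'))
    (by simpa using Real.exp_pos _) ENNReal.ofReal_ne_top (fun ω hω => by
      change ∫⁻ U, ENNReal.ofReal (Real.exp (bernScore (θ N ω) (x N ω u) U)) ∂(uniforms N) ≤ _
      rw [← ofReal_integral_eq_lintegral_ofReal (integrable_exp_bernScore _ _)
        (ae_of_all _ fun _ => (Real.exp_pos _).le), integral_exp_bernScore]
      refine ENNReal.ofReal_le_ofReal (Real.exp_le_exp.2 ?_)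
      have h1 := (abs_le.1 (show |bernRem (θ N ω) (x N ω u) - q N u / 2| ≤ 1 from hω)).2
      have h2 := hq u
      linarith)
  refine (measure_mono ?_).trans (key.trans ?_)
  · intro w hw
    have hw' : ¬bernScore (θ N w.1) (x N w.1 u) w.2 ≤ K' := hw
    exact ENNReal.ofReal_le_ofReal (Real.exp_le_exp.2 (not_le.1 hw').le)
  · rw [← ENNReal.add_halves δ]
    refine add_le_add hN (le_trans ?_ hK.1)
    rw [← ENNReal.ofReal_div_of_pos (Real.exp_pos _), div_eq_mul_inv, ← Real.exp_neg]
    refine ENNReal.ofReal_le_ofReal ?_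
    have := Real.exp_pos (‖u‖ ^ 2 / 2 + 1)
    gcongr

theorem bernScore_linear_le [DecidableEq κ] {N : ℕ} (θ : Fin N → ℝ)
    (L : EuclideanSpace ℝ κ →ₗ[ℝ] (Fin N → ℝ)) (U : Fin N → unitInterval) {K : ℝ}
    (hK : ∀ j, |bernScore θ (L (EuclideanSpace.single j 1)) U| ≤ K) (u : EuclideanSpace ℝ κ) :
    bernScore θ (L u) U ≤ ‖u‖ * (Fintype.card κ * K) := by
  have := abs_sum_linear_div_le L (ρ := fun _ => 1)
    (ξ := fun i => (if (U i : ℝ) ≤ Real.sigmoid (θ i) then 1 else 0) - Real.sigmoid (θ i)) (B := K)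
    (fun j => by simpa [bernScore] using hK j) u
  simp only [div_one] at this
  exact (le_abs_self _).trans this

/-- Locally the statement is just uniform convergence of the remainder. Globally, the score is at
most B√q, while the convex remainder, known to be about R²/2 where √q = R, must grow at least
linearly beyond. -/
theorem IsBernBlock.isLANBlock [∀ N, IsProbabilityMeasure (P N)] [DecidableEq κ]
    (h : IsBernBlock P θ x q) (D : ℕ → Set (EuclideanSpace ℝ κ)) :
    IsLANBlock (fun N => (P N).prod (uniforms N)) D
      (fun N w u => bernScore (θ N w.1) (x N w.1 u) w.2 - bernRem (θ N w.1) (x N w.1 u))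
      (fun N w u => bernScore (θ N w.1) (x N w.1 u) w.2) q := by
  refine ⟨?_, ?_⟩
  · intro δ hδ
    set n := Fintype.card κ with hn
    have hδ' : 0 < δ / (2 * n + 1) := ENNReal.div_pos hδ.ne' (by finiteness)
    choose K1 hK1 hP1 using fun j : κ =>
      h.exists_bernScore_le (EuclideanSpace.single j 1) hδ'
    -- Exponential bounds are one-sided; the directions −e_j supply the lower bounds.
    choose K2 hK2 hP2 using fun j : κ =>
      h.exists_bernScore_le (-EuclideanSpace.single j 1) hδ'
    set K := ∑ j, (K1 j + K2 j) with hK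
    have hKj : ∀ j, K1 j ≤ K ∧ K2 j ≤ K := fun j => by
      have : K1 j + K2 j ≤ K := Finset.single_le_sum (f := fun j => K1 j + K2 j)
        (fun j _ => (add_pos (hK1 j) (hK2 j)).le) (Finset.mem_univ j)
      exact ⟨by linarith [hK2 j], by linarith [hK1 j]⟩
    have hK0 : 0 ≤ K := Finset.sum_nonneg fun j _ => (add_pos (hK1 j) (hK2 j)).le
    set B := n * K with hB
    have hB0 : 0 ≤ B := by positivity
    -- With this R the slope R/2 − 1 of the remainder outside the ball equals B + 1, one more than
    -- the slope of the score.
    set R := 2 * (B + 1) + 2 with hR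
    have hR0 : 0 < R := by positivity
    have E1 := ProbGe.iInter fun j => hP1 j K (hKj j).1
    have E2 := ProbGe.iInter fun j => hP2 j K (hKj j).2
    have E3 := Whp.prod_fst (Q := fun N => uniforms N) |>.2
      (h.whp_bernRem hR0 one_pos) _ hδ'
    have E := (E1.inter E2).inter E3
    refine ⟨(B + 1) * R, (E.of_le ?_).mono ?_⟩
    · have : (Fintype.card κ : ℝ≥0∞) * (δ / (2 * n + 1)) + Fintype.card κ * (δ / (2 * n + 1))
          + δ / (2 * n + 1) = (2 * n + 1) * (δ / (2 * n + 1)) := by rw [← hn]; ring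
      rw [this]
      exact ENNReal.mul_div_le
    · filter_upwards [h.proj, h.q_smul] with N hproj hsmul
      rintro w ⟨⟨h1, h2⟩, h3⟩ u -
      obtain ⟨u', hu'1, hu'2, hxu⟩ := hproj u
      have hs := bernScore_linear_le (θ N w.1) (x N w.1) w.2 (K := K) (fun j => by
        rw [abs_le]
        refine ⟨?_, h1 j⟩
        have h2' : bernScore (θ N w.1) (x N w.1 (-EuclideanSpace.single j 1)) w.2 ≤ K := h2 j
        rw [map_neg, ← neg_one_smul ℝ, bernScore_smul] at h2'
        linarith) u'
      rw [hxu] at hs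
      have hsqrt : ‖u'‖ = Real.sqrt (q N u) := by rw [← hu'1, Real.sqrt_sq (norm_nonneg _)]
      set y := Real.sqrt (q N u)
      have hy0 : 0 ≤ y := Real.sqrt_nonneg _
      rw [hsqrt, ← hB] at hs
      change bernScore (θ N w.1) (x N w.1 u) w.2 - bernRem (θ N w.1) (x N w.1 u)
        ≤ (B + 1) * R - y
      rcases le_or_gt y R with hyR | hyR
      · have := bernRem_nonneg (θ N w.1) (x N w.1 u)
        nlinarith
      · have hy : 0 < y := hR0.trans hyR
        have h4 : |bernRem (θ N w.1) (x N w.1 ((R / y) • u')) - q N ((R / y) • u') / 2| ≤ 1 :=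
          h3 _ (by
            rw [norm_smul, Real.norm_of_nonneg (by positivity), hsqrt, div_mul_cancel₀ _ hy.ne'])
        have hq : q N ((R / y) • u') = R ^ 2 := by
          rw [hsmul, hu'2, ← hu'1, hsqrt]; field_simp
        rw [hq] at h4
        -- Convexity along the segment from 0, where the remainder vanishes, to u' carries the bound
        -- from the sphere of radius R out to u'.
        have hconv := (convexOn_bernRem (θ N w.1) (x N w.1)).2 (Set.mem_univ u')
          (Set.mem_univ (0 : EuclideanSpace ℝ κ)) (show 0 ≤ R / y by positivity)
          (show 0 ≤ 1 - R / y by rw [sub_nonneg, div_le_one hy]; exact hyR.le) (by ring)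
        simp only [smul_zero, add_zero, smul_eq_mul] at hconv
        have h00 : bernRem (θ N w.1) (x N w.1 0) = 0 := by simp [bernRem, softplusRem]
        rw [h00, mul_zero, add_zero, hxu] at hconv
        have h5 : R ^ 2 / 2 - 1 ≤ R / y * bernRem (θ N w.1) (x N w.1 u) := by
          have := (abs_le.1 h4).1
          linarith
        rw [div_mul_eq_mul_div, le_div_iff₀ hy] at h5
        have h6 : (R / 2 - 1) * y ≤ bernRem (θ N w.1) (x N w.1 u) := by
          have : R * ((R / 2 - 1) * y) ≤ R * bernRem (θ N w.1) (x N w.1 u) := by nlinarith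
          exact le_of_mul_le_mul_left this hR0
        have h7 : (R / 2 - 1) = B + 1 := by rw [hR]; ring
        rw [h7] at h6
        nlinarith
  · intro R hR ε hε
    refine (Whp.prod_fst (Q := fun N => uniforms N) |>.2 (h.whp_bernRem hR hε)).mono
      (Eventually.of_forall fun N w hw u hu => ?_)
    have := hw u hu
    rw [abs_sub_comm] at this
    refine (le_of_eq ?_).trans this
    congr 1
    ring

/-- The conditional moment generating function of the score at r is the exponential of `bernRem` in
direction r u. Only finitely many r matter for a given accuracy, so pointwise convergence of the
remainder is enough. -/
theorem IsBernBlock.condNormal (h : IsBernBlock P θ x q) (u : EuclideanSpace ℝ κ) :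
    CondNormal P (fun N => uniforms N) (fun N ω U => bernScore (θ N ω) (x N ω u) U)
      fun N => q N u := by
  intro ε hε
  set R := ‖u‖ ^ 2 with hR
  obtain ⟨δ, hδ, Λ, hΛ⟩ := exists_finset_norm_charFun_sub_le R hε
  have hW : Whp P fun N => {ω | ∀ r ∈ Λ,
      ω ∈ {ω | |Real.exp (bernRem (θ N ω) (x N ω ((r : ℝ) • u)))
        - Real.exp ((r : ℝ) ^ 2 * q N u / 2)| ≤ δ}} := by
    refine Whp.biInter Λ (s := fun r N => {ω | |Real.exp (bernRem (θ N ω) (x N ω ((r : ℝ) • u)))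
        - Real.exp ((r : ℝ) ^ 2 * q N u / 2)| ≤ δ}) fun r _ => ?_
    set B := Real.exp ((r : ℝ) ^ 2 * R / 2) with hB
    have hB0 : 0 < B := Real.exp_pos _
    -- The bound 1 permits |eˣ − 1| ≤ 2|x|; the other bound compensates for the factor 2 and for the
    -- size B of the limit.
    refine (h.rem ((r : ℝ) • u) (min 1 (δ / (2 * B))) (by positivity)).mono ?_
    filter_upwards [h.q_smul, h.q_le] with N hsm hle ω hω
    have hω' : |bernRem (θ N ω) (x N ω ((r : ℝ) • u)) - q N ((r : ℝ) • u) / 2|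
      ≤ min 1 (δ / (2 * B)) := hω
    rw [hsm] at hω'
    set a := bernRem (θ N ω) (x N ω ((r : ℝ) • u))
    set b := (r : ℝ) ^ 2 * q N u / 2
    have e : Real.exp a - Real.exp b = Real.exp b * (Real.exp (a - b) - 1) := by
      rw [mul_sub, ← Real.exp_add]; ring_nf
    change |Real.exp a - Real.exp b| ≤ δ
    rw [e, abs_mul, abs_of_pos (Real.exp_pos _)]
    have hb : Real.exp b ≤ B := Real.exp_le_exp.2 (by
      have := hle u
      change (r : ℝ) ^ 2 * q N u / 2 ≤ (r : ℝ) ^ 2 * R / 2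
      gcongr)
    calc _ ≤ B * (2 * (δ / (2 * B))) := by
          gcongr
          refine (Real.abs_exp_sub_one_le (hω'.trans (min_le_left _ _))).trans ?_
          gcongr
          exact hω'.trans (min_le_right _ _)
      _ = δ := by field_simp
  refine hW.mono ?_
  filter_upwards [h.nonneg, h.q_le] with N h0 hle ω hω
  have hm : Measurable fun U : Fin N → unitInterval => bernScore (θ N ω) (x N ω u) U :=
    (measurable_bernScore (h.meas_logit N) (h.meas N u)).comp (measurable_const.prodMk measurable_id)
  have : IsProbabilityMeasure ((uniforms N).map fun U => bernScore (θ N ω) (x N ω u) U) :=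
    Measure.isProbabilityMeasure_map hm.aemeasurable
  have hexp : ∀ t : ℝ, ∀ U, t * bernScore (θ N ω) (x N ω u) U
      = bernScore (θ N ω) (x N ω (t • u)) U := fun t U => by rw [map_smul, bernScore_smul]
  have key := hΛ ((uniforms N).map fun U => bernScore (θ N ω) (x N ω u) U) (q N u)
    ⟨h0 u, hle u⟩ (fun t => by
      rw [integrable_map_measure (by fun_prop) hm.aemeasurable]
      simp only [Function.comp_def, hexp]
      exact integrable_exp_bernScore _ _) (fun r hr => by
      rw [mgf, integral_map hm.aemeasurable (by fun_prop)]
      simp only [id_eq, hexp]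
      rw [integral_exp_bernScore]
      exact hω r hr)
  rw [charFun_apply_real, integral_map hm.aemeasurable (by fun_prop)] at key
  simpa using key

end BernBlock

end RENSEM


namespace RENSEM

/-! ### Asymptotics of maximizers -/

section Argmax

variable {κ : Type*} [Fintype κ] {Ω : ℕ → Type*} [∀ N, MeasurableSpace (Ω N)]
  {P : ∀ N, Measure (Ω N)} {D : ℕ → Set (EuclideanSpace ℝ κ)}
  {ℓ s : ∀ N, Ω N → EuclideanSpace ℝ κ → ℝ} {q : ℕ → EuclideanSpace ℝ κ → ℝ}

/-- Blocks add up. -/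
theorem IsLANBlock.add {ℓ' s' : ∀ N, Ω N → EuclideanSpace ℝ κ → ℝ}
    {q' : ℕ → EuclideanSpace ℝ κ → ℝ} (h : IsLANBlock P D ℓ s q) (h' : IsLANBlock P D ℓ' s' q')
    (hq : ∀ᶠ N in atTop, ∀ u, 0 ≤ q N u) (hq' : ∀ᶠ N in atTop, ∀ u, 0 ≤ q' N u) :
    IsLANBlock P D (fun N w u => ℓ N w u + ℓ' N w u) (fun N w u => s N w u + s' N w u)
      (fun N u => q N u + q' N u) where
  global δ hδ := by
    have h2 : 0 < δ / 2 := ENNReal.half_pos hδ.ne'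
    obtain ⟨A, hA⟩ := h.global _ h2
    obtain ⟨A', hA'⟩ := h'.global _ h2
    refine ⟨A + A', ?_⟩
    have := (hA.inter hA')
    rw [ENNReal.add_halves] at this
    refine this.mono ?_
    filter_upwards [hq, hq'] with N h0 h0'
    rintro w ⟨h1, h2⟩ u hu
    have e1 := h1 u hu
    have e2 := h2 u hu
    have e3 : Real.sqrt (q N u + q' N u) ≤ Real.sqrt (q N u) + Real.sqrt (q' N u) := by
      rw [Real.sqrt_le_left (by positivity)]
      nlinarith [Real.sq_sqrt (h0 u), Real.sq_sqrt (h0' u), Real.sqrt_nonneg (q N u),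
        Real.sqrt_nonneg (q' N u), mul_nonneg (Real.sqrt_nonneg (q N u)) (Real.sqrt_nonneg (q' N u))]
    linarith
  local' R hR ε hε := by
    refine ((h.local' R hR (ε / 2) (by positivity)).inter
      (h'.local' R hR (ε / 2) (by positivity))).mono (Eventually.of_forall ?_)
    rintro N w ⟨h1, h2⟩ u hu
    have e1 := abs_le.1 (h1 u hu)
    have e2 := abs_le.1 (h2 u hu)
    rw [abs_le]
    constructor <;> linarith [e1.1, e1.2, e2.1, e2.2]

/-- A block on the first coordinate of a product space. -/
theorem IsLANBlock.prod_fst {Ω' : ℕ → Type*} [∀ N, MeasurableSpace (Ω' N)]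
    (Q : ∀ N, Measure (Ω' N)) [∀ N, IsProbabilityMeasure (Q N)] (h : IsLANBlock P D ℓ s q) :
    IsLANBlock (fun N => (P N).prod (Q N)) D (fun N w u => ℓ N w.1 u) (fun N w u => s N w.1 u) q where
  global δ hδ := by
    obtain ⟨A, hA⟩ := h.global δ hδ
    exact ⟨A, ProbGe.prod_fst.2 hA⟩
  local' R hR ε hε := Whp.prod_fst.2 (h.local' R hR ε hε)

variable {S : ∀ N, Ω N → EuclideanSpace ℝ κ} {u : ∀ N, Ω N → EuclideanSpace ℝ κ}

/-- At the maximizer 0 ≤ ℓ ≤ A − ‖u‖. -/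
theorem IsLANBlock.exists_norm_argmax_le (h : IsLANBlock P D ℓ s fun _ u => ‖u‖ ^ 2)
    (hmax : Whp P fun N => {w | u N w ∈ D N ∧ 0 ≤ ℓ N w (u N w)}) {δ : ℝ≥0∞} (hδ : 0 < δ) :
    ∃ R : ℝ, ProbGe P δ fun N => {w | ‖u N w‖ ≤ R} := by
  have h2 : 0 < δ / 2 := ENNReal.half_pos hδ.ne'
  obtain ⟨A, hA⟩ := h.global _ h2
  have := hA.inter (hmax _ h2)
  rw [ENNReal.add_halves] at this
  refine ⟨A, this.mono (Eventually.of_forall ?_)⟩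
  rintro N w ⟨h1, h2, h3⟩
  have h4 := h1 _ h2
  rw [Real.sqrt_sq (norm_nonneg _)] at h4
  change ‖u N w‖ ≤ A
  linarith

/-- At the unit vector in the direction of the score, the local expansion bounds the norm of the
score by ℓ plus a constant, and the global bound controls ℓ there. No moments of the score are used.
-/
theorem IsLANBlock.exists_norm_score_le (h : IsLANBlock P D ℓ s fun _ u => ‖u‖ ^ 2)
    (hS : ∀ N w v, s N w v = inner ℝ (S N w) v)
    (hball : ∀ R : ℝ, ∀ᶠ N in atTop, ∀ v, ‖v‖ ≤ R → v ∈ D N) {δ : ℝ≥0∞} (hδ : 0 < δ) :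
    ∃ R : ℝ, ProbGe P δ fun N => {w | ‖S N w‖ ≤ R} := by
  have h2 : 0 < δ / 2 := ENNReal.half_pos hδ.ne'
  obtain ⟨A, hA⟩ := h.global _ h2
  have := hA.inter (h.local' 1 one_pos 1 one_pos _ h2)
  rw [ENNReal.add_halves] at this
  refine ⟨max 0 (A + 2), this.mono ?_⟩
  filter_upwards [hball 1] with N hN
  rintro w ⟨h1, h2⟩
  change ‖S N w‖ ≤ _
  rcases eq_or_ne (S N w) 0 with h0 | h0
  · rw [h0, norm_zero]; exact le_max_left _ _
  · refine le_max_of_le_right ?_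
    set v : EuclideanSpace ℝ κ := ‖S N w‖⁻¹ • S N w with hv
    have hSn : ‖S N w‖ ≠ 0 := norm_ne_zero_iff.2 h0
    have hv1 : ‖v‖ = 1 := by
      rw [hv, norm_smul, norm_inv, norm_norm, inv_mul_cancel₀ hSn]
    have e1 := h1 v (hN v hv1.le)
    have e2 := (abs_le.1 (h2 v hv1.le)).1
    rw [hS, hv1] at e2
    rw [hv1] at e1
    have e3 : inner ℝ (S N w) v = ‖S N w‖ := by
      rw [hv, inner_smul_right, real_inner_self_eq_norm_sq]
      field_simp
    rw [e3] at e2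
    have := Real.sqrt_nonneg ((1 : ℝ) ^ 2)
    linarith

/-- The maximizer of the log-likelihood is asymptotically equal to the normalized score. -/
theorem IsLANBlock.whp_norm_argmax_sub_score_le (h : IsLANBlock P D ℓ s fun _ u => ‖u‖ ^ 2)
    (hS : ∀ N w v, s N w v = inner ℝ (S N w) v)
    (hball : ∀ R : ℝ, ∀ᶠ N in atTop, ∀ v, ‖v‖ ≤ R → v ∈ D N)
    (hmax : Whp P fun N => {w | u N w ∈ D N ∧ ∀ v ∈ D N, ℓ N w v ≤ ℓ N w (u N w)})
    (hzero : ∀ᶠ N in atTop, ∀ w, ℓ N w 0 = 0) {ε : ℝ} (hε : 0 < ε) :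
    Whp P fun N => {w | ‖u N w - S N w‖ ≤ ε} := by
  intro δ hδ
  have h4 : 0 < δ / 2 / 2 := ENNReal.half_pos (ENNReal.half_pos hδ.ne').ne'
  have hmax' : Whp P fun N => {w | u N w ∈ D N ∧ 0 ≤ ℓ N w (u N w)} := by
    refine hmax.mono ?_
    filter_upwards [hzero, hball 0] with N h0 hb
    rintro w ⟨h1, h2⟩
    refine ⟨h1, ?_⟩
    rw [← h0 w]
    exact h2 0 (hb 0 (by simp))
  obtain ⟨R1, hR1⟩ := h.exists_norm_argmax_le hmax' h4
  obtain ⟨R2, hR2⟩ := h.exists_norm_score_le hS hball h4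
  set R := max 1 (max R1 R2) with hR
  have hR0 : 0 < R := lt_of_lt_of_le one_pos (le_max_left _ _)
  have E := (hR1.inter hR2).inter ((h.local' R hR0 (ε ^ 2 / 4) (by positivity) _ h4).inter
    (hmax _ h4))
  rw [ENNReal.add_halves, ENNReal.add_halves] at E
  refine E.mono ?_
  filter_upwards [hball R] with N hb
  rintro w ⟨⟨h1, h2⟩, h3, h4, h5⟩
  have hu : ‖u N w‖ ≤ R := le_trans h1 ((le_max_left _ _).trans (le_max_right _ _))
  have hs : ‖S N w‖ ≤ R := le_trans h2 ((le_max_right _ _).trans (le_max_right _ _))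
  have e1 := (abs_le.1 (h3 _ hu)).2
  have e2 := (abs_le.1 (h3 _ hs)).1
  have e3 := h5 _ (hb _ hs)
  rw [hS] at e1 e2
  rw [real_inner_self_eq_norm_sq] at e2
  -- Comparing the expansions at the maximizer and at the score completes the square: half of this
  -- squared norm is at most the sum of two errors ε²/4.
  have e4 : ‖u N w - S N w‖ ^ 2 ≤ ε ^ 2 := by
    rw [norm_sub_sq_real, real_inner_comm]
    linarith
  change ‖u N w - S N w‖ ≤ ε
  exact le_of_sq_le_sq e4 hε.le

end Argmax

/-! ### Convergence in distribution -/

section Distribution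

variable {κ : Type*} [Fintype κ] {Ω : ℕ → Type*} [∀ N, MeasurableSpace (Ω N)]
  {P : ∀ N, Measure (Ω N)} [∀ N, IsProbabilityMeasure (P N)]

theorem tendstoInDistribution_stdGaussian {X : ∀ N, Ω N → EuclideanSpace ℝ κ}
    (hX : ∀ N, AEMeasurable (X N) (P N))
    (h : ∀ a, Tendsto (fun N => ∫ w, Complex.exp (inner ℝ (X N w) a * Complex.I) ∂(P N)) atTop
      (𝓝 (Real.exp (-‖a‖ ^ 2 / 2) : ℝ))) :
    TendstoInDistribution X atTop (id : EuclideanSpace ℝ κ → EuclideanSpace ℝ κ) P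
      (stdGaussian (EuclideanSpace ℝ κ)) where
  forall_aemeasurable := hX
  aemeasurable_limit := aemeasurable_id
  tendsto := by
    refine ProbabilityMeasure.tendsto_of_tendsto_charFun fun a => ?_
    simp only [ProbabilityMeasure.coe_mk, Measure.map_id, charFun_stdGaussian]
    have e : ∀ N, charFun ((P N).map (X N)) a
        = ∫ w, Complex.exp (inner ℝ (X N w) a * Complex.I) ∂(P N) := fun N => by
      rw [charFun_apply, integral_map (hX N) (by fun_prop)]
    simp_rw [e]
    convert h a using 2
    push_cast
    ring_nf

/-- Slutsky's argument for characteristic functions, with the exponential 1-Lipschitz on the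
imaginary axis. -/
theorem tendsto_integral_cexp_of_whp {X S : ∀ N, Ω N → EuclideanSpace ℝ κ}
    (hX : ∀ N, AEMeasurable (X N) (P N)) (hS : ∀ N, AEMeasurable (S N) (P N))
    (hclose : ∀ ε > 0, Whp P fun N => {w | ‖X N w - S N w‖ ≤ ε}) {a : EuclideanSpace ℝ κ} {c : ℂ}
    (h : Tendsto (fun N => ∫ w, Complex.exp (inner ℝ (S N w) a * Complex.I) ∂(P N)) atTop (𝓝 c)) :
    Tendsto (fun N => ∫ w, Complex.exp (inner ℝ (X N w) a * Complex.I) ∂(P N)) atTop (𝓝 c) := by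
  have hint : ∀ {Y : ∀ N, Ω N → EuclideanSpace ℝ κ}, (∀ N, AEMeasurable (Y N) (P N)) → ∀ N,
      Integrable (fun w => Complex.exp (inner ℝ (Y N w) a * Complex.I)) (P N) := fun {Y} hY N => by
    have := hY N
    refine Integrable.of_bound (C := 1) ?_ (ae_of_all _ fun w => ?_)
    · have : AEMeasurable (fun w => inner ℝ (Y N w) a) (P N) := by fun_prop
      exact (Complex.measurable_exp.comp_aemeasurable
        ((Complex.measurable_ofReal.comp_aemeasurable this).mul_const _)).aestronglyMeasurable
    · rw [Complex.norm_exp_ofReal_mul_I]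
  have hdiff : Tendsto (fun N => ∫ w, Complex.exp (inner ℝ (X N w) a * Complex.I) ∂(P N)
      - ∫ w, Complex.exp (inner ℝ (S N w) a * Complex.I) ∂(P N)) atTop (𝓝 0) := by
    rw [tendsto_zero_iff_norm_tendsto_zero, Metric.tendsto_atTop']
    intro ε hε
    set η := ε / (2 * (‖a‖ + 1)) with hη
    have hη0 : 0 < η := by positivity
    obtain ⟨n0, hn0⟩ := eventually_atTop.1 (hclose η hη0 (ENNReal.ofReal (ε / 5))
      (by simpa using by positivity))
    refine ⟨n0, fun N hN => ?_⟩
    rw [← integral_sub (hint hX N) (hint hS N), dist_zero_right, norm_norm]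
    have key := norm_integral_le_of_le_on (μ := P N) (B := 2) (ε := ε / 2)
      (F := fun w => Complex.exp (inner ℝ (X N w) a * Complex.I)
        - Complex.exp (inner ℝ (S N w) a * Complex.I))
      (fun w => by
        refine (norm_sub_le _ _).trans ?_
        rw [Complex.norm_exp_ofReal_mul_I, Complex.norm_exp_ofReal_mul_I]; norm_num)
      (by positivity) (G := {w | ‖X N w - S N w‖ ≤ η}) (fun w hw => by
        refine (norm_cexp_sub_cexp_le (by simp) (by simp)).trans ?_
        rw [← sub_mul, norm_mul, Complex.norm_I, mul_one, ← Complex.ofReal_sub, ← inner_sub_left,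
          Complex.norm_real]
        refine (norm_inner_le_norm _ _).trans ?_
        have h1 : ‖X N w - S N w‖ ≤ η := hw
        calc _ ≤ η * (‖a‖ + 1) := by gcongr; linarith
          _ = ε / 2 := by rw [hη]; field_simp)
    have : (P N).real {w | ‖X N w - S N w‖ ≤ η}ᶜ ≤ ε / 5 :=
      ENNReal.toReal_le_of_le_ofReal (by positivity) (hn0 N hN.le)
    linarith
  simpa using hdiff.add h

/-- The variances q and r need not converge separately, hence the formulation by differences. Only
their final sum has a limit. -/
theorem tendsto_of_sub_mul_exp {a b : ℕ → ℂ} {q r : ℕ → ℝ} (hq : ∀ᶠ N in atTop, 0 ≤ q N)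
    (hab : Tendsto (fun N => a N - b N * Real.exp (-q N / 2)) atTop (𝓝 0))
    (hb : Tendsto (fun N => b N - Real.exp (-r N / 2)) atTop (𝓝 0)) :
    Tendsto (fun N => a N - Real.exp (-(q N + r N) / 2)) atTop (𝓝 0) := by
  have h1 : Tendsto (fun N => (b N - Real.exp (-r N / 2)) * Real.exp (-q N / 2)) atTop (𝓝 0) := by
    refine squeeze_zero_norm' ?_ (tendsto_zero_iff_norm_tendsto_zero.1 hb)
    filter_upwards [hq] with N hN
    rw [norm_mul, Complex.norm_real, Real.norm_of_nonneg (Real.exp_pos _).le]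
    exact mul_le_of_le_one_right (norm_nonneg _) (Real.exp_le_one_iff.2 (by linarith))
  have h2 := hab.add h1
  rw [add_zero] at h2
  refine h2.congr fun N => ?_
  have : Real.exp (-(q N + r N) / 2) = Real.exp (-r N / 2) * Real.exp (-q N / 2) := by
    rw [← Real.exp_add]; ring_nf
  rw [this]
  push_cast
  ring

end Distribution

end RENSEM


namespace RENSEM

/-! ### Spectral form of the covariance matrices -/

section Spectral

variable {N p : ℕ}

theorem posSemidef_gram (G : SimpleGraph (Fin N)) :
    (adjacency G * (adjacency G)ᵀ).PosSemidef := by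
  simpa [Matrix.conjTranspose_eq_transpose_of_trivial] using
    Matrix.posSemidef_self_mul_conjTranspose (adjacency G)

/-- The eigenvalues of `E Eᵀ`. -/
noncomputable def eig (G : SimpleGraph (Fin N)) : Fin N → ℝ :=
  (posSemidef_gram G).isHermitian.eigenvalues

/-- An orthogonal matrix of eigenvectors of `E Eᵀ`. -/
noncomputable def rot (G : SimpleGraph (Fin N)) : Matrix (Fin N) (Fin N) ℝ :=
  (posSemidef_gram G).isHermitian.eigenvectorUnitary

theorem eig_nonneg (G : SimpleGraph (Fin N)) (i : Fin N) : 0 ≤ eig G i :=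
  (posSemidef_gram G).eigenvalues_nonneg i

theorem rot_mul_transpose (G : SimpleGraph (Fin N)) : rot G * (rot G)ᵀ = 1 := by
  have := Unitary.coe_mul_star_self (posSemidef_gram G).isHermitian.eigenvectorUnitary
  rwa [Unitary.coe_star, Matrix.star_eq_conjTranspose,
    Matrix.conjTranspose_eq_transpose_of_trivial] at this

theorem transpose_mul_rot (G : SimpleGraph (Fin N)) : (rot G)ᵀ * rot G = 1 :=
  mul_eq_one_comm.1 (rot_mul_transpose G)

theorem gram_eq (G : SimpleGraph (Fin N)) :
    adjacency G * (adjacency G)ᵀ = rot G * Matrix.diagonal (eig G) * (rot G)ᵀ := by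
  have := (posSemidef_gram G).isHermitian.spectral_theorem
  rw [Unitary.conjStarAlgAut_apply, Matrix.star_eq_conjTranspose,
    Matrix.conjTranspose_eq_transpose_of_trivial] at this
  exact this

/-- One rotation diagonalizes the covariances for all values of the variance components at once.
Without it the parameters could not be compared coordinate by coordinate. -/
theorem cov_eq (G : SimpleGraph (Fin N)) (s t : ℝ) :
    s • (1 : Matrix (Fin N) (Fin N) ℝ) + t • (adjacency G * (adjacency G)ᵀ)
      = rot G * Matrix.diagonal (fun i => s + t * eig G i) * (rot G)ᵀ := by
  have e : Matrix.diagonal (fun i => s + t * eig G i)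
      = s • (1 : Matrix (Fin N) (Fin N) ℝ) + t • Matrix.diagonal (eig G) := by
    ext i j
    by_cases h : i = j
    · subst h; simp
    · simp [h]
  rw [e, mul_add, add_mul, gram_eq, Matrix.mul_smul, Matrix.mul_smul, Matrix.smul_mul,
    Matrix.smul_mul, mul_one, rot_mul_transpose]

theorem gaussianLogLik_cov (G : SimpleGraph (Fin N)) {s t : ℝ} (hpos : ∀ i, 0 < s + t * eig G i)
    (r : Fin N → ℝ) :
    gaussianLogLik (s • 1 + t • (adjacency G * (adjacency G)ᵀ)) r
      = -(N / 2 : ℝ) * Real.log (2 * Real.pi)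
        - 1 / 2 * ∑ i, (Real.log (s + t * eig G i)
          + (((rot G)ᵀ *ᵥ r) i) ^ 2 / (s + t * eig G i)) := by
  have hdet : (rot G * Matrix.diagonal (fun i => s + t * eig G i) * (rot G)ᵀ).det
      = ∏ i, (s + t * eig G i) := by
    rw [Matrix.det_mul_comm, ← mul_assoc, transpose_mul_rot, one_mul, Matrix.det_diagonal]
  have hinv : (rot G * Matrix.diagonal (fun i => s + t * eig G i) * (rot G)ᵀ)⁻¹
      = rot G * Matrix.diagonal (fun i => (s + t * eig G i)⁻¹) * (rot G)ᵀ := by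
    refine Matrix.inv_eq_right_inv ?_
    calc _ = rot G * Matrix.diagonal (fun i => s + t * eig G i) * ((rot G)ᵀ * rot G)
          * Matrix.diagonal (fun i => (s + t * eig G i)⁻¹) * (rot G)ᵀ := by
          simp only [mul_assoc]
      _ = 1 := by
          rw [transpose_mul_rot, mul_one, mul_assoc (rot G), Matrix.diagonal_mul_diagonal]
          simp [(hpos _).ne', rot_mul_transpose]
  rw [gaussianLogLik, cov_eq, hdet, hinv, Real.log_prod fun i _ => (hpos i).ne']
  have hq : r ⬝ᵥ (rot G * Matrix.diagonal (fun i => (s + t * eig G i)⁻¹) * (rot G)ᵀ) *ᵥ r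
      = ∑ i, (((rot G)ᵀ *ᵥ r) i) ^ 2 / (s + t * eig G i) := by
    rw [← Matrix.mulVec_mulVec, ← Matrix.mulVec_mulVec, Matrix.dotProduct_mulVec,
      ← Matrix.mulVec_transpose]
    simp only [dotProduct, Matrix.mulVec_diagonal]
    exact Finset.sum_congr rfl fun i _ => by ring
  rw [hq, Finset.sum_add_distrib]
  ring

end Spectral

/-! ### One linear model of the likelihood -/

section Model

variable {N p : ℕ} {ι : Type*} [Fintype ι]

/-- The variances of the rotated residuals. -/
noncomputable def scale (G : SimpleGraph (Fin N)) (s t : ParamIdx p) (φ : Param p) (i : Fin N) : ℝ :=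
  φ s + φ t * eig G i

theorem scale_pos (G : SimpleGraph (Fin N)) {s t : ParamIdx p} {φ : Param p} (hs : 0 < φ s)
    (ht : 0 ≤ φ t) (i : Fin N) : 0 < scale G s t φ i :=
  add_pos_of_pos_of_nonneg hs (mul_nonneg ht (eig_nonneg G i))

/-- Relative changes of the variances of the rotated residuals. -/
noncomputable def covDir (G : SimpleGraph (Fin N)) (s t : ParamIdx p) (φ : Param p) :
    Param p →ₗ[ℝ] (Fin N → ℝ) where
  toFun h i := scale G s t h i / scale G s t φ i
  map_add' h h' := by
    ext i; simp only [scale, PiLp.add_apply, Pi.add_apply]; ring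
  map_smul' c h := by
    ext i; simp only [scale, PiLp.smul_apply, Pi.smul_apply, smul_eq_mul, RingHom.id_apply]; ring

/-- Standardized changes of the means of the rotated responses. -/
noncomputable def meanDir (G : SimpleGraph (Fin N)) (b : ι → ParamIdx p) (s t : ParamIdx p)
    (φ : Param p) (X : Matrix (Fin N) ι ℝ) : Param p →ₗ[ℝ] (Fin N → ℝ) where
  toFun h i := ((rot G)ᵀ *ᵥ (X *ᵥ fun k => h (b k))) i / Real.sqrt (scale G s t φ i)
  map_add' h h' := by
    ext i
    have : (fun k => (h + h') (b k)) = (fun k => h (b k)) + fun k => h' (b k) := rfl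
    rw [this, Matrix.mulVec_add, Matrix.mulVec_add, Pi.add_apply, add_div, Pi.add_apply]
  map_smul' c h := by
    ext i
    have : (fun k => (c • h) (b k)) = c • fun k => h (b k) := rfl
    rw [this, Matrix.mulVec_smul, Matrix.mulVec_smul, Pi.smul_apply, smul_eq_mul, mul_div_assoc]
    rfl

/-- Correlated noise made from white noise. -/
noncomputable def colour (G : SimpleGraph (Fin N)) (s t : ParamIdx p) (φ : Param p)
    (z : Fin N → ℝ) : Fin N → ℝ :=
  rot G *ᵥ fun i => Real.sqrt (scale G s t φ i) * z i

/-- The variances of the rotated residuals are linear in the parameter, so their ratio at φ + h and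
φ is exactly 1 plus a linear function of h. The identity therefore holds for large h too, as the
global bound requires. -/
theorem gaussianLogLik_sub (G : SimpleGraph (Fin N)) {b : ι → ParamIdx p} {s t : ParamIdx p}
    {φ h : Param p} (hs : 0 < φ s) (ht : 0 ≤ φ t) (hs' : 0 < (φ + h) s) (ht' : 0 ≤ (φ + h) t)
    (X : Matrix (Fin N) ι ℝ) (z : Fin N → ℝ) {R : Fin N → ℝ}
    (hR : R = (X *ᵥ fun k => φ (b k)) + colour G s t φ z) :
    gaussianLogLik ((φ + h) s • 1 + (φ + h) t • (adjacency G * (adjacency G)ᵀ))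
        (R - X *ᵥ fun k => (φ + h) (b k))
      - gaussianLogLik (φ s • 1 + φ t • (adjacency G * (adjacency G)ᵀ)) (R - X *ᵥ fun k => φ (b k))
      = gdev (covDir G s t φ h) (meanDir G b s t φ X h) z := by
  have hp := scale_pos G hs ht
  have hp' := scale_pos G hs' ht'
  rw [gaussianLogLik_cov G hp, gaussianLogLik_cov G hp', gdev]
  have e1 : (rot G)ᵀ *ᵥ (R - X *ᵥ fun k => φ (b k))
      = fun i => Real.sqrt (scale G s t φ i) * z i := by
    rw [hR, add_sub_cancel_left, colour, Matrix.mulVec_mulVec, transpose_mul_rot,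
      Matrix.one_mulVec]
  have e2 : ∀ i, ((rot G)ᵀ *ᵥ (R - X *ᵥ fun k => (φ + h) (b k))) i
      = Real.sqrt (scale G s t φ i) * (z i - meanDir G b s t φ X h i) := fun i => by
    have : (fun k => (φ + h) (b k)) = (fun k => φ (b k)) + fun k => h (b k) := rfl
    rw [this, Matrix.mulVec_add, ← sub_sub, Matrix.mulVec_sub, e1]
    have h0 : Real.sqrt (scale G s t φ i) ≠ 0 := (Real.sqrt_pos.2 (hp i)).ne'
    simp only [Pi.sub_apply, meanDir, LinearMap.coe_mk, AddHom.coe_mk]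
    field_simp
  rw [sub_sub_sub_cancel_left, ← mul_sub, ← Finset.sum_sub_distrib, e1, neg_mul, ← mul_neg,
    ← Finset.sum_neg_distrib]
  congr 1
  refine Finset.sum_congr rfl fun i _ => ?_
  rw [e2]
  have h1 : (φ + h) s + (φ + h) t * eig G i = scale G s t φ i * (1 + covDir G s t φ h i) := by
    simp only [covDir, LinearMap.coe_mk, AddHom.coe_mk, PiLp.add_apply]
    rw [mul_add, mul_div_cancel₀ _ (hp i).ne']
    simp only [scale]; ring
  have h2 : 0 < 1 + covDir G s t φ h i := by
    have := hp' i
    rw [scale, h1] at this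
    exact (pos_iff_pos_of_mul_pos this).1 (hp i)
  have h3 : φ s + φ t * eig G i = scale G s t φ i := rfl
  rw [h1, h3, Real.log_mul (hp i).ne' h2.ne', mul_pow, mul_pow, Real.sq_sqrt (hp i).le,
    mul_div_mul_left _ _ (hp i).ne', mul_div_cancel_left₀ _ (hp i).ne']
  ring

theorem contDiffAt_gaussianLogLik (G : SimpleGraph (Fin N)) {b : ι → ParamIdx p}
    {s t : ParamIdx p} {φ : Param p} (hs : 0 < φ s) (ht : 0 < φ t) (X : Matrix (Fin N) ι ℝ)
    (R : Fin N → ℝ) :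
    ContDiffAt ℝ 2 (fun ψ : Param p =>
      gaussianLogLik (ψ s • 1 + ψ t • (adjacency G * (adjacency G)ᵀ))
        (R - X *ᵥ fun k => ψ (b k))) φ := by
  have hc : ∀ k, Continuous fun ψ : Param p => ψ k := fun k => by fun_prop
  -- Near φ the variance components stay positive, so determinant and inverse may be replaced by the
  -- spectral formula, whose smoothness is elementary.
  have hev : (fun ψ : Param p => gaussianLogLik (ψ s • 1 + ψ t • (adjacency G * (adjacency G)ᵀ))
        (R - X *ᵥ fun k => ψ (b k))) =ᶠ[𝓝 φ] fun ψ => -(N / 2 : ℝ) * Real.log (2 * Real.pi)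
        - 1 / 2 * ∑ i, (Real.log (ψ s + ψ t * eig G i)
          + (((rot G)ᵀ *ᵥ (R - X *ᵥ fun k => ψ (b k))) i) ^ 2 / (ψ s + ψ t * eig G i)) := by
    filter_upwards [(hc s).continuousAt.eventually (lt_mem_nhds hs),
      (hc t).continuousAt.eventually (lt_mem_nhds ht)] with ψ h1 h2
    exact gaussianLogLik_cov G (scale_pos G h1 h2.le) _
  refine ContDiffAt.congr_of_eventuallyEq ?_ hev
  have hk : ∀ k, ContDiffAt ℝ 2 (fun ψ : Param p => ψ k) φ := fun k => by fun_prop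
  refine contDiffAt_const.sub (contDiffAt_const.mul (ContDiffAt.sum fun i _ => ?_))
  have hd : ContDiffAt ℝ 2 (fun ψ : Param p => ψ s + ψ t * eig G i) φ :=
    (hk s).add ((hk t).mul contDiffAt_const)
  have hne : φ s + φ t * eig G i ≠ 0 := (scale_pos G hs ht.le i).ne'
  refine (hd.log hne).add (ContDiffAt.div (ContDiffAt.pow ?_ 2) hd hne)
  simp only [Matrix.mulVec, dotProduct, Pi.sub_apply]
  fun_prop

end Model

/-! ### Second derivatives -/

section SecondDerivative

variable {N p : ℕ}

/-- The quadratic form of a matrix. -/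
noncomputable def quadForm {κ : Type*} [Fintype κ] (J : Matrix κ κ ℝ) (h : EuclideanSpace ℝ κ) : ℝ :=
  h.ofLp ⬝ᵥ J *ᵥ h.ofLp

theorem fderiv_fderiv_eq {E : Type*} [NormedAddCommGroup E] [NormedSpace ℝ E] {f : E → ℝ} {φ h : E}
    (hf : ContDiffAt ℝ 2 f φ) {g' : ℝ → ℝ} {g'' : ℝ}
    (h1 : ∀ᶠ t in 𝓝 (0 : ℝ), HasDerivAt (fun t : ℝ => f (φ + t • h)) (g' t) t)
    (h2 : HasDerivAt g' g'' 0) : fderiv ℝ (fderiv ℝ f) φ h h = g'' := by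
  have hF : DifferentiableAt ℝ (fderiv ℝ f) φ :=
    (hf.fderiv_right (m := 1) (by norm_num)).differentiableAt (by norm_num)
  have hline : ∀ t : ℝ, HasDerivAt (fun t : ℝ => φ + t • h) h t := fun t => by
    simpa using ((hasDerivAt_id t).smul_const h).const_add φ
  have hg' : g' =ᶠ[𝓝 0] fun t => fderiv ℝ f (φ + t • h) h := by
    have hd : ∀ᶠ ψ in 𝓝 φ, DifferentiableAt ℝ f ψ := by
      filter_upwards [hf.eventually (by simp)] with ψ hψ
      exact hψ.differentiableAt (by norm_num)
    have hcont : Tendsto (fun t : ℝ => φ + t • h) (𝓝 0) (𝓝 φ) := by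
      have := (hline 0).continuousAt.tendsto
      simpa using this
    filter_upwards [h1, hcont.eventually hd] with t ht1 ht2
    have := ht2.hasFDerivAt.comp_hasDerivAt t (hline t)
    exact ht1.unique this
  have hg'' : HasDerivAt (fun t : ℝ => fderiv ℝ f (φ + t • h) h)
      (fderiv ℝ (fderiv ℝ f) φ h h) 0 := by
    have hF0 : HasFDerivAt (fderiv ℝ f) (fderiv ℝ (fderiv ℝ f) φ) (φ + (0 : ℝ) • h) := by
      simpa using hF.hasFDerivAt
    have h3 : HasDerivAt (fun t : ℝ => fderiv ℝ f (φ + t • h)) (fderiv ℝ (fderiv ℝ f) φ h) 0 :=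
      hF0.comp_hasDerivAt (0 : ℝ) (hline 0)
    have := h3.clm_apply (hasDerivAt_const (0 : ℝ) h)
    simpa using this
  exact (hg''.congr_of_eventuallyEq hg').unique h2

/-- Only diagonal values of the Hessian are needed later, and these come from calculus in one
variable along lines. -/
theorem quadForm_obsInfo {G : SimpleGraph (Fin N)} {x : Data N p} {φ h : Param p}
    (hf : ContDiffAt ℝ 2 (logLik G x) φ) {g' : ℝ → ℝ} {g'' : ℝ}
    (h1 : ∀ᶠ t in 𝓝 (0 : ℝ), HasDerivAt (fun t : ℝ => logLik G x (φ + t • h)) (g' t) t)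
    (h2 : HasDerivAt g' g'' 0) : quadForm (obsInfo G x φ) h = -g'' := by
  have hF : DifferentiableAt ℝ (fderiv ℝ (logLik G x)) φ :=
    (hf.fderiv_right (m := 1) (by norm_num)).differentiableAt (by norm_num)
  have hsp : ∀ k l, secondPartial (logLik G x) φ k l = fderiv ℝ (fderiv ℝ (logLik G x)) φ
      (EuclideanSpace.single k 1) (EuclideanSpace.single l 1) := fun k l => by
    rw [secondPartial, (hF.hasFDerivAt.clm_apply (hasFDerivAt_const _ _)).fderiv]
    simp
  rw [← fderiv_fderiv_eq hf h1 h2]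
  generalize fderiv ℝ (fderiv ℝ (logLik G x)) φ = F' at hsp
  have hsum : h = ∑ k, h k • EuclideanSpace.single k (1 : ℝ) := by
    conv_lhs => rw [← (EuclideanSpace.basisFun _ ℝ).sum_repr h]
    simp
  have e1 : ∀ v, F' h v = ∑ k, h k * F' (EuclideanSpace.single k 1) v := fun v => by
    conv_lhs => rw [hsum, map_sum, sum_apply]
    simp
  have e2 : ∀ v, F' v h = ∑ l, h l * F' v (EuclideanSpace.single l 1) := fun v => by
    conv_lhs => rw [hsum, map_sum]
    simp
  rw [e1, ← Finset.sum_neg_distrib]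
  simp only [quadForm, dotProduct, Matrix.mulVec, obsInfo, Matrix.of_apply, hsp, e2, neg_mul,
    Finset.sum_neg_distrib, mul_neg]
  refine congrArg Neg.neg (Finset.sum_congr rfl fun k _ => ?_)
  exact congrArg _ (Finset.sum_congr rfl fun l _ => mul_comm _ _)

theorem hasDerivAt_gdev {ι : Type*} [Fintype ι] (w x z : ι → ℝ) {t : ℝ}
    (ht : ∀ i, 0 < 1 + t * w i) :
    HasDerivAt (fun t : ℝ => gdev (t • w) (t • x) z)
      (-(1 / 2) * ∑ i, (w i / (1 + t * w i) + ((-2 * (z i - t * x i) * x i) * (1 + t * w i)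
        - (z i - t * x i) ^ 2 * w i) / (1 + t * w i) ^ 2)) t := by
  unfold gdev
  refine HasDerivAt.const_mul _ (HasDerivAt.fun_sum fun i _ => ?_)
  simp only [Pi.smul_apply, smul_eq_mul]
  have h1 : HasDerivAt (fun t : ℝ => 1 + t * w i) (w i) t := by
    simpa using ((hasDerivAt_id t).mul_const (w i)).const_add 1
  have h2 : HasDerivAt (fun t : ℝ => (z i - t * x i) ^ 2) (-2 * (z i - t * x i) * x i) t := by
    have := (((hasDerivAt_id' t).mul_const (x i)).const_sub (z i)).fun_pow 2
    exact this.congr_deriv (by push_cast; ring)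
  simpa using ((h1.log (ht i).ne').add (h2.div h1 (ht i).ne')).sub_const (z i ^ 2)

theorem hasDerivAt_deriv_gdev {ι : Type*} [Fintype ι] (w x z : ι → ℝ) :
    HasDerivAt (fun t : ℝ => -(1 / 2) * ∑ i, (w i / (1 + t * w i)
        + ((-2 * (z i - t * x i) * x i) * (1 + t * w i)
        - (z i - t * x i) ^ 2 * w i) / (1 + t * w i) ^ 2))
      (-∑ i, (x i ^ 2 + 2 * z i * x i * w i + z i ^ 2 * w i ^ 2 - w i ^ 2 / 2)) 0 := by
  have key : ∀ i, HasDerivAt (fun t : ℝ => w i / (1 + t * w i)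
        + ((-2 * (z i - t * x i) * x i) * (1 + t * w i)
        - (z i - t * x i) ^ 2 * w i) / (1 + t * w i) ^ 2)
      (2 * (x i ^ 2 + 2 * z i * x i * w i + z i ^ 2 * w i ^ 2 - w i ^ 2 / 2)) 0 := fun i => by
    have h1 : HasDerivAt (fun t : ℝ => 1 + t * w i) (w i) 0 := by
      simpa using ((hasDerivAt_id (0 : ℝ)).mul_const (w i)).const_add 1
    have h2 : HasDerivAt (fun t : ℝ => z i - t * x i) (-x i) 0 := by
      simpa using ((hasDerivAt_id (0 : ℝ)).mul_const (x i)).const_sub (z i)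
    have hne : (1 + (0 : ℝ) * w i) ≠ 0 := by simp
    have := ((hasDerivAt_const (0 : ℝ) (w i)).div h1 hne).add
      ((((h2.const_mul (-2)).mul_const (x i)).mul h1 |>.sub ((h2.pow 2).mul_const (w i))).div
        (h1.pow 2) (pow_ne_zero 2 hne))
    refine HasDerivAt.congr_deriv this ?_
    simp only [zero_mul, add_zero, sub_zero, Pi.pow_apply, Pi.sub_apply, Pi.mul_apply]
    push_cast
    ring
  have := (HasDerivAt.fun_sum fun i (_ : i ∈ Finset.univ) => key i).const_mul (-(1 / 2) : ℝ)
  refine this.congr_deriv ?_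
  rw [← Finset.mul_sum]
  ring

end SecondDerivative

end RENSEM


namespace RENSEM

/-! ### The likelihood in whitened coordinates -/

section Whitening

variable {N p : ℕ}

/-- The index of a variance component. -/
abbrev varIdx {p : ℕ} (k : Fin 4) : ParamIdx p := Sum.inr (Sum.inr (Sum.inr k))

/-- The index of a coefficient of the mediator model. -/
abbrev gammaIdx {p : ℕ} (k : GammaIdx p) : ParamIdx p := Sum.inr (Sum.inl k)

/-- The linear predictors of the exposure model. -/
noncomputable def logitDir (C : Fin N → Fin p → ℝ) : Param p →ₗ[ℝ] (Fin N → ℝ) where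
  toFun h i := alpha h ⬝ᵥ C i
  map_add' h h' := by
    ext i
    have : alpha (h + h') = alpha h + alpha h' := rfl
    simp only [this, add_dotProduct, Pi.add_apply]
  map_smul' c h := by
    ext i
    have : alpha (c • h) = c • alpha h := rfl
    simp only [this, smul_dotProduct, Pi.smul_apply, RingHom.id_apply]

theorem propensity_eq_sigmoid (φ : Param p) (C : Fin N → Fin p → ℝ) (i : Fin N) :
    propensity φ (C i) = Real.sigmoid (logitDir C φ i) :=
  (sigmoid_eq_div _).symm

/-- The log-likelihood of the exposures. -/
noncomputable def exposureLogLik (C : Fin N → Fin p → ℝ) (A : Fin N → ℝ) (φ : Param p) : ℝ :=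
  ∑ i, (A i * logitDir C φ i - softplus (logitDir C φ i))

/-- The log-likelihood of the outcomes given the other variables. -/
noncomputable def outcomeLogLik (G : SimpleGraph (Fin N)) (x : Data N p) (φ : Param p) : ℝ :=
  gaussianLogLik (φ (varIdx 0) • 1 + φ (varIdx 1) • (adjacency G * (adjacency G)ᵀ))
    (x.2.2.2 - designY G x.1 x.2.1 x.2.2.1 *ᵥ fun k => φ (Sum.inl k))

/-- The log-likelihood of the mediators given exposures and confounders. -/
noncomputable def mediatorLogLik (G : SimpleGraph (Fin N)) (x : Data N p) (φ : Param p) : ℝ :=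
  gaussianLogLik (φ (varIdx 2) • 1 + φ (varIdx 3) • (adjacency G * (adjacency G)ᵀ))
    (x.2.2.1 - designM G x.1 x.2.1 *ᵥ fun k => φ (gammaIdx k))

/-- The log-odds of the propensity are linear in α, which puts the exposure term in
exponential-family form with cumulant function `softplus`. -/
theorem logLik_eq (G : SimpleGraph (Fin N)) (x : Data N p) (φ : Param p) :
    logLik G x φ = outcomeLogLik G x φ + mediatorLogLik G x φ + exposureLogLik x.1 x.2.1 φ := by
  have h : ∀ t : ℝ, Real.log (Real.sigmoid t / (1 - Real.sigmoid t)) = t ∧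
      Real.log (1 - Real.sigmoid t) = -softplus t := fun t => by
    have h1 : 1 - Real.sigmoid t = (1 + Real.exp t)⁻¹ := by
      rw [sigmoid_eq_div]; field_simp; ring
    have h2 : Real.sigmoid t / (1 - Real.sigmoid t) = Real.exp t := by
      rw [h1, sigmoid_eq_div]; field_simp
    exact ⟨by rw [h2, Real.log_exp], by rw [h1, Real.log_inv, softplus]⟩
  have he : exposureLogLik x.1 x.2.1 φ
      = ∑ i, x.2.1 i * Real.log (propensity φ (x.1 i) / (1 - propensity φ (x.1 i)))
        + ∑ i, Real.log (1 - propensity φ (x.1 i)) := by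
    rw [← Finset.sum_add_distrib]
    refine Finset.sum_congr rfl fun i _ => ?_
    rw [propensity_eq_sigmoid, (h _).1, (h _).2]; ring
  rw [he]
  rfl

theorem contDiff_softplus : ContDiff ℝ 2 softplus :=
  (contDiff_const.add Real.contDiff_exp).log fun t => by positivity

theorem contDiff_exposureLogLik (C : Fin N → Fin p → ℝ) (A : Fin N → ℝ) :
    ContDiff ℝ 2 (exposureLogLik C A) := by
  have h : ∀ i, ContDiff ℝ 2 fun φ => logitDir C φ i := fun i => by
    simp only [logitDir, LinearMap.coe_mk, AddHom.coe_mk, dotProduct, alpha]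
    fun_prop
  exact ContDiff.sum fun i _ => (contDiff_const.mul (h i)).sub (contDiff_softplus.comp (h i))

theorem contDiffAt_logLik (G : SimpleGraph (Fin N)) (x : Data N p) {φ : Param p}
    (hφ : ∀ k, 0 < variances φ k) : ContDiffAt ℝ 2 (logLik G x) φ := by
  refine ContDiffAt.congr_of_eventuallyEq ?_ (Eventually.of_forall (logLik_eq G x))
  exact ((contDiffAt_gaussianLogLik G (hφ 0) (hφ 1) _ _).add
    (contDiffAt_gaussianLogLik G (hφ 2) (hφ 3) _ _)).add (contDiff_exposureLogLik _ _).contDiffAt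

/-- Mediators made from white noise. -/
noncomputable def whiteMediator (G : SimpleGraph (Fin N)) (φ : Param p) (C : Fin N → Fin p → ℝ)
    (A z : Fin N → ℝ) : Fin N → ℝ :=
  designM G C A *ᵥ gamma φ + colour G (varIdx 2) (varIdx 3) φ z

/-- Data made from confounders, uniform variables, and white noise. -/
noncomputable def whiteData (G : SimpleGraph (Fin N)) (φ : Param p)
    (ω : (((Fin N → Fin p → ℝ) × (Fin N → unitInterval)) × (Fin N → ℝ)) × (Fin N → ℝ)) :
    Data N p :=
  let C := ω.1.1.1
  let A := exposure φ C ω.1.1.2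
  let M := whiteMediator G φ C A ω.1.2
  (C, A, M, designY G C A M *ᵥ beta φ + colour G (varIdx 0) (varIdx 1) φ ω.2)

/-- The direction of means of the mediator model. -/
noncomputable def meanM (G : SimpleGraph (Fin N)) (φ : Param p)
    (ω : (Fin N → Fin p → ℝ) × (Fin N → unitInterval)) : Param p →ₗ[ℝ] (Fin N → ℝ) :=
  meanDir G gammaIdx (varIdx 2) (varIdx 3) φ (designM G ω.1 (exposure φ ω.1 ω.2))

/-- The direction of means of the outcome model. -/
noncomputable def meanY (G : SimpleGraph (Fin N)) (φ : Param p)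
    (ω : ((Fin N → Fin p → ℝ) × (Fin N → unitInterval)) × (Fin N → ℝ)) :
    Param p →ₗ[ℝ] (Fin N → ℝ) :=
  meanDir G Sum.inl (varIdx 0) (varIdx 1) φ (designY G ω.1.1 (exposure φ ω.1.1 ω.1.2)
    (whiteMediator G φ ω.1.1 (exposure φ ω.1.1 ω.1.2) ω.2))

theorem exposureLogLik_sub (C : Fin N → Fin p → ℝ) (U : Fin N → unitInterval) (φ h : Param p) :
    exposureLogLik C (exposure φ C U) (φ + h) - exposureLogLik C (exposure φ C U) φ
      = bernScore (logitDir C φ) (logitDir C h) U - bernRem (logitDir C φ) (logitDir C h) := by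
  simp only [exposureLogLik, bernScore, bernRem, ← Finset.sum_sub_distrib]
  refine Finset.sum_congr rfl fun i _ => ?_
  simp only [exposure, propensity_eq_sigmoid, softplusRem, map_add, Pi.add_apply]
  ring

theorem logLik_whiteData_sub (G : SimpleGraph (Fin N)) {φ h : Param p}
    (hφ : ∀ k, 0 < variances φ k) (hφ' : ∀ k, 0 < variances (φ + h) k)
    (ω : (((Fin N → Fin p → ℝ) × (Fin N → unitInterval)) × (Fin N → ℝ)) × (Fin N → ℝ)) :
    logLik G (whiteData G φ ω) (φ + h) - logLik G (whiteData G φ ω) φ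
      = gdev (covDir G (varIdx 0) (varIdx 1) φ h) (meanY G φ ω.1 h) ω.2
        + gdev (covDir G (varIdx 2) (varIdx 3) φ h) (meanM G φ ω.1.1 h) ω.1.2
        + (bernScore (logitDir ω.1.1.1 φ) (logitDir ω.1.1.1 h) ω.1.1.2
          - bernRem (logitDir ω.1.1.1 φ) (logitDir ω.1.1.1 h)) := by
  have hY : outcomeLogLik G (whiteData G φ ω) (φ + h) - outcomeLogLik G (whiteData G φ ω) φ
      = gdev (covDir G (varIdx 0) (varIdx 1) φ h) (meanY G φ ω.1 h) ω.2 :=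
    gaussianLogLik_sub (b := Sum.inl) G (hφ 0) (hφ 1).le (hφ' 0) (hφ' 1).le _ ω.2 rfl
  have hM : mediatorLogLik G (whiteData G φ ω) (φ + h) - mediatorLogLik G (whiteData G φ ω) φ
      = gdev (covDir G (varIdx 2) (varIdx 3) φ h) (meanM G φ ω.1.1 h) ω.1.2 :=
    gaussianLogLik_sub (b := gammaIdx) G (hφ 2) (hφ 3).le (hφ' 2) (hφ' 3).le _ ω.1.2 rfl
  have hA := exposureLogLik_sub ω.1.1.1 ω.1.1.2 φ h
  rw [logLik_eq, logLik_eq, ← hY, ← hM, ← hA]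
  simp only [whiteData]
  ring

/-- The curvature of `gdev` at the origin. -/
noncomputable def gcurv {ι : Type*} [Fintype ι] (w x z : ι → ℝ) : ℝ :=
  ∑ i, (x i ^ 2 + 2 * z i * x i * w i + z i ^ 2 * w i ^ 2 - w i ^ 2 / 2)

/-- The information about logits `θ` in direction `x`. -/
noncomputable def bernInfo {ι : Type*} [Fintype ι] (θ x : ι → ℝ) : ℝ :=
  ∑ i, Real.sigmoid (θ i) * (1 - Real.sigmoid (θ i)) * x i ^ 2

theorem hasDerivAt_exposureLogLik (C : Fin N → Fin p → ℝ) (A : Fin N → ℝ) (φ h : Param p) (t : ℝ) :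
    HasDerivAt (fun t : ℝ => exposureLogLik C A (φ + t • h))
      (∑ i, (A i - Real.sigmoid (logitDir C φ i + t * logitDir C h i)) * logitDir C h i) t := by
  simp only [exposureLogLik, map_add, map_smul, Pi.add_apply, Pi.smul_apply, smul_eq_mul]
  refine HasDerivAt.fun_sum fun i _ => ?_
  have h1 : HasDerivAt (fun t : ℝ => logitDir C φ i + t * logitDir C h i) (logitDir C h i) t := by
    simpa using ((hasDerivAt_id t).mul_const (logitDir C h i)).const_add (logitDir C φ i)
  have := (h1.const_mul (A i)).sub ((hasDerivAt_softplus _).comp t h1)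
  exact this.congr_deriv (by ring)

theorem hasDerivAt_deriv_exposureLogLik (C : Fin N → Fin p → ℝ) (A : Fin N → ℝ) (φ h : Param p) :
    HasDerivAt (fun t : ℝ =>
        ∑ i, (A i - Real.sigmoid (logitDir C φ i + t * logitDir C h i)) * logitDir C h i)
      (-bernInfo (logitDir C φ) (logitDir C h)) 0 := by
  rw [bernInfo, ← Finset.sum_neg_distrib]
  refine HasDerivAt.fun_sum fun i _ => ?_
  have h1 : HasDerivAt (fun t : ℝ => logitDir C φ i + t * logitDir C h i) (logitDir C h i) 0 := by
    simpa using ((hasDerivAt_id (0 : ℝ)).mul_const (logitDir C h i)).const_add (logitDir C φ i)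
  have := (((Real.hasDerivAt_sigmoid _).comp (0 : ℝ) h1).const_sub (A i)).mul_const (logitDir C h i)
  refine this.congr_deriv ?_
  simp only [zero_mul, add_zero]
  ring

theorem eventually_variances_pos {φ : Param p} (hφ : ∀ k, 0 < variances φ k) (h : Param p) :
    ∀ᶠ t in 𝓝 (0 : ℝ), ∀ k, 0 < variances (φ + t • h) k := by
  refine eventually_all.2 fun k => ?_
  have hc : Continuous fun t : ℝ => variances (φ + t • h) k := by
    have : ∀ t : ℝ, variances (φ + t • h) k = variances φ k + t * variances h k := fun t => rfl
    simp_rw [this]; fun_prop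
  exact hc.continuousAt.eventually (lt_mem_nhds (by simpa using hφ k))

theorem quadForm_obsInfo_whiteData (G : SimpleGraph (Fin N)) {φ : Param p}
    (hφ : ∀ k, 0 < variances φ k) (h : Param p)
    (ω : (((Fin N → Fin p → ℝ) × (Fin N → unitInterval)) × (Fin N → ℝ)) × (Fin N → ℝ)) :
    quadForm (obsInfo G (whiteData G φ ω) φ) h
      = gcurv (covDir G (varIdx 0) (varIdx 1) φ h) (meanY G φ ω.1 h) ω.2
        + gcurv (covDir G (varIdx 2) (varIdx 3) φ h) (meanM G φ ω.1.1 h) ω.1.2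
        + bernInfo (logitDir ω.1.1.1 φ) (logitDir ω.1.1.1 h) := by
  have hpos : ∀ s t : Fin 4, ∀ᶠ r in 𝓝 (0 : ℝ),
      ∀ i, 0 < 1 + r * covDir G (varIdx s) (varIdx t) φ h i := fun s t => by
    refine eventually_all.2 fun i => ?_
    have hc : Continuous fun r : ℝ => 1 + r * covDir G (varIdx s) (varIdx t) φ h i := by fun_prop
    exact hc.continuousAt.eventually (lt_mem_nhds (by simp))
  rw [quadForm_obsInfo (contDiffAt_logLik G _ hφ) ?_
    (((hasDerivAt_deriv_gdev (covDir G (varIdx 0) (varIdx 1) φ h) (meanY G φ ω.1 h) ω.2).add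
      (hasDerivAt_deriv_gdev (covDir G (varIdx 2) (varIdx 3) φ h) (meanM G φ ω.1.1 h) ω.1.2)).add
      (hasDerivAt_deriv_exposureLogLik ω.1.1.1 (exposure φ ω.1.1.1 ω.1.1.2) φ h))]
  · simp only [gcurv]; ring
  filter_upwards [(eventually_variances_pos hφ h).eventually_nhds, (hpos 0 1), (hpos 2 3)]
    with r h1 h2 h3
  have key : (fun t : ℝ => logLik G (whiteData G φ ω) (φ + t • h)) =ᶠ[𝓝 r] fun t =>
      gdev (t • covDir G (varIdx 0) (varIdx 1) φ h) (t • meanY G φ ω.1 h) ω.2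
      + gdev (t • covDir G (varIdx 2) (varIdx 3) φ h) (t • meanM G φ ω.1.1 h) ω.1.2
      + exposureLogLik ω.1.1.1 (exposure φ ω.1.1.1 ω.1.1.2) (φ + t • h)
      + (logLik G (whiteData G φ ω) φ
        - exposureLogLik ω.1.1.1 (exposure φ ω.1.1.1 ω.1.1.2) φ) := by
    filter_upwards [h1] with t ht
    have e1 := logLik_whiteData_sub G hφ ht ω
    have e2 := exposureLogLik_sub ω.1.1.1 ω.1.1.2 φ (t • h)
    simp only [map_smul] at e1 e2
    linarith
  exact ((((hasDerivAt_gdev _ _ _ h2).add (hasDerivAt_gdev _ _ _ h3)).add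
    (hasDerivAt_exposureLogLik _ _ _ _ _)).add_const _).congr_of_eventuallyEq key

/-- In directions of `α` only the exposures carry information. -/
theorem quadForm_obsInfo_alpha (G : SimpleGraph (Fin N)) {φ : Param p}
    (hφ : ∀ k, 0 < variances φ k) {h : Param p} (hb : ∀ k, h (Sum.inl k) = 0)
    (hg : ∀ k, h (gammaIdx k) = 0) (hv : ∀ k, h (varIdx k) = 0) (x : Data N p) :
    quadForm (obsInfo G x φ) h = bernInfo (logitDir x.1 φ) (logitDir x.1 h) := by
  rw [quadForm_obsInfo (contDiffAt_logLik G _ hφ) (Eventually.of_forall fun t => ?_)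
    (hasDerivAt_deriv_exposureLogLik x.1 x.2.1 φ h), neg_neg]
  have key : (fun t : ℝ => logLik G x (φ + t • h)) = fun t =>
      exposureLogLik x.1 x.2.1 (φ + t • h) + (outcomeLogLik G x φ + mediatorLogLik G x φ) := by
    funext t
    rw [logLik_eq]
    simp only [outcomeLogLik, mediatorLogLik, PiLp.add_apply, PiLp.smul_apply, hb, hg, hv,
      smul_zero, add_zero]
    ring
  rw [key]
  exact (hasDerivAt_exposureLogLik _ _ _ _ _).add_const _

end Whitening

/-! ### The law of the whitened data -/

section Law

variable {N p : ℕ}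

theorem integral_cexp_dotProduct_gaussian (v : Fin N → ℝ) (c : NNReal) :
    ∫ x, Complex.exp ((v ⬝ᵥ x : ℝ) * Complex.I) ∂(Measure.pi fun _ : Fin N => gaussianReal 0 c)
      = Complex.exp (-(c * (v ⬝ᵥ v) : ℝ) / 2) := by
  have e : ∀ x : Fin N → ℝ, Complex.exp ((v ⬝ᵥ x : ℝ) * Complex.I)
      = ∏ i, Complex.exp ((v i : ℂ) * x i * Complex.I) := fun x => by
    rw [← Complex.exp_sum, dotProduct, Complex.ofReal_sum, Finset.sum_mul]
    simp
  simp_rw [e]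
  rw [integral_fintype_prod_eq_prod (𝕜 := ℂ)
    (f := fun i (y : ℝ) => Complex.exp ((v i : ℂ) * y * Complex.I))]
  have h : ∀ i, ∫ y : ℝ, Complex.exp ((v i : ℂ) * y * Complex.I) ∂(gaussianReal 0 c)
      = Complex.exp (-(c * (v i * v i) : ℝ) / 2) := fun i => by
    have := charFun_gaussianReal (μ := 0) (v := c) (t := v i)
    rw [charFun_apply_real] at this
    rw [this]
    congr 1
    push_cast
    ring
  simp_rw [h]
  rw [← Complex.exp_sum]
  congr 1
  rw [← Finset.sum_div, Finset.sum_neg_distrib, ← Complex.ofReal_sum, ← Finset.mul_sum]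
  rfl

theorem measurable_mulVec (A : Matrix (Fin N) (Fin N) ℝ) : Measurable fun v => A *ᵥ v :=
  (Matrix.mulVecLin A).continuous_of_finiteDimensional.measurable

theorem measurable_colour (G : SimpleGraph (Fin N)) (s t : ParamIdx p) (φ : Param p) :
    Measurable (colour G s t φ) := by
  exact (measurable_mulVec (rot G)).comp (by fun_prop)

/-- Random effects and errors enter the data only through E b + ε, a centred Gaussian vector. Its
characteristic function depends only on the covariance, which is the one of the coloured white noise
by `cov_eq`. -/
theorem map_colour (G : SimpleGraph (Fin N)) {s t : ParamIdx p} {φ : Param p} (hs : 0 < φ s)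
    (ht : 0 < φ t) :
    (stdNormals N).map (colour G s t φ)
      = ((isoGaussian N (φ t)).prod (isoGaussian N (φ s))).map
        fun q => adjacency G *ᵥ q.1 + q.2 := by
  have hmeas : Measurable fun q : (Fin N → ℝ) × (Fin N → ℝ) => adjacency G *ᵥ q.1 + q.2 :=
    ((measurable_mulVec _).comp measurable_fst).add measurable_snd
  have h1 := Measure.isProbabilityMeasure_map (μ := stdNormals N)
    (measurable_colour G s t φ).aemeasurable
  have h2 := Measure.isProbabilityMeasure_map
    (μ := (isoGaussian N (φ t)).prod (isoGaussian N (φ s))) hmeas.aemeasurable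
  refine Measure.ext_of_charFunDual (funext fun L => ?_)
  obtain ⟨v, hv⟩ : ∃ v : Fin N → ℝ, ∀ x, L x = v ⬝ᵥ x := by
    refine ⟨fun i => L (Pi.single i 1), fun x => ?_⟩
    conv_lhs => rw [pi_eq_sum_univ' x]
    rw [map_sum, dotProduct]
    refine Finset.sum_congr rfl fun i _ => ?_
    rw [map_smul, smul_eq_mul, mul_comm]
  rw [charFunDual_apply, charFunDual_apply]
  simp only [hv]
  have hc : Continuous fun x : Fin N → ℝ => Complex.exp ((v ⬝ᵥ x : ℝ) * Complex.I) := by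
    unfold dotProduct; fun_prop
  rw [integral_map (measurable_colour G s t φ).aemeasurable hc.aestronglyMeasurable,
    integral_map hmeas.aemeasurable hc.aestronglyMeasurable]
  have e1 : ∀ z, v ⬝ᵥ colour G s t φ z
      = (fun i => ((rot G)ᵀ *ᵥ v) i * Real.sqrt (scale G s t φ i)) ⬝ᵥ z := fun z => by
    rw [colour, Matrix.dotProduct_mulVec, ← Matrix.mulVec_transpose]
    simp only [dotProduct, mul_assoc]
  have e2 : ∀ q : (Fin N → ℝ) × (Fin N → ℝ),
      Complex.exp ((v ⬝ᵥ (adjacency G *ᵥ q.1 + q.2) : ℝ) * Complex.I)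
      = Complex.exp ((((adjacency G)ᵀ *ᵥ v) ⬝ᵥ q.1 : ℝ) * Complex.I)
        * Complex.exp ((v ⬝ᵥ q.2 : ℝ) * Complex.I) := fun q => by
    rw [← Complex.exp_add, dotProduct_add, Matrix.dotProduct_mulVec, ← Matrix.mulVec_transpose]
    push_cast
    rw [add_mul]
  simp_rw [e1, e2]
  rw [integral_prod_mul (fun a : Fin N → ℝ => Complex.exp ((((adjacency G)ᵀ *ᵥ v) ⬝ᵥ a : ℝ)
    * Complex.I)) (fun a : Fin N → ℝ => Complex.exp ((v ⬝ᵥ a : ℝ) * Complex.I)), isoGaussian,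
    isoGaussian, integral_cexp_dotProduct_gaussian, integral_cexp_dotProduct_gaussian,
    integral_cexp_dotProduct_gaussian, ← Complex.exp_add]
  congr 1
  have hq : v ⬝ᵥ (φ s • (1 : Matrix (Fin N) (Fin N) ℝ) + φ t • (adjacency G * (adjacency G)ᵀ)) *ᵥ v
      = ∑ i, scale G s t φ i * ((rot G)ᵀ *ᵥ v) i ^ 2 := by
    rw [cov_eq, ← Matrix.mulVec_mulVec, ← Matrix.mulVec_mulVec, Matrix.dotProduct_mulVec,
      ← Matrix.mulVec_transpose]
    simp only [dotProduct, Matrix.mulVec_diagonal, scale]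
    exact Finset.sum_congr rfl fun i _ => by ring
  have hq' : v ⬝ᵥ (φ s • (1 : Matrix (Fin N) (Fin N) ℝ)
        + φ t • (adjacency G * (adjacency G)ᵀ)) *ᵥ v
      = φ s * (v ⬝ᵥ v) + φ t * (((adjacency G)ᵀ *ᵥ v) ⬝ᵥ ((adjacency G)ᵀ *ᵥ v)) := by
    rw [Matrix.add_mulVec, Matrix.smul_mulVec, Matrix.smul_mulVec, dotProduct_add,
      dotProduct_smul, dotProduct_smul, Matrix.one_mulVec, ← Matrix.mulVec_mulVec,
      Matrix.dotProduct_mulVec v (adjacency G), ← Matrix.mulVec_transpose]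
    rfl
  have e3 : (fun i => ((rot G)ᵀ *ᵥ v) i * Real.sqrt (scale G s t φ i)) ⬝ᵥ
      (fun i => ((rot G)ᵀ *ᵥ v) i * Real.sqrt (scale G s t φ i))
      = ∑ i, scale G s t φ i * ((rot G)ᵀ *ᵥ v) i ^ 2 := by
    refine Finset.sum_congr rfl fun i _ => ?_
    have := Real.sq_sqrt (scale_pos G hs ht.le i).le
    linear_combination ((rot G)ᵀ *ᵥ v) i ^ 2 * this
  rw [e3, ← hq, hq', Real.coe_toNNReal _ hs.le, Real.coe_toNNReal _ ht.le]
  push_cast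
  ring

/-- The law of confounders, uniform variables, and white noise. -/
noncomputable abbrev whiteLaw (ν : Measure (Fin N → Fin p → ℝ)) :
    Measure ((((Fin N → Fin p → ℝ) × (Fin N → unitInterval)) × (Fin N → ℝ)) × (Fin N → ℝ)) :=
  ((ν.prod (Measure.pi fun _ => volume)).prod (stdNormals N)).prod (stdNormals N)

/-- Data from confounders, uniform variables, and total errors. -/
noncomputable def errorData (G : SimpleGraph (Fin N)) (φ : Param p)
    (ω : (Fin N → Fin p → ℝ) × (Fin N → unitInterval) × (Fin N → ℝ) × (Fin N → ℝ)) :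
    Data N p :=
  let A := exposure φ ω.1 ω.2.1
  let M := designM G ω.1 A *ᵥ gamma φ + ω.2.2.1
  (ω.1, A, M, designY G ω.1 A M *ᵥ beta φ + ω.2.2.2)

theorem measurable_errorData (G : SimpleGraph (Fin N)) (φ : Param p) :
    Measurable (errorData G φ) := by
  have h : errorData G φ = generate G φ ∘
      fun ω => (ω.1, ω.2.1, (0, ω.2.2.1), (0, ω.2.2.2)) := by
    funext ω
    simp [errorData, generate, mediator, outcome, Matrix.mulVec_zero]
  rw [h]
  exact (measurable_generate G φ).comp (by fun_prop)

theorem measurable_whiteData (G : SimpleGraph (Fin N)) (φ : Param p) :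
    Measurable (whiteData G φ) := by
  have h : whiteData G φ = errorData G φ ∘
      fun ω => (ω.1.1.1, ω.1.1.2, colour G (varIdx 2) (varIdx 3) φ ω.1.2,
        colour G (varIdx 0) (varIdx 1) φ ω.2) := rfl
  have hc := fun s t => measurable_colour G (p := p) s t φ
  rw [h]
  exact (measurable_errorData G φ).comp (by fun_prop)

/-- Both constructions factor through `errorData`, which sees only the total errors, so `map_colour`
for the two models settles the matter. From here on, probabilities can be computed with white noise.
-/
theorem map_whiteData (G : SimpleGraph (Fin N)) (ν : Measure (Fin N → Fin p → ℝ))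
    [IsProbabilityMeasure ν] {φ : Param p} (hφ : ∀ k, 0 < variances φ k) :
    (whiteLaw ν).map (whiteData G φ) = dataLaw G ν φ := by
  have hmeas : Measurable fun q : (Fin N → ℝ) × (Fin N → ℝ) => adjacency G *ᵥ q.1 + q.2 :=
    ((measurable_mulVec _).comp measurable_fst).add measurable_snd
  set LM := ((isoGaussian N (φ (varIdx 3))).prod (isoGaussian N (φ (varIdx 2)))).map
    (fun q => adjacency G *ᵥ q.1 + q.2) with hLM
  set LY := ((isoGaussian N (φ (varIdx 1))).prod (isoGaussian N (φ (varIdx 0)))).map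
    (fun q => adjacency G *ᵥ q.1 + q.2) with hLY
  have hmM := measurable_colour G (p := p) (varIdx 2) (varIdx 3) φ
  have hmY := measurable_colour G (p := p) (varIdx 0) (varIdx 1) φ
  have h1 : (noiseLaw ν φ).map (Prod.map id (Prod.map id (Prod.map
      (fun q : (Fin N → ℝ) × (Fin N → ℝ) => adjacency G *ᵥ q.1 + q.2)
      (fun q : (Fin N → ℝ) × (Fin N → ℝ) => adjacency G *ᵥ q.1 + q.2))))
      = ν.prod ((Measure.pi fun _ => volume).prod (LM.prod LY)) := by
    have : IsProbabilityMeasure LM := Measure.isProbabilityMeasure_map hmeas.aemeasurable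
    have : IsProbabilityMeasure LY := Measure.isProbabilityMeasure_map hmeas.aemeasurable
    rw [noiseLaw, ← Measure.map_prod_map _ _ measurable_id (by fun_prop),
      ← Measure.map_prod_map _ _ measurable_id (by fun_prop),
      ← Measure.map_prod_map _ _ hmeas hmeas, Measure.map_id, Measure.map_id]
    rfl
  have h2 : (ν.prod ((Measure.pi fun _ : Fin N => (volume : Measure unitInterval)).prod
        ((stdNormals N).prod (stdNormals N)))).map
      (Prod.map id (Prod.map id (Prod.map (colour G (varIdx 2) (varIdx 3) φ)
        (colour G (varIdx 0) (varIdx 1) φ))))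
      = ν.prod ((Measure.pi fun _ => volume).prod (LM.prod LY)) := by
    rw [← Measure.map_prod_map _ _ measurable_id (by fun_prop),
      ← Measure.map_prod_map _ _ measurable_id (by fun_prop),
      ← Measure.map_prod_map _ _ hmM hmY, Measure.map_id, Measure.map_id,
      map_colour G (hφ 2) (hφ 3), map_colour G (hφ 0) (hφ 1)]
  have h3 : (whiteLaw ν).map (fun ω => (ω.1.1.1, ω.1.1.2, ω.1.2, ω.2))
      = ν.prod ((Measure.pi fun _ : Fin N => (volume : Measure unitInterval)).prod
        ((stdNormals N).prod (stdNormals N))) := by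
    have e : (fun ω : (((Fin N → Fin p → ℝ) × (Fin N → unitInterval)) × (Fin N → ℝ)) × (Fin N → ℝ) =>
        (ω.1.1.1, ω.1.1.2, ω.1.2, ω.2)) = MeasurableEquiv.prodAssoc ∘ MeasurableEquiv.prodAssoc := rfl
    rw [e, ← Measure.map_map (by fun_prop) (by fun_prop), whiteLaw,
      Measure.prodAssoc_prod, Measure.prodAssoc_prod]
  have e4 : generate G φ = errorData G φ ∘ (Prod.map id (Prod.map id (Prod.map
      (fun q : (Fin N → ℝ) × (Fin N → ℝ) => adjacency G *ᵥ q.1 + q.2)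
      (fun q : (Fin N → ℝ) × (Fin N → ℝ) => adjacency G *ᵥ q.1 + q.2)))) := by
    funext ω
    simp only [generate, errorData, Function.comp, mediator, outcome, Prod.map, id, add_assoc]
  have e5 : whiteData G φ = errorData G φ ∘ (Prod.map id (Prod.map id (Prod.map
      (colour G (varIdx 2) (varIdx 3) φ) (colour G (varIdx 0) (varIdx 1) φ)))) ∘
      (fun ω => (ω.1.1.1, ω.1.1.2, ω.1.2, ω.2)) := rfl
  rw [dataLaw, e4, e5, ← Measure.map_map (measurable_errorData G φ) (by fun_prop),
    ← Measure.map_map (measurable_errorData G φ) (by fun_prop), h1,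
    ← Measure.map_map (by fun_prop) (by fun_prop), h3, h2]

/-- The confounders have the same law under all parameters. This lets a statement under one
parameter be used under another when it concerns confounders only. -/
theorem map_fst_dataLaw (G : SimpleGraph (Fin N)) (ν : Measure (Fin N → Fin p → ℝ))
    [IsProbabilityMeasure ν] (φ : Param p) : (dataLaw G ν φ).map Prod.fst = ν := by
  rw [dataLaw, Measure.map_map measurable_fst (measurable_generate G φ)]
  have : Prod.fst ∘ generate G φ = Prod.fst := rfl
  rw [this, noiseLaw, Measure.map_fst_prod]
  simp

end Law

end RENSEM


namespace RENSEM

/-! ### Square roots of positive definite matrices -/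

section SquareRoot

variable {κ : Type*} [Fintype κ]

theorem frob_nonneg (A : Matrix κ κ ℝ) : 0 ≤ frob A := Real.sqrt_nonneg _

theorem frob_sq (A : Matrix κ κ ℝ) : frob A ^ 2 = ∑ i, ∑ j, A i j ^ 2 := by
  have h : (Aᵀ * A).trace = ∑ i, ∑ j, A i j ^ 2 := by
    simp only [Matrix.trace, Matrix.diag, Matrix.mul_apply, Matrix.transpose_apply, ← pow_two]
    exact Finset.sum_comm
  have h0 : 0 ≤ (Aᵀ * A).trace := h ▸ Finset.sum_nonneg fun i _ =>
    Finset.sum_nonneg fun j _ => sq_nonneg _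
  rw [frob, Real.sq_sqrt h0, h]

theorem frob_transpose (A : Matrix κ κ ℝ) : frob Aᵀ = frob A := by
  rw [← Real.sqrt_sq (frob_nonneg Aᵀ), ← Real.sqrt_sq (frob_nonneg A), frob_sq, frob_sq,
    Finset.sum_comm]
  rfl

theorem norm_sq_eq_dotProduct (u : EuclideanSpace ℝ κ) : ‖u‖ ^ 2 = u.ofLp ⬝ᵥ u.ofLp := by
  rw [EuclideanSpace.real_norm_sq_eq]
  exact Finset.sum_congr rfl fun i _ => pow_two _

theorem quadForm_sub (A A' : Matrix κ κ ℝ) (u : EuclideanSpace ℝ κ) :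
    quadForm (A - A') u = quadForm A u - quadForm A' u := by
  simp only [quadForm, Matrix.sub_mulVec, dotProduct_sub]

theorem quadForm_smul (A : Matrix κ κ ℝ) (c : ℝ) (u : EuclideanSpace ℝ κ) :
    quadForm A (c • u) = c ^ 2 * quadForm A u := by
  simp only [quadForm, WithLp.ofLp_smul, Matrix.mulVec_smul, dotProduct_smul,
    smul_dotProduct, smul_eq_mul]
  ring

theorem convexOn_quadForm {B : Matrix κ κ ℝ} (hB : B.PosSemidef) : ConvexOn ℝ Set.univ (quadForm B) := by
  refine ⟨convex_univ, fun x _ y _ a b ha hb hab => ?_⟩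
  have h0 : 0 ≤ quadForm B (x - y) := by
    have := hB.dotProduct_mulVec_nonneg (x - y).ofLp
    simpa [quadForm] using this
  have e : a • quadForm B x + b • quadForm B y - quadForm B (a • x + b • y)
      = a * b * quadForm B (x - y) := by
    have hb' : b = 1 - a := by linarith
    subst hb'
    simp only [quadForm, WithLp.ofLp_add, WithLp.ofLp_sub, WithLp.ofLp_smul, Matrix.mulVec_add,
      Matrix.mulVec_sub, Matrix.mulVec_smul, dotProduct_add, dotProduct_sub, dotProduct_smul,
      add_dotProduct, sub_dotProduct, smul_dotProduct, smul_eq_mul]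
    ring
  have := mul_nonneg (mul_nonneg ha hb) h0
  linarith

variable [DecidableEq κ]

theorem norm_toEuclideanLin_le (A : Matrix κ κ ℝ) (u : EuclideanSpace ℝ κ) :
    ‖Matrix.toEuclideanLin A u‖ ≤ frob A * ‖u‖ := by
  refine (sq_le_sq₀ (norm_nonneg _) (mul_nonneg (frob_nonneg _) (norm_nonneg _))).1 ?_
  rw [mul_pow, frob_sq, EuclideanSpace.real_norm_sq_eq, EuclideanSpace.real_norm_sq_eq,
    Finset.sum_mul]
  refine Finset.sum_le_sum fun i _ => ?_
  simpa [Matrix.toLpLin_apply, Matrix.mulVec, dotProduct] using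
    Finset.sum_mul_sq_le_sq_mul_sq Finset.univ (A i) u.ofLp

theorem quadForm_eq_inner (A : Matrix κ κ ℝ) (u : EuclideanSpace ℝ κ) :
    quadForm A u = inner ℝ u (Matrix.toEuclideanLin A u) := by
  rw [EuclideanSpace.inner_eq_star_dotProduct, quadForm, dotProduct_comm]
  simp [Matrix.toLpLin_apply]

theorem abs_quadForm_le (A : Matrix κ κ ℝ) (u : EuclideanSpace ℝ κ) :
    |quadForm A u| ≤ frob A * ‖u‖ ^ 2 := by
  rw [quadForm_eq_inner]
  refine (abs_real_inner_le_norm _ _).trans ?_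
  have := mul_le_mul_of_nonneg_left (norm_toEuclideanLin_le A u) (norm_nonneg u)
  linarith

theorem quadForm_one (u : EuclideanSpace ℝ κ) : quadForm 1 u = ‖u‖ ^ 2 := by
  rw [quadForm, Matrix.one_mulVec, norm_sq_eq_dotProduct]

theorem quadForm_conj (A S : Matrix κ κ ℝ) (u : EuclideanSpace ℝ κ) :
    quadForm (Sᵀ * A * S) u = quadForm A (Matrix.toEuclideanLin S u) := by
  simp only [quadForm, Matrix.toLpLin_apply, ← Matrix.mulVec_mulVec]
  rw [Matrix.dotProduct_mulVec, Matrix.vecMul_transpose]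

theorem toEuclideanLin_mul (A A' : Matrix κ κ ℝ) (u : EuclideanSpace ℝ κ) :
    Matrix.toEuclideanLin (A * A') u = Matrix.toEuclideanLin A (Matrix.toEuclideanLin A' u) := by
  simp [Matrix.toLpLin_apply, Matrix.mulVec_mulVec]

variable {B : Matrix κ κ ℝ}

theorem isSymm_sqrt (B : Matrix κ κ ℝ) : (CFC.sqrt B)ᵀ = CFC.sqrt B := by
  have := (Matrix.nonneg_iff_posSemidef.1 (CFC.sqrt_nonneg B)).isHermitian
  rwa [Matrix.IsHermitian, Matrix.conjTranspose_eq_transpose_of_trivial] at this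

theorem sqrt_mul_sqrt (hB : B.PosDef) : CFC.sqrt B * CFC.sqrt B = B :=
  CFC.sqrt_mul_sqrt_self B (Matrix.nonneg_iff_posSemidef.2 hB.posSemidef)

theorem isUnit_det_sqrt (hB : B.PosDef) : IsUnit (CFC.sqrt B).det := by
  have h : (CFC.sqrt B).det * (CFC.sqrt B).det = B.det := by
    rw [← Matrix.det_mul, sqrt_mul_sqrt hB]
  have h0 := hB.det_pos
  rw [← h] at h0
  exact isUnit_iff_ne_zero.2 fun h1 => by simp [h1] at h0

theorem sqrt_mul_inv (hB : B.PosDef) : CFC.sqrt B * (CFC.sqrt B)⁻¹ = 1 :=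
  Matrix.mul_nonsing_inv _ (isUnit_det_sqrt hB)

theorem inv_mul_sqrt (hB : B.PosDef) : (CFC.sqrt B)⁻¹ * CFC.sqrt B = 1 :=
  Matrix.nonsing_inv_mul _ (isUnit_det_sqrt hB)

theorem quadForm_eq_norm_sq (hB : B.PosDef) (u : EuclideanSpace ℝ κ) :
    quadForm B u = ‖Matrix.toEuclideanLin (CFC.sqrt B) u‖ ^ 2 := by
  rw [← quadForm_one, ← quadForm_conj, isSymm_sqrt, mul_one, sqrt_mul_sqrt hB]

theorem toEuclideanLin_sqrt_inv (hB : B.PosDef) (u : EuclideanSpace ℝ κ) :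
    Matrix.toEuclideanLin (CFC.sqrt B) (Matrix.toEuclideanLin (CFC.sqrt B)⁻¹ u) = u := by
  rw [← toEuclideanLin_mul, sqrt_mul_inv hB]
  simp

theorem toEuclideanLin_inv_sqrt (hB : B.PosDef) (u : EuclideanSpace ℝ κ) :
    Matrix.toEuclideanLin (CFC.sqrt B)⁻¹ (Matrix.toEuclideanLin (CFC.sqrt B) u) = u := by
  rw [← toEuclideanLin_mul, inv_mul_sqrt hB]
  simp

theorem quadForm_sqrt_inv (hB : B.PosDef) (u : EuclideanSpace ℝ κ) :
    quadForm B (Matrix.toEuclideanLin (CFC.sqrt B)⁻¹ u) = ‖u‖ ^ 2 := by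
  rw [quadForm_eq_norm_sq hB, toEuclideanLin_sqrt_inv hB]

/-- Conjugating by B^{1/2} turns the normalized deviation into a relative error of quadratic forms,
uniform over all directions. -/
theorem abs_quadForm_sub_le (hB : B.PosDef) (J : Matrix κ κ ℝ) (u : EuclideanSpace ℝ κ) :
    |quadForm J u - quadForm B u|
      ≤ frob ((CFC.sqrt B)⁻¹ * J * (CFC.sqrt B)⁻¹ - 1) * quadForm B u := by
  have e : J - B = (CFC.sqrt B)ᵀ * ((CFC.sqrt B)⁻¹ * J * (CFC.sqrt B)⁻¹ - 1) * CFC.sqrt B := by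
    rw [isSymm_sqrt, mul_sub, sub_mul, mul_one, sqrt_mul_sqrt hB, ← mul_assoc, ← mul_assoc,
      sqrt_mul_inv hB, one_mul, mul_assoc, inv_mul_sqrt hB, mul_one]
  rw [← quadForm_sub, e, quadForm_conj, quadForm_eq_norm_sq hB]
  exact abs_quadForm_le _ _

theorem norm_sqrt_inv_sq_le (hB : B.PosDef) (u : EuclideanSpace ℝ κ) :
    ‖Matrix.toEuclideanLin (CFC.sqrt B)⁻¹ u‖ ^ 2 ≤ frob B⁻¹ * ‖u‖ ^ 2 := by
  have hinv : B⁻¹ = ((CFC.sqrt B)⁻¹)ᵀ * (CFC.sqrt B)⁻¹ := by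
    rw [Matrix.transpose_nonsing_inv, isSymm_sqrt, ← Matrix.mul_inv_rev, sqrt_mul_sqrt hB]
  have : ‖Matrix.toEuclideanLin (CFC.sqrt B)⁻¹ u‖ ^ 2 = quadForm B⁻¹ u := by
    rw [← quadForm_one, ← quadForm_conj, mul_one, ← hinv]
  rw [this]
  exact (le_abs_self _).trans (abs_quadForm_le _ _)

/-- Comparison of two quadratic forms through their square roots. -/
theorem abs_quadForm_sub_quadForm_le {B' : Matrix κ κ ℝ} (hB : B.PosDef) (hB' : B'.PosDef) {η : ℝ}
    (hη : frob ((CFC.sqrt B)⁻¹ * CFC.sqrt B' - 1) ≤ η) (u : EuclideanSpace ℝ κ) :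
    |quadForm B' u - quadForm B u| ≤ η * (2 + η) * quadForm B u := by
  set D := (CFC.sqrt B)⁻¹ * CFC.sqrt B' - 1 with hD
  have hη0 : 0 ≤ η := (frob_nonneg _).trans hη
  -- The definition of D gives B'^{1/2} = B^{1/2}(I + D). Transposing with the symmetry of the roots
  -- puts the perturbation on the left, where it acts on B^{1/2}u.
  have e : CFC.sqrt B' = CFC.sqrt B + Dᵀ * CFC.sqrt B := by
    rw [hD, Matrix.transpose_sub, Matrix.transpose_mul, Matrix.transpose_nonsing_inv, isSymm_sqrt,
      isSymm_sqrt, Matrix.transpose_one, sub_mul, one_mul, mul_assoc, inv_mul_sqrt hB, mul_one]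
    abel
  set v := Matrix.toEuclideanLin (CFC.sqrt B) u with hv
  have hdiff : ‖Matrix.toEuclideanLin (CFC.sqrt B') u - v‖ ≤ η * ‖v‖ := by
    have : Matrix.toEuclideanLin (CFC.sqrt B') u - v = Matrix.toEuclideanLin Dᵀ v := by
      rw [hv, e, map_add, LinearMap.add_apply, toEuclideanLin_mul, add_sub_cancel_left]
    rw [this]
    refine (norm_toEuclideanLin_le _ _).trans ?_
    rw [frob_transpose]
    gcongr
  rw [quadForm_eq_norm_sq hB, quadForm_eq_norm_sq hB', ← hv]
  have h1 := abs_le.1 ((abs_norm_sub_norm_le _ _).trans hdiff)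
  set a := ‖Matrix.toEuclideanLin (CFC.sqrt B') u‖ with ha
  have ha0 : 0 ≤ a := norm_nonneg _
  have hv0 := norm_nonneg v
  have e2 : |a ^ 2 - ‖v‖ ^ 2| = |a - ‖v‖| * (a + ‖v‖) := by
    have h2 : 0 ≤ a + ‖v‖ := by positivity
    conv_rhs => rw [← abs_of_nonneg h2]
    rw [← abs_mul]
    congr 1
    ring
  rw [e2]
  calc _ ≤ (η * ‖v‖) * ((2 + η) * ‖v‖) :=
        mul_le_mul (abs_le.2 h1) (by linarith [h1.2]) (by positivity) (by positivity)
    _ = _ := by ring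

end SquareRoot

end RENSEM


namespace RENSEM

/-! ### Blocks of the information -/

section Blocks

variable {N p : ℕ}

/-- The classes of the coordinates: `β`, `γ`, `α`, variances of the outcome model, and variances of
the mediator model. -/
def paramClass : ParamIdx p → Fin 5
  | Sum.inl _ => 0
  | Sum.inr (Sum.inl _) => 1
  | Sum.inr (Sum.inr (Sum.inl _)) => 2
  | Sum.inr (Sum.inr (Sum.inr k)) => if k = 0 ∨ k = 1 then 3 else 4

/-- The projection to the coordinates of some classes. -/
noncomputable def coordProj (S : Finset (Fin 5)) : Param p →ₗ[ℝ] Param p where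
  toFun h := WithLp.toLp 2 fun k => if paramClass k ∈ S then h k else 0
  map_add' h h' := by ext k; by_cases hk : paramClass k ∈ S <;> simp [hk]
  map_smul' c h := by ext k; by_cases hk : paramClass k ∈ S <;> simp [hk]

theorem coordProj_apply (S : Finset (Fin 5)) (h : Param p) (k : ParamIdx p) :
    coordProj S h k = if paramClass k ∈ S then h k else 0 := rfl

theorem coordProj_coordProj (S : Finset (Fin 5)) (h : Param p) :
    coordProj S (coordProj S h) = coordProj S h := by
  ext k
  simp only [coordProj_apply]
  split_ifs <;> rfl

theorem covDir_congr (G : SimpleGraph (Fin N)) {s t : ParamIdx p} (φ : Param p) {h h' : Param p}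
    (hs : h s = h' s) (ht : h t = h' t) : covDir G s t φ h = covDir G s t φ h' := by
  ext i
  simp only [covDir, LinearMap.coe_mk, AddHom.coe_mk, scale, hs, ht]

theorem meanDir_congr {ι : Type*} [Fintype ι] (G : SimpleGraph (Fin N)) {b : ι → ParamIdx p}
    (s t : ParamIdx p) (φ : Param p) (X : Matrix (Fin N) ι ℝ) {h h' : Param p}
    (hb : ∀ k, h (b k) = h' (b k)) : meanDir G b s t φ X h = meanDir G b s t φ X h' := by
  ext i
  simp only [meanDir, LinearMap.coe_mk, AddHom.coe_mk, hb]

theorem logitDir_congr (C : Fin N → Fin p → ℝ) {h h' : Param p} (ha : alpha h = alpha h') :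
    logitDir C h = logitDir C h' := by
  ext i
  simp only [logitDir, LinearMap.coe_mk, AddHom.coe_mk, ha]

theorem covDir_coordProj (G : SimpleGraph (Fin N)) (φ h : Param p) (S : Finset (Fin 5)) :
    covDir G (varIdx 0) (varIdx 1) φ (coordProj S h)
        = (if (3 : Fin 5) ∈ S then covDir G (varIdx 0) (varIdx 1) φ h else 0) ∧
      covDir G (varIdx 2) (varIdx 3) φ (coordProj S h)
        = (if (4 : Fin 5) ∈ S then covDir G (varIdx 2) (varIdx 3) φ h else 0) := by
  constructor <;> split_ifs with hS
  · exact covDir_congr G φ (by simp [coordProj_apply, paramClass, hS])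
      (by simp [coordProj_apply, paramClass, hS])
  · rw [← map_zero (covDir G (varIdx 0) (varIdx 1) φ)]
    exact covDir_congr G φ (by simp [coordProj_apply, paramClass, hS])
      (by simp [coordProj_apply, paramClass, hS])
  · exact covDir_congr G φ (by simp [coordProj_apply, paramClass, hS])
      (by simp [coordProj_apply, paramClass, hS])
  · rw [← map_zero (covDir G (varIdx 2) (varIdx 3) φ)]
    exact covDir_congr G φ (by simp [coordProj_apply, paramClass, hS])
      (by simp [coordProj_apply, paramClass, hS])

theorem meanY_coordProj (G : SimpleGraph (Fin N)) (φ h : Param p) (S : Finset (Fin 5))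
    (ω : ((Fin N → Fin p → ℝ) × (Fin N → unitInterval)) × (Fin N → ℝ)) :
    meanY G φ ω (coordProj S h) = if (0 : Fin 5) ∈ S then meanY G φ ω h else 0 := by
  split_ifs with hS
  · exact meanDir_congr G _ _ φ _ fun k => by simp [coordProj_apply, paramClass, hS]
  · rw [← map_zero (meanY G φ ω)]
    exact meanDir_congr G _ _ φ _ fun k => by simp [coordProj_apply, paramClass, hS]

theorem meanM_coordProj (G : SimpleGraph (Fin N)) (φ h : Param p) (S : Finset (Fin 5))
    (ω : (Fin N → Fin p → ℝ) × (Fin N → unitInterval)) :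
    meanM G φ ω (coordProj S h) = if (1 : Fin 5) ∈ S then meanM G φ ω h else 0 := by
  split_ifs with hS
  · exact meanDir_congr G _ _ φ _ fun k => by simp [coordProj_apply, paramClass, hS]
  · rw [← map_zero (meanM G φ ω)]
    exact meanDir_congr G _ _ φ _ fun k => by simp [coordProj_apply, paramClass, hS]

theorem logitDir_coordProj (C : Fin N → Fin p → ℝ) (h : Param p) (S : Finset (Fin 5)) :
    logitDir C (coordProj S h) = if (2 : Fin 5) ∈ S then logitDir C h else 0 := by
  split_ifs with hS
  · exact logitDir_congr C (funext fun k => by simp [alpha, coordProj_apply, paramClass, hS])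
  · rw [← map_zero (logitDir C)]
    exact logitDir_congr C (funext fun k => by simp [alpha, coordProj_apply, paramClass, hS])

theorem gcurv_zero_left {ι : Type*} [Fintype ι] (x z : ι → ℝ) : gcurv 0 x z = ∑ i, x i ^ 2 := by
  simp [gcurv]

theorem bernInfo_zero {ι : Type*} [Fintype ι] (θ : ι → ℝ) : bernInfo θ 0 = 0 := by
  simp [bernInfo]

/-- Projecting out the variance components removes w, and with it the current noise z: in the
directions of β or γ alone the observed information is a plain sum of squared mean changes. This is
what isolates the random part of `gquad`. -/
theorem quadForm_obsInfo_coordProj (G : SimpleGraph (Fin N)) {φ : Param p}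
    (hφ : ∀ k, 0 < variances φ k) (h : Param p)
    (ω : (((Fin N → Fin p → ℝ) × (Fin N → unitInterval)) × (Fin N → ℝ)) × (Fin N → ℝ)) :
    quadForm (obsInfo G (whiteData G φ ω) φ) (coordProj {0, 3} h)
        = gcurv (covDir G (varIdx 0) (varIdx 1) φ h) (meanY G φ ω.1 h) ω.2 ∧
    quadForm (obsInfo G (whiteData G φ ω) φ) (coordProj {0} h) = ∑ i, meanY G φ ω.1 h i ^ 2 ∧
    quadForm (obsInfo G (whiteData G φ ω) φ) (coordProj {1, 4} h)
        = gcurv (covDir G (varIdx 2) (varIdx 3) φ h) (meanM G φ ω.1.1 h) ω.1.2 ∧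
    quadForm (obsInfo G (whiteData G φ ω) φ) (coordProj {1} h) = ∑ i, meanM G φ ω.1.1 h i ^ 2 ∧
    quadForm (obsInfo G (whiteData G φ ω) φ) (coordProj {2} h)
        = bernInfo (logitDir ω.1.1.1 φ) (logitDir ω.1.1.1 h) := by
  refine ⟨?_, ?_, ?_, ?_, ?_⟩ <;>
  · rw [quadForm_obsInfo_whiteData G hφ, (covDir_coordProj G φ h _).1, (covDir_coordProj G φ h _).2,
      meanY_coordProj, meanM_coordProj, logitDir_coordProj]
    simp [gcurv_zero_left, bernInfo_zero]

variable {G : SimpleGraph (Fin N)} {ν : Measure (Fin N → Fin p → ℝ)} {φ : Param p}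

theorem integrable_quadForm_obsInfo
    (hint : ∀ k l, Integrable (fun x => obsInfo G x φ k l) (dataLaw G ν φ)) (h : Param p) :
    Integrable (fun x => quadForm (obsInfo G x φ) h) (dataLaw G ν φ) ∧
      ∫ x, quadForm (obsInfo G x φ) h ∂(dataLaw G ν φ) = quadForm (fisherInfo G ν φ) h := by
  simp only [quadForm, dotProduct, Matrix.mulVec, fisherInfo, Matrix.of_apply]
  have h1 : ∀ k, Integrable (fun x => ∑ l, obsInfo G x φ k l * h l) (dataLaw G ν φ) := fun k =>
    integrable_finsetSum _ fun l _ => (hint k l).mul_const _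
  refine ⟨integrable_finsetSum _ fun k _ => (h1 k).const_mul _, ?_⟩
  rw [integral_finsetSum _ fun k _ => (h1 k).const_mul _]
  refine Finset.sum_congr rfl fun k _ => ?_
  rw [integral_const_mul, integral_finsetSum _ fun l _ => (hint k l).mul_const _]
  congr 1
  exact Finset.sum_congr rfl fun l _ => integral_mul_const _ _

variable [IsProbabilityMeasure ν]

theorem integrable_quadForm_whiteData (hφ : ∀ k, 0 < variances φ k)
    (hint : ∀ k l, Integrable (fun x => obsInfo G x φ k l) (dataLaw G ν φ)) (h : Param p) :
    Integrable (fun ω => quadForm (obsInfo G (whiteData G φ ω) φ) h) (whiteLaw ν) ∧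
      ∫ ω, quadForm (obsInfo G (whiteData G φ ω) φ) h ∂(whiteLaw ν)
        = quadForm (fisherInfo G ν φ) h := by
  obtain ⟨h1, h2⟩ := integrable_quadForm_obsInfo hint h
  rw [← map_whiteData G ν hφ] at h1
  refine ⟨h1.comp_measurable (measurable_whiteData G φ), ?_⟩
  rw [← h2, ← map_whiteData G ν hφ,
    integral_map (measurable_whiteData G φ).aemeasurable h1.aestronglyMeasurable]

/-- Given the past, the terms linear in z integrate to 0 and those in z² to w_i², which leaves half
of ∑ w_i². -/
theorem integral_gcurv {Ω : Type*} [MeasurableSpace Ω] {P : Measure Ω} [IsProbabilityMeasure P]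
    {w : Fin N → ℝ} {x : Ω → Fin N → ℝ}
    (h1 : Integrable (fun ω : Ω × (Fin N → ℝ) => gcurv w (x ω.1) ω.2) (P.prod (stdNormals N)))
    (h2 : Integrable (fun ω : Ω × (Fin N → ℝ) => ∑ i, x ω.1 i ^ 2) (P.prod (stdNormals N))) :
    ∫ ω, gcurv w (x ω.1) ω.2 ∂(P.prod (stdNormals N))
      = ∫ ω, ∑ i, x ω.1 i ^ 2 ∂(P.prod (stdNormals N)) + 1 / 2 * ∑ i, w i ^ 2 := by
  -- Fubini is applied to the difference, because its inner integral is a constant.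
  have hd := h1.sub h2
  have hi1 : ∀ i, Integrable (fun z : Fin N → ℝ => z i) (stdNormals N) := fun i =>
    integrable_comp_eval (μ := fun _ : Fin N => gaussianReal 0 1) (i := i) (f := fun y : ℝ => y)
      (memLp_id_stdNormal.integrable one_le_two)
  have hi2 : ∀ i, Integrable (fun z : Fin N → ℝ => z i ^ 2) (stdNormals N) := fun i =>
    integrable_comp_eval (μ := fun _ : Fin N => gaussianReal 0 1) (i := i) (f := fun y : ℝ => y ^ 2)
      memLp_id_stdNormal.integrable_sq
  have he1 : ∀ i, ∫ z, z i ∂(stdNormals N) = 0 := fun i =>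
    (integral_comp_eval (μ := fun _ : Fin N => gaussianReal 0 1) (i := i) (f := fun y : ℝ => y)
      (by fun_prop)).trans integral_id_stdNormal
  have he2 : ∀ i, ∫ z, z i ^ 2 ∂(stdNormals N) = 1 := fun i =>
    (integral_comp_eval (μ := fun _ : Fin N => gaussianReal 0 1) (i := i) (f := fun y : ℝ => y ^ 2)
      (by fun_prop)).trans integral_sq_stdNormal
  have hin : ∀ ω, ∫ z, (gcurv w (x ω) z - ∑ i, x ω i ^ 2) ∂(stdNormals N)
      = 1 / 2 * ∑ i, w i ^ 2 := fun ω => by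
    have e : ∀ z, gcurv w (x ω) z - ∑ i, x ω i ^ 2
        = ∑ i, (z i * (2 * x ω i * w i) + (z i ^ 2 * w i ^ 2 - w i ^ 2 / 2)) := fun z => by
      rw [gcurv, ← Finset.sum_sub_distrib]
      exact Finset.sum_congr rfl fun i _ => by ring
    simp_rw [e]
    have hA : ∀ i, Integrable (fun z : Fin N → ℝ => z i * (2 * x ω i * w i)) (stdNormals N) :=
      fun i => (hi1 i).mul_const _
    have hB : ∀ i, Integrable (fun z : Fin N → ℝ => z i ^ 2 * w i ^ 2) (stdNormals N) :=
      fun i => (hi2 i).mul_const _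
    have hC : ∀ i, Integrable (fun z : Fin N → ℝ => z i ^ 2 * w i ^ 2 - w i ^ 2 / 2)
      (stdNormals N) := fun i => (hB i).sub (integrable_const _)
    have hD : ∀ i, Integrable (fun z : Fin N → ℝ =>
        z i * (2 * x ω i * w i) + (z i ^ 2 * w i ^ 2 - w i ^ 2 / 2)) (stdNormals N) :=
      fun i => (hA i).add (hC i)
    rw [integral_finsetSum _ fun i _ => hD i, Finset.mul_sum]
    refine Finset.sum_congr rfl fun i _ => ?_
    rw [integral_add (hA i) (hC i), integral_mul_const, he1,
      integral_sub (hB i) (integrable_const _), integral_mul_const, he2]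
    simp
    ring
  have hsub := integral_sub h1 h2
  have hprod := integral_prod (fun ω : Ω × (Fin N → ℝ) => gcurv w (x ω.1) ω.2 - ∑ i, x ω.1 i ^ 2) hd
  simp only [hin] at hprod
  rw [hsub] at hprod
  simp only [integral_const, probReal_univ, one_smul] at hprod
  linarith

/-- Means and variances have no cross information, and the variance part is nonrandom. -/
theorem quadForm_fisherInfo_outcome (hφ : ∀ k, 0 < variances φ k)
    (hint : ∀ k l, Integrable (fun x => obsInfo G x φ k l) (dataLaw G ν φ)) (h : Param p) :
    quadForm (fisherInfo G ν φ) (coordProj {0, 3} h) = quadForm (fisherInfo G ν φ) (coordProj {0} h)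
      + 1 / 2 * ∑ i, covDir G (varIdx 0) (varIdx 1) φ h i ^ 2 := by
  obtain ⟨i1, e1⟩ := integrable_quadForm_whiteData hφ hint (coordProj {0, 3} h)
  obtain ⟨i2, e2⟩ := integrable_quadForm_whiteData hφ hint (coordProj {0} h)
  simp only [fun ω => (quadForm_obsInfo_coordProj G hφ h ω).1,
    fun ω => (quadForm_obsInfo_coordProj G hφ h ω).2.1] at i1 i2 e1 e2
  rw [← e1, ← e2]
  exact integral_gcurv (P := (ν.prod (Measure.pi fun _ => volume)).prod (stdNormals N))
    (x := fun ω => meanY G φ ω h) i1 i2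

theorem quadForm_fisherInfo_mediator (hφ : ∀ k, 0 < variances φ k)
    (hint : ∀ k l, Integrable (fun x => obsInfo G x φ k l) (dataLaw G ν φ)) (h : Param p) :
    quadForm (fisherInfo G ν φ) (coordProj {1, 4} h) = quadForm (fisherInfo G ν φ) (coordProj {1} h)
      + 1 / 2 * ∑ i, covDir G (varIdx 2) (varIdx 3) φ h i ^ 2 := by
  obtain ⟨i1, e1⟩ := integrable_quadForm_whiteData hφ hint (coordProj {1, 4} h)
  obtain ⟨i2, e2⟩ := integrable_quadForm_whiteData hφ hint (coordProj {1} h)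
  simp only [fun ω => (quadForm_obsInfo_coordProj G hφ h ω).2.2.1,
    fun ω => (quadForm_obsInfo_coordProj G hφ h ω).2.2.2.1] at i1 i2 e1 e2
  rw [← e1, ← e2]
  have key : ∀ f : ((Fin N → Fin p → ℝ) × (Fin N → unitInterval)) × (Fin N → ℝ) → ℝ,
      ∫ ω, f ω.1 ∂(whiteLaw ν)
        = ∫ ω, f ω ∂((ν.prod (Measure.pi fun _ => volume)).prod (stdNormals N)) := fun f => by
    rw [whiteLaw, integral_fun_fst]
    simp
  have key' : ∀ f : ((Fin N → Fin p → ℝ) × (Fin N → unitInterval)) × (Fin N → ℝ) → ℝ,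
      Integrable (fun ω => f ω.1) (whiteLaw ν) →
        Integrable f ((ν.prod (Measure.pi fun _ => volume)).prod (stdNormals N)) := fun f hf =>
    hf.of_comp_fst (NeZero.ne _)
  rw [key fun ω => gcurv (covDir G (varIdx 2) (varIdx 3) φ h) (meanM G φ ω.1 h) ω.2,
    key fun ω => ∑ i, meanM G φ ω.1 h i ^ 2]
  exact integral_gcurv (P := ν.prod (Measure.pi fun _ => volume)) (x := fun ω => meanM G φ ω h)
    (key' (fun ω => gcurv (covDir G (varIdx 2) (varIdx 3) φ h) (meanM G φ ω.1 h) ω.2) i1)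
    (key' (fun ω => ∑ i, meanM G φ ω.1 h i ^ 2) i2)

/-- The three factors of the likelihood involve disjoint groups of parameters, so no cross terms
arise between them. -/
theorem quadForm_fisherInfo_eq_add (hφ : ∀ k, 0 < variances φ k)
    (hint : ∀ k l, Integrable (fun x => obsInfo G x φ k l) (dataLaw G ν φ)) (h : Param p) :
    quadForm (fisherInfo G ν φ) h = quadForm (fisherInfo G ν φ) (coordProj {0, 3} h)
      + quadForm (fisherInfo G ν φ) (coordProj {1, 4} h)
      + quadForm (fisherInfo G ν φ) (coordProj {2} h) := by
  obtain ⟨i1, e1⟩ := integrable_quadForm_whiteData hφ hint (coordProj {0, 3} h)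
  obtain ⟨i2, e2⟩ := integrable_quadForm_whiteData hφ hint (coordProj {1, 4} h)
  obtain ⟨i3, e3⟩ := integrable_quadForm_whiteData hφ hint (coordProj {2} h)
  rw [← e1, ← e2, ← e3, ← (integrable_quadForm_whiteData hφ hint h).2, ← integral_add i1 i2]
  have e4 := integral_add (i1.add i2) i3
  simp only [Pi.add_apply] at e4
  rw [← e4]
  refine integral_congr_ae (ae_of_all _ fun ω => ?_)
  obtain ⟨h1, -, h2, -, h3⟩ := quadForm_obsInfo_coordProj G hφ h ω
  simp only [h1, h2, h3]
  exact quadForm_obsInfo_whiteData G hφ h ω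

end Blocks

end RENSEM


namespace RENSEM

/-! ### Consequences of the regularity conditions -/

section Regularity

variable {p : ℕ} {G : ∀ N, SimpleGraph (Fin N)} {ν : ∀ N, Measure (Fin N → Fin p → ℝ)}
  {Θ : Set (Param p)} {φ : Param p}

/-- The operator `B_N(φ)^{-1/2}`. -/
noncomputable def invSqrt {N : ℕ} (G : SimpleGraph (Fin N)) (ν : Measure (Fin N → Fin p → ℝ))
    (φ : Param p) : Param p →ₗ[ℝ] Param p :=
  Matrix.toEuclideanLin (fisherSqrt G ν φ)⁻¹

theorem InformationGrowth.norm_invSqrt_le (h : InformationGrowth G ν Θ) (hφ : φ ∈ Θ) {ε : ℝ}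
    (hε : 0 < ε) : ∀ᶠ N in atTop, ∀ u, ‖invSqrt (G N) (ν N) φ u‖ ≤ ε * ‖u‖ := by
  have h0 : (0 : ℝ≥0∞) < ENNReal.ofReal (ε ^ 2) := ENNReal.ofReal_pos.2 (by positivity)
  filter_upwards [h.tendsto.eventually (gt_mem_nhds h0), h.posDef] with N hN hB u
  have h1 : frob (fisherInfo (G N) (ν N) φ)⁻¹ ≤ ε ^ 2 := by
    refine (ENNReal.ofReal_le_ofReal_iff (by positivity)).1 (le_trans ?_ hN.le)
    exact le_iSup₂ (f := fun φ (_ : φ ∈ Θ) =>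
      ENNReal.ofReal (frob (fisherInfo (G N) (ν N) φ)⁻¹)) φ hφ
  refine (sq_le_sq₀ (norm_nonneg _) (by positivity)).1 ?_
  rw [mul_pow]
  exact (norm_sqrt_inv_sq_le (hB φ hφ) u).trans (by gcongr)

theorem InformationConvergence.lintegral_frob_le (h : InformationConvergence G ν Θ)
    [∀ N, IsProbabilityMeasure (ν N)] {η : ℝ} (hη : 0 < η) :
    ∀ᶠ N in atTop, ∀ φ ∈ Θ, ∫⁻ x, ENNReal.ofReal
      (frob ((fisherSqrt (G N) (ν N) φ)⁻¹ * obsInfo (G N) x φ * (fisherSqrt (G N) (ν N) φ)⁻¹ - 1))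
      ∂(dataLaw (G N) (ν N) φ) ≤ ENNReal.ofReal η := by
  have h0 : (0 : ℝ≥0∞) < ENNReal.ofReal (η ^ 2) := ENNReal.ofReal_pos.2 (by positivity)
  filter_upwards [h.eventually (gt_mem_nhds h0)] with N hN φ hφ
  have h1 := (le_iSup₂ (f := fun φ (_ : φ ∈ Θ) => ∫⁻ x, ENNReal.ofReal
      (frob ((fisherSqrt (G N) (ν N) φ)⁻¹ * obsInfo (G N) x φ *
        (fisherSqrt (G N) (ν N) φ)⁻¹ - 1) ^ 2) ∂(dataLaw (G N) (ν N) φ)) φ hφ).trans hN.le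
  set f : Data N p → ℝ := fun x => frob ((fisherSqrt (G N) (ν N) φ)⁻¹ * obsInfo (G N) x φ *
        (fisherSqrt (G N) (ν N) φ)⁻¹ - 1) with hf
  calc ∫⁻ x, ENNReal.ofReal (f x) ∂(dataLaw (G N) (ν N) φ)
      ≤ ∫⁻ x, (ENNReal.ofReal (η / 2) + ENNReal.ofReal (1 / (2 * η)) * ENNReal.ofReal (f x ^ 2))
        ∂(dataLaw (G N) (ν N) φ) := by
        refine lintegral_mono fun x => ?_
        rw [← ENNReal.ofReal_mul (by positivity), ← ENNReal.ofReal_add (by positivity)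
          (by positivity)]
        refine ENNReal.ofReal_le_ofReal ?_
        have : η / 2 + 1 / (2 * η) * f x ^ 2 - f x = 1 / (2 * η) * (f x - η) ^ 2 := by
          field_simp; ring
        have h2 : 0 ≤ 1 / (2 * η) * (f x - η) ^ 2 := by positivity
        linarith
    _ = ENNReal.ofReal (η / 2) + ENNReal.ofReal (1 / (2 * η)) * ∫⁻ x, ENNReal.ofReal (f x ^ 2)
        ∂(dataLaw (G N) (ν N) φ) := by
        rw [lintegral_add_left measurable_const, lintegral_const_mul' _ _ ENNReal.ofReal_ne_top]
        simp
    _ ≤ ENNReal.ofReal (η / 2) + ENNReal.ofReal (1 / (2 * η)) * ENNReal.ofReal (η ^ 2) := by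
        gcongr
    _ = ENNReal.ofReal η := by
        rw [← ENNReal.ofReal_mul (by positivity), ← ENNReal.ofReal_add (by positivity)
          (by positivity)]
        congr 1
        field_simp; ring

variable [∀ N, IsProbabilityMeasure (ν N)]

theorem continuous_frob_conj {κ : Type*} [Fintype κ] [DecidableEq κ] (T : Matrix κ κ ℝ) :
    Continuous fun J : κ → κ → ℝ => frob (T * Matrix.of J * T - 1) := by
  unfold frob
  have h : Continuous fun J : κ → κ → ℝ => T * Matrix.of J * T - 1 := by
    have : Continuous fun J : κ → κ → ℝ => (Matrix.of J : Matrix κ κ ℝ) := continuous_id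
    fun_prop
  exact Real.continuous_sqrt.comp (h.matrix_transpose.matrix_mul h).matrix_trace

theorem whp_frob_le (hgrowth : InformationGrowth G ν Θ) (hconv : InformationConvergence G ν Θ)
    (hvar : ∀ k, 0 < variances φ k) (hφ : φ ∈ Θ) {ε : ℝ} (hε : 0 < ε) :
    Whp (fun N => whiteLaw (ν N)) fun N => {ω | frob ((fisherSqrt (G N) (ν N) φ)⁻¹
      * obsInfo (G N) (whiteData (G N) φ ω) φ * (fisherSqrt (G N) (ν N) φ)⁻¹ - 1) ≤ ε} := by
  intro δ hδ
  obtain ⟨η, hη0, hη⟩ : ∃ η : ℝ, 0 < η ∧ ENNReal.ofReal η / ENNReal.ofReal ε ≤ δ := by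
    have h1 : Tendsto (fun η : ℝ => ENNReal.ofReal η / ENNReal.ofReal ε) (𝓝[>] 0) (𝓝 0) := by
      have h2 : Tendsto (fun η : ℝ => ENNReal.ofReal η) (𝓝[>] 0) (𝓝 0) := by
        rw [← ENNReal.ofReal_zero]
        exact (ENNReal.continuous_ofReal.tendsto 0).mono_left nhdsWithin_le_nhds
      simpa using ENNReal.Tendsto.div_const h2 (Or.inr (ENNReal.ofReal_pos.2 hε).ne')
    obtain ⟨η, h3, h4⟩ := ((h1.eventually (ge_mem_nhds hδ)).and self_mem_nhdsWithin).exists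
    exact ⟨η, h4, h3⟩
  filter_upwards [hconv.lintegral_frob_le hη0, hgrowth.integrable] with N hN hint
  set f : Data N p → ℝ := fun x => frob ((fisherSqrt (G N) (ν N) φ)⁻¹ * obsInfo (G N) x φ *
        (fisherSqrt (G N) (ν N) φ)⁻¹ - 1) with hf
  have hmeas : AEMeasurable f (dataLaw (G N) (ν N) φ) := by
    have h1 : AEMeasurable (fun x k l => obsInfo (G N) x φ k l) (dataLaw (G N) (ν N) φ) :=
      aemeasurable_pi_lambda _ fun k => aemeasurable_pi_lambda _ fun l =>
        (hint φ hφ k l).aestronglyMeasurable.aemeasurable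
    exact (continuous_frob_conj _).measurable.comp_aemeasurable h1
  have h1 : dataLaw (G N) (ν N) φ {x | ENNReal.ofReal ε ≤ ENNReal.ofReal (f x)} ≤ δ :=
    (meas_ge_le_lintegral_div hmeas.ennreal_ofReal (ENNReal.ofReal_pos.2 hε).ne'
      ENNReal.ofReal_ne_top).trans ((ENNReal.div_le_div_right (hN φ hφ) _).trans hη)
  rw [← map_whiteData (G N) (ν N) hvar] at h1
  refine (measure_mono fun ω hω => ?_).trans ((Measure.le_map_apply
    (measurable_whiteData (G N) φ).aemeasurable _).trans h1)
  rw [Set.mem_compl_iff, Set.mem_ofPred_eq, not_le] at hω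
  rw [Set.mem_preimage, Set.mem_ofPred_eq]
  exact ENNReal.ofReal_le_ofReal hω.le

end Regularity

/-! ### The linear models as Gaussian blocks -/

section GaussianModels

variable {p : ℕ} {G : ∀ N, SimpleGraph (Fin N)} {ν : ∀ N, Measure (Fin N → Fin p → ℝ)}
  {Θ : Set (Param p)} {φ : Param p}

/-- The local parameters of `Θ`. -/
def localSet (G : ∀ N, SimpleGraph (Fin N)) (ν : ∀ N, Measure (Fin N → Fin p → ℝ))
    (Θ : Set (Param p)) (φ : Param p) (N : ℕ) : Set (Param p) :=
  {u | φ + invSqrt (G N) (ν N) φ u ∈ Θ}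

theorem InformationGrowth.eventually_mem_localSet (h : InformationGrowth G ν Θ)
    (hφ : φ ∈ interior Θ) (R : ℝ) :
    ∀ᶠ N in atTop, ∀ u, ‖u‖ ≤ R → φ + invSqrt (G N) (ν N) φ u ∈ Θ := by
  obtain ⟨r, hr, hball⟩ := Metric.isOpen_iff.1 isOpen_interior φ hφ
  have hR : 0 < r / (2 * (|R| + 1)) := by positivity
  filter_upwards [h.norm_invSqrt_le (interior_subset hφ) hR] with N hN u hu
  refine interior_subset (hball ?_)
  rw [Metric.mem_ball, dist_eq_norm, add_sub_cancel_left]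
  refine (hN u).trans_lt ?_
  have h1 : ‖u‖ ≤ |R| + 1 := by have := le_abs_self R; linarith
  calc r / (2 * (|R| + 1)) * ‖u‖ ≤ r / (2 * (|R| + 1)) * (|R| + 1) := by gcongr
    _ = r / 2 := by field_simp
    _ < r := by linarith

theorem exists_variances_mem_Icc (hΘ : IsCompact Θ) (hvar : ∀ φ ∈ Θ, ∀ k, 0 < variances φ k) :
    ∃ v V : ℝ, 0 < v ∧ v ≤ V ∧ ∀ φ ∈ Θ, ∀ k, variances φ k ∈ Set.Icc v V := by
  have hc : ∀ k, ContinuousOn (fun φ : Param p => variances φ k) Θ := fun k => by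
    have : Continuous fun φ : Param p => φ (varIdx k) := by fun_prop
    exact this.continuousOn
  rcases Θ.eq_empty_or_nonempty with rfl | hne
  · exact ⟨1, 1, one_pos, le_rfl, by simp⟩
  choose a ha hamin using fun k => hΘ.exists_isMinOn hne (hc k)
  choose b hb hbmax using fun k => hΘ.exists_isMaxOn hne (hc k)
  refine ⟨Finset.univ.inf' Finset.univ_nonempty fun k => variances (a k) k,
    Finset.univ.sup' Finset.univ_nonempty fun k => variances (b k) k, ?_, ?_, fun φ hφ k => ⟨?_, ?_⟩⟩
  · simpa using fun k => hvar _ (ha k) k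
  · exact (Finset.inf'_le _ (Finset.mem_univ 0)).trans
      ((hamin 0 (hb 0)).trans (Finset.le_sup' (fun k => variances (b k) k) (Finset.mem_univ 0)))
  · exact (Finset.inf'_le _ (Finset.mem_univ k)).trans (hamin k hφ)
  · exact le_trans (hbmax k hφ) (Finset.le_sup' (fun k => variances (b k) k) (Finset.mem_univ k))

/-- Numerator and denominator are both affine in the eigenvalue, so their ratio is bounded uniformly
over all eigenvalues, however large. Hence max |w_i| → 0 follows from B_N^{-1} → 0 alone. -/
theorem abs_covDir_le {N : ℕ} (G : SimpleGraph (Fin N)) {s t : ParamIdx p} (hs : 0 < φ s)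
    (ht : 0 < φ t) (h : Param p) (i : Fin N) :
    |covDir G s t φ h i| ≤ (1 / φ s + 1 / φ t) * ‖h‖ := by
  have hd := scale_pos G hs ht.le i
  have hμ := eig_nonneg G i
  have h1 : |h s| ≤ ‖h‖ := abs_apply_le_norm h s
  have h2 : |h t| ≤ ‖h‖ := abs_apply_le_norm h t
  have h0 := norm_nonneg h
  simp only [covDir, LinearMap.coe_mk, AddHom.coe_mk]
  rw [abs_div, abs_of_pos hd, div_le_iff₀ hd]
  have h3 : |scale G s t h i| ≤ ‖h‖ * (1 + eig G i) := by
    rw [scale]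
    refine (abs_add_le _ _).trans ?_
    rw [abs_mul, abs_of_nonneg hμ, mul_add, mul_one]
    gcongr
  refine h3.trans ?_
  have h4 : 1 + eig G i ≤ (1 / φ s + 1 / φ t) * scale G s t φ i := by
    have e : (1 / φ s + 1 / φ t) * scale G s t φ i
        = 1 + eig G i + (φ t / φ s * eig G i + φ s / φ t) := by
      simp only [scale]; field_simp; ring
    rw [e]
    have : 0 ≤ φ t / φ s * eig G i + φ s / φ t := by positivity
    linarith
  calc _ ≤ ‖h‖ * ((1 / φ s + 1 / φ t) * scale G s t φ i) := by gcongr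
    _ = _ := by ring

/-- Each variance ratio is a convex combination of the ratios of the two variance components. The
weights do not depend on h, which is the structure that `geomSup` needs. -/
theorem one_add_covDir {N : ℕ} (G : SimpleGraph (Fin N)) {s t : ParamIdx p} (hs : 0 < φ s)
    (ht : 0 < φ t) (h : Param p) (i : Fin N) :
    1 + covDir G s t φ h i = (φ + h) s / φ s * (φ s / scale G s t φ i)
      + (φ + h) t / φ t * (1 - φ s / scale G s t φ i) := by
  have hd := (scale_pos G hs ht.le i).ne'
  simp only [covDir, LinearMap.coe_mk, AddHom.coe_mk, PiLp.add_apply]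
  have e : 1 - φ s / scale G s t φ i = φ t * eig G i / scale G s t φ i := by
    rw [eq_div_iff hd, sub_mul, div_mul_cancel₀ _ hd, scale]; ring
  rw [e]
  field_simp
  simp only [scale]
  ring

/-- Common to mediator and outcome models: S selects the whole block and S' its mean coefficients.
By `hsplit` the variance contribution to `gquad` cancels exactly against that in q, so the only
random approximation needed concerns the means. -/
theorem isGaussBlock_of_projections {Ω : ℕ → Type*} [∀ N, MeasurableSpace (Ω N)]
    {P : ∀ N, Measure (Ω N)} {x : ∀ N, Ω N → Param p →ₗ[ℝ] (Fin N → ℝ)} {a b : Fin 4}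
    {S S' : Finset (Fin 5)} (hΘ : IsCompact Θ) (hvar : ∀ φ ∈ Θ, ∀ k, 0 < variances φ k)
    (hφ : φ ∈ interior Θ) (hgrowth : InformationGrowth G ν Θ)
    (hmeas : ∀ N h, Measurable fun ω => x N ω h)
    (hcov : ∀ N h, covDir (G N) (varIdx a) (varIdx b) φ (coordProj S h)
      = covDir (G N) (varIdx a) (varIdx b) φ h)
    (hx : ∀ N ω h, x N ω (coordProj S h) = x N ω h)
    (hle : ∀ᶠ N in atTop, ∀ h, quadForm (fisherInfo (G N) (ν N) φ) (coordProj S h)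
      ≤ quadForm (fisherInfo (G N) (ν N) φ) h)
    (hsplit : ∀ᶠ N in atTop, ∀ h, quadForm (fisherInfo (G N) (ν N) φ) (coordProj S h)
      = quadForm (fisherInfo (G N) (ν N) φ) (coordProj S' h)
        + 1 / 2 * ∑ i, covDir (G N) (varIdx a) (varIdx b) φ h i ^ 2)
    (hquad : ∀ ε > 0, Whp P fun N => {ω | ∀ u,
      |∑ i, x N ω (invSqrt (G N) (ν N) φ u) i ^ 2 - quadForm (fisherInfo (G N) (ν N) φ)
        (coordProj S' (invSqrt (G N) (ν N) φ u))| ≤ ε * ‖u‖ ^ 2}) :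
    IsGaussBlock P (localSet G ν Θ φ)
      (fun N => covDir (G N) (varIdx a) (varIdx b) φ ∘ₗ invSqrt (G N) (ν N) φ)
      (fun N ω => x N ω ∘ₗ invSqrt (G N) (ν N) φ)
      (fun N u => quadForm (fisherInfo (G N) (ν N) φ) (coordProj S (invSqrt (G N) (ν N) φ u))) := by
  have hφΘ := interior_subset hφ
  have ha : 0 < φ (varIdx a) := hvar φ hφΘ a
  have hb : 0 < φ (varIdx b) := hvar φ hφΘ b
  refine ⟨fun N u => hmeas N _, ?_, ?_, ?_, ?_, ?_, ?_⟩
  · filter_upwards [hgrowth.posDef] with N hB u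
    have hB := hB φ hφΘ
    set u' := Matrix.toEuclideanLin (fisherSqrt (G N) (ν N) φ)
      (coordProj S (invSqrt (G N) (ν N) φ u)) with hu'
    have hT : invSqrt (G N) (ν N) φ u' = coordProj S (invSqrt (G N) (ν N) φ u) :=
      toEuclideanLin_inv_sqrt hB _
    refine ⟨u', (quadForm_eq_norm_sq hB _).symm, ?_, ?_, fun ω => ?_⟩
    · simp only [hT, coordProj_coordProj]
    · simp only [LinearMap.comp_apply, hT, hcov]
    · simp only [LinearMap.comp_apply, hT, hx]
  · filter_upwards [hgrowth.posDef, hle] with N hB h u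
    exact (h _).trans (quadForm_sqrt_inv (hB φ hφΘ) u).le
  · intro ε hε
    refine (hquad ε hε).mono ?_
    filter_upwards [hsplit] with N h ω hω u
    have e : gquad (covDir (G N) (varIdx a) (varIdx b) φ (invSqrt (G N) (ν N) φ u))
        (x N ω (invSqrt (G N) (ν N) φ u)) = ∑ i, x N ω (invSqrt (G N) (ν N) φ u) i ^ 2
        + 1 / 2 * ∑ i, covDir (G N) (varIdx a) (varIdx b) φ (invSqrt (G N) (ν N) φ u) i ^ 2 := by
      rw [gquad, Finset.mul_sum, ← Finset.sum_add_distrib]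
      exact Finset.sum_congr rfl fun i _ => by ring
    have := hω u
    simp only [LinearMap.comp_apply]
    rw [e, h, add_sub_add_right_eq_sub]
    exact this
  · intro ε hε
    set c := 1 / φ (varIdx a) + 1 / φ (varIdx b) with hc
    have hc0 : 0 < c := by positivity
    filter_upwards [hgrowth.norm_invSqrt_le hφΘ (ε := ε / c) (by positivity)] with N hN u i
    refine (abs_covDir_le (G N) ha hb _ i).trans ?_
    calc c * ‖invSqrt (G N) (ν N) φ u‖ ≤ c * (ε / c * ‖u‖) := by gcongr; exact hN u
      _ = ε * ‖u‖ := by field_simp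
  · obtain ⟨v, V, hv, hvV, hI⟩ := exists_variances_mem_Icc hΘ hvar
    have hV : 0 < V := hv.trans_le hvV
    have h1 : 1 ≤ V / v := (one_le_div hv).2 hvV
    have h2 : v / V ≤ 1 := (div_le_one hV).2 hvV
    have hratio : ∀ ψ ∈ Θ, ∀ k, ψ (varIdx k) / φ (varIdx k) ∈ Set.Icc (v / V) (V / v) :=
      fun ψ hψ k => by
        have i1 := hI ψ hψ k
        have i2 := hI φ hφΘ k
        have i3 : 0 < φ (varIdx k) := hv.trans_le i2.1
        exact ⟨div_le_div₀ (hv.le.trans i1.1) i1.1 i3 i2.2, div_le_div₀ hV.le i1.2 hv i2.1⟩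
    refine ⟨v / V, V / v, by positivity, h1, h2.trans h1, Eventually.of_forall fun N =>
      ⟨fun i => φ (varIdx a) / scale (G N) (varIdx a) (varIdx b) φ i, fun i => ?_, fun u hu =>
        ⟨_, hratio _ hu a, _, hratio _ hu b, fun i => one_add_covDir (G N) ha hb _ i⟩⟩⟩
    have hd := scale_pos (G N) ha hb.le i
    refine ⟨by positivity, (div_le_one hd).2 ?_⟩
    have := mul_nonneg hb.le (eig_nonneg (G N) i)
    rw [scale]; linarith
  · exact hgrowth.eventually_mem_localSet hφ

end GaussianModels

end RENSEM


namespace RENSEM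

/-! ### The three blocks of the model -/

/-! ### Measurability of designs, mean directions and logits. -/

section Measurability

variable {N p : ℕ}

theorem measurable_designM_mulVec {Ω : Type*} [MeasurableSpace Ω] (G : SimpleGraph (Fin N))
    {C : Ω → Fin N → Fin p → ℝ} {A : Ω → Fin N → ℝ} (hC : Measurable C) (hA : Measurable A)
    (g : GammaIdx p → ℝ) : Measurable fun ω => designM G (C ω) (A ω) *ᵥ g := by
  refine measurable_pi_lambda _ fun i => ?_
  simp only [designM, nbrAvg, Matrix.mulVec, dotProduct,
    Matrix.of_apply, Fintype.sum_sum_type, Sum.elim_inl, Sum.elim_inr, Fin.sum_univ_succ,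
    Matrix.cons_val_zero, Matrix.cons_val_succ, Fin.sum_univ_zero]
  fun_prop

theorem measurable_designY_mulVec {Ω : Type*} [MeasurableSpace Ω] (G : SimpleGraph (Fin N))
    {C : Ω → Fin N → Fin p → ℝ} {A M : Ω → Fin N → ℝ} (hC : Measurable C) (hA : Measurable A)
    (hM : Measurable M) (b : BetaIdx p → ℝ) :
    Measurable fun ω => designY G (C ω) (A ω) (M ω) *ᵥ b := by
  refine measurable_pi_lambda _ fun i => ?_
  simp only [designY, nbrAvg, Matrix.mulVec, dotProduct,
    Matrix.of_apply, Fintype.sum_sum_type, Sum.elim_inl, Sum.elim_inr, Fin.sum_univ_succ,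
    Matrix.cons_val_zero, Matrix.cons_val_succ, Fin.sum_univ_zero]
  fun_prop

theorem measurable_meanDir {ι Ω : Type*} [Fintype ι] [MeasurableSpace Ω] (G : SimpleGraph (Fin N))
    (b : ι → ParamIdx p) (s t : ParamIdx p) (φ h : Param p) {X : Ω → Matrix (Fin N) ι ℝ}
    (hX : Measurable fun ω => X ω *ᵥ fun k => h (b k)) :
    Measurable fun ω => meanDir G b s t φ (X ω) h := by
  have := (measurable_mulVec (rot G)ᵀ).comp hX
  refine measurable_pi_lambda _ fun i => ?_
  exact ((measurable_pi_apply i).comp this).div_const _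

theorem measurable_exposure (φ : Param p) :
    Measurable fun ω : (Fin N → Fin p → ℝ) × (Fin N → unitInterval) => exposure φ ω.1 ω.2 := by
  have h : Measurable fun ω : (Fin N → Fin p → ℝ) × (Fin N → unitInterval) =>
      ((ω, (0 : Fin N → ℝ)), (0 : Fin N → ℝ)) := by fun_prop
  -- Exposures do not involve the network, so any graph serves here.
  exact ((measurable_whiteData (⊥ : SimpleGraph (Fin N)) φ).comp h).snd.fst

theorem measurable_meanM (G : SimpleGraph (Fin N)) (φ h : Param p) :
    Measurable fun ω => meanM G φ ω h :=
  measurable_meanDir G gammaIdx (varIdx 2) (varIdx 3) φ h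
    (measurable_designM_mulVec G measurable_fst (measurable_exposure φ) fun k => h (gammaIdx k))

theorem measurable_meanY (G : SimpleGraph (Fin N)) (φ h : Param p) :
    Measurable fun ω => meanY G φ ω h := by
  have h1 : Measurable fun ω : ((Fin N → Fin p → ℝ) × (Fin N → unitInterval)) × (Fin N → ℝ) =>
      (ω, (0 : Fin N → ℝ)) := by fun_prop
  have h2 := ((measurable_whiteData G φ).comp h1).snd.snd.fst
  have hM : Measurable fun ω : ((Fin N → Fin p → ℝ) × (Fin N → unitInterval)) × (Fin N → ℝ) =>
      whiteMediator G φ ω.1.1 (exposure φ ω.1.1 ω.1.2) ω.2 := h2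
  have hA : Measurable fun ω : ((Fin N → Fin p → ℝ) × (Fin N → unitInterval)) × (Fin N → ℝ) =>
      exposure φ ω.1.1 ω.1.2 := (measurable_exposure φ).comp measurable_fst
  exact measurable_meanDir G Sum.inl (varIdx 0) (varIdx 1) φ h
    (measurable_designY_mulVec G measurable_fst.fst hA hM fun k => h (Sum.inl k))

theorem measurable_logitDir (φ : Param p) :
    Measurable fun C : Fin N → Fin p → ℝ => logitDir C φ := by
  refine measurable_pi_lambda _ fun i => ?_
  simp only [logitDir, LinearMap.coe_mk, AddHom.coe_mk, dotProduct]
  fun_prop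

theorem measurable_bernInfo {Ω ι : Type*} [Fintype ι] [MeasurableSpace Ω] {θ x : Ω → ι → ℝ}
    (hθ : Measurable θ) (hx : Measurable x) : Measurable fun ω => bernInfo (θ ω) (x ω) := by
  unfold bernInfo
  refine Finset.measurable_sum _ fun i _ => ?_
  have h1 : Measurable fun ω => Real.sigmoid (θ ω i) :=
    continuous_sigmoid.measurable.comp (by fun_prop)
  fun_prop

end Measurability

/-! ### Verification of the block conditions from the information conditions. -/

section Models

variable {p : ℕ} {G : ∀ N, SimpleGraph (Fin N)} {ν : ∀ N, Measure (Fin N → Fin p → ℝ)}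
  {Θ : Set (Param p)} {φ : Param p}

/-- The part of the squared norm of a local parameter that belongs to some classes. -/
noncomputable def blockForm (G : ∀ N, SimpleGraph (Fin N)) (ν : ∀ N, Measure (Fin N → Fin p → ℝ))
    (φ : Param p) (S : Finset (Fin 5)) (N : ℕ) (u : Param p) : ℝ :=
  quadForm (fisherInfo (G N) (ν N) φ) (coordProj S (invSqrt (G N) (ν N) φ u))

theorem InformationGrowth.quadForm_nonneg (h : InformationGrowth G ν Θ) (hφ : φ ∈ Θ) :
    ∀ᶠ N in atTop, ∀ u, 0 ≤ quadForm (fisherInfo (G N) (ν N) φ) u := by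
  filter_upwards [h.posDef] with N hB u
  rw [quadForm_eq_norm_sq (hB φ hφ)]
  positivity

theorem InformationGrowth.blockForm_nonneg (h : InformationGrowth G ν Θ) (hφ : φ ∈ Θ)
    (S : Finset (Fin 5)) : ∀ᶠ N in atTop, ∀ u, 0 ≤ blockForm G ν φ S N u := by
  filter_upwards [h.quadForm_nonneg hφ] with N hN u using hN _

variable [∀ N, IsProbabilityMeasure (ν N)]

theorem InformationGrowth.quadForm_coordProj_le (h : InformationGrowth G ν Θ) (hφ : φ ∈ Θ)
    (hpos : ∀ k, 0 < variances φ k) {S : Finset (Fin 5)}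
    (hS : S = {0, 3} ∨ S = {1, 4} ∨ S = {2}) :
    ∀ᶠ N in atTop, ∀ u, quadForm (fisherInfo (G N) (ν N) φ) (coordProj S u)
      ≤ quadForm (fisherInfo (G N) (ν N) φ) u := by
  filter_upwards [h.quadForm_nonneg hφ, h.integrable] with N h0 hint u
  have h1 := quadForm_fisherInfo_eq_add hpos (hint φ hφ) u
  have h2 := h0 (coordProj {0, 3} u)
  have h3 := h0 (coordProj {1, 4} u)
  have h4 := h0 (coordProj {2} u)
  rcases hS with rfl | rfl | rfl <;> linarith

theorem InformationGrowth.blockForm_add (h : InformationGrowth G ν Θ) (hφ : φ ∈ Θ)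
    (hpos : ∀ k, 0 < variances φ k) : ∀ᶠ N in atTop, ∀ u,
    blockForm G ν φ {0, 3} N u + blockForm G ν φ {1, 4} N u + blockForm G ν φ {2} N u
      = ‖u‖ ^ 2 := by
  filter_upwards [h.posDef, h.integrable] with N hB hint u
  rw [← quadForm_sqrt_inv (hB φ hφ) u]
  exact (quadForm_fisherInfo_eq_add hpos (hint φ hφ) _).symm

theorem whp_quadForm_obsInfo (hgrowth : InformationGrowth G ν Θ)
    (hconv : InformationConvergence G ν Θ) (hpos : ∀ k, 0 < variances φ k) (hφ : φ ∈ Θ)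
    {S' S : Finset (Fin 5)}
    (hle : ∀ᶠ N in atTop, ∀ h, quadForm (fisherInfo (G N) (ν N) φ) (coordProj S' h)
      ≤ quadForm (fisherInfo (G N) (ν N) φ) (coordProj S h))
    (hS : S = {0, 3} ∨ S = {1, 4} ∨ S = {2}) {ε : ℝ} (hε : 0 < ε) :
    Whp (fun N => whiteLaw (ν N)) fun N => {ω | ∀ u,
      |quadForm (obsInfo (G N) (whiteData (G N) φ ω) φ) (coordProj S' (invSqrt (G N) (ν N) φ u))
        - quadForm (fisherInfo (G N) (ν N) φ) (coordProj S' (invSqrt (G N) (ν N) φ u))|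
        ≤ ε * ‖u‖ ^ 2} := by
  refine (whp_frob_le hgrowth hconv hpos hφ hε).mono ?_
  filter_upwards [hle, hgrowth.quadForm_coordProj_le hφ hpos hS, hgrowth.quadForm_nonneg hφ,
    hgrowth.posDef] with N h1 h2 h3 hB ω hω u
  refine (abs_quadForm_sub_le (hB φ hφ) _ _).trans ?_
  have h4 : quadForm (fisherInfo (G N) (ν N) φ) (coordProj S' (invSqrt (G N) (ν N) φ u))
      ≤ ‖u‖ ^ 2 := (h1 _).trans ((h2 _).trans (quadForm_sqrt_inv (hB φ hφ) u).le)
  exact mul_le_mul hω h4 (h3 _) hε.le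

theorem isGaussBlock_outcome (hΘ : IsCompact Θ) (hvar : ∀ φ ∈ Θ, ∀ k, 0 < variances φ k)
    (hφ : φ ∈ interior Θ) (hgrowth : InformationGrowth G ν Θ)
    (hconv : InformationConvergence G ν Θ) :
    IsGaussBlock (fun N => ((ν N).prod (uniforms N)).prod (stdNormals N)) (localSet G ν Θ φ)
      (fun N => covDir (G N) (varIdx 0) (varIdx 1) φ ∘ₗ invSqrt (G N) (ν N) φ)
      (fun N ω => meanY (G N) φ ω ∘ₗ invSqrt (G N) (ν N) φ) (blockForm G ν φ {0, 3}) := by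
  have hφΘ := interior_subset hφ
  have hpos := hvar φ hφΘ
  have hsplit : ∀ᶠ N in atTop, ∀ h, quadForm (fisherInfo (G N) (ν N) φ) (coordProj {0, 3} h)
      = quadForm (fisherInfo (G N) (ν N) φ) (coordProj {0} h)
        + 1 / 2 * ∑ i, covDir (G N) (varIdx 0) (varIdx 1) φ h i ^ 2 := by
    filter_upwards [hgrowth.integrable] with N hint h
    exact quadForm_fisherInfo_outcome hpos (hint φ hφΘ) h
  refine isGaussBlock_of_projections hΘ hvar hφ hgrowth (fun N h => measurable_meanY (G N) φ h)
    (fun N h => ?_) (fun N ω h => ?_) (hgrowth.quadForm_coordProj_le hφΘ hpos (Or.inl rfl))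
    hsplit fun ε hε => ?_
  · rw [(covDir_coordProj (G N) φ h _).1, if_pos (by decide)]
  · rw [meanY_coordProj, if_pos (by decide)]
  -- The observed information uses all the noise, while the mean changes use only the past. The
  -- event can thus be read on the full space and the last coordinate dropped.
  · refine (Whp.prod_fst (Q := fun N => stdNormals N)).1 ?_
    refine (whp_quadForm_obsInfo hgrowth hconv hpos hφΘ (S' := {0}) (S := {0, 3}) ?_ (Or.inl rfl)
      hε).mono (Eventually.of_forall fun N ω hω u => ?_)
    · filter_upwards [hsplit] with N h u
      rw [h u]
      exact le_add_of_nonneg_right (by positivity)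
    · have := hω u
      rwa [(quadForm_obsInfo_coordProj (G N) hpos _ ω).2.1] at this

theorem isGaussBlock_mediator (hΘ : IsCompact Θ) (hvar : ∀ φ ∈ Θ, ∀ k, 0 < variances φ k)
    (hφ : φ ∈ interior Θ) (hgrowth : InformationGrowth G ν Θ)
    (hconv : InformationConvergence G ν Θ) :
    IsGaussBlock (fun N => (ν N).prod (uniforms N)) (localSet G ν Θ φ)
      (fun N => covDir (G N) (varIdx 2) (varIdx 3) φ ∘ₗ invSqrt (G N) (ν N) φ)
      (fun N ω => meanM (G N) φ ω ∘ₗ invSqrt (G N) (ν N) φ) (blockForm G ν φ {1, 4}) := by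
  have hφΘ := interior_subset hφ
  have hpos := hvar φ hφΘ
  have hsplit : ∀ᶠ N in atTop, ∀ h, quadForm (fisherInfo (G N) (ν N) φ) (coordProj {1, 4} h)
      = quadForm (fisherInfo (G N) (ν N) φ) (coordProj {1} h)
        + 1 / 2 * ∑ i, covDir (G N) (varIdx 2) (varIdx 3) φ h i ^ 2 := by
    filter_upwards [hgrowth.integrable] with N hint h
    exact quadForm_fisherInfo_mediator hpos (hint φ hφΘ) h
  refine isGaussBlock_of_projections hΘ hvar hφ hgrowth (fun N h => measurable_meanM (G N) φ h)
    (fun N h => ?_) (fun N ω h => ?_) (hgrowth.quadForm_coordProj_le hφΘ hpos (Or.inr (Or.inl rfl)))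
    hsplit fun ε hε => ?_
  · rw [(covDir_coordProj (G N) φ h _).2, if_pos (by decide)]
  · rw [meanM_coordProj, if_pos (by decide)]
  · refine (Whp.prod_fst (Q := fun N => stdNormals N)).1
      ((Whp.prod_fst (Q := fun N => stdNormals N)).1 ?_)
    refine (whp_quadForm_obsInfo hgrowth hconv hpos hφΘ (S' := {1}) (S := {1, 4}) ?_
      (Or.inr (Or.inl rfl)) hε).mono (Eventually.of_forall fun N ω hω u => ?_)
    · filter_upwards [hsplit] with N h u
      rw [h u]
      exact le_add_of_nonneg_right (by positivity)
    · have := hω u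
      rwa [(quadForm_obsInfo_coordProj (G N) hpos _ ω).2.2.2.1] at this

theorem bernRem_eq_integral {ι : Type*} [Fintype ι] (θ x : ι → ℝ) :
    bernRem θ x = ∫ r in (0 : ℝ)..1, (1 - r) * bernInfo (θ + r • x) x := by
  simp only [bernRem, bernInfo, Finset.mul_sum, softplusRem_eq_integral, Pi.add_apply,
    Pi.smul_apply, smul_eq_mul]
  rw [intervalIntegral.integral_finsetSum]
  intro i _
  refine Continuous.intervalIntegrable ?_ _ _
  have h : Continuous fun r : ℝ => Real.sigmoid (θ i + r * x i) :=
    continuous_sigmoid.comp (by fun_prop)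
  fun_prop

theorem continuous_bernInfo_line {ι : Type*} [Fintype ι] (θ x : ι → ℝ) :
    Continuous fun r : ℝ => bernInfo (θ + r • x) x := by
  simp only [bernInfo, Pi.add_apply, Pi.smul_apply, smul_eq_mul]
  refine continuous_finsetSum _ fun i _ => ?_
  have h : Continuous fun r : ℝ => Real.sigmoid (θ i + r * x i) :=
    continuous_sigmoid.comp (by fun_prop)
  fun_prop

/-- The weight 1 − r has integral 1/2 on [0, 1], which is where q/2 comes from, and it is at most 1.
-/
theorem enorm_bernRem_sub_le {ι : Type*} [Fintype ι] (θ x : ι → ℝ) (q : ℝ) :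
    ENNReal.ofReal |bernRem θ x - q / 2|
      ≤ ∫⁻ r in Set.Ioc (0 : ℝ) 1, ENNReal.ofReal |bernInfo (θ + r • x) x - q| := by
  have hc := continuous_bernInfo_line θ x
  have e : bernRem θ x - q / 2
      = ∫ r in (0 : ℝ)..1, (1 - r) * (bernInfo (θ + r • x) x - q) := by
    have h1 : ∫ r in (0 : ℝ)..1, (1 - r) * q = q / 2 := by
      rw [intervalIntegral.integral_mul_const, intervalIntegral.integral_sub (by simp) (by simp)]
      simp
      ring
    simp_rw [mul_sub]
    rw [intervalIntegral.integral_sub (Continuous.intervalIntegrable (by fun_prop) _ _)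
      (Continuous.intervalIntegrable (by fun_prop) _ _), h1, bernRem_eq_integral]
  rw [e, intervalIntegral.integral_of_le zero_le_one, ← Real.norm_eq_abs, ofReal_norm]
  refine (enorm_integral_le_lintegral_enorm _).trans ?_
  refine setLIntegral_mono' measurableSet_Ioc fun r hr => ?_
  rw [enorm_mul, ← ofReal_norm, ← ofReal_norm, Real.norm_eq_abs, Real.norm_eq_abs,
    ← ENNReal.ofReal_mul (abs_nonneg _)]
  refine ENNReal.ofReal_le_ofReal (mul_le_of_le_one_left (abs_nonneg _) ?_)
  rw [abs_le]
  exact ⟨by linarith [hr.2], by linarith [hr.1]⟩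

/-- Along a direction of `α`, the information of the exposures is close to the Fisher information
at the starting point. -/
theorem lintegral_bernInfo_sub_le (hvar : ∀ φ ∈ Θ, ∀ k, 0 < variances φ k)
    (hφ : φ ∈ interior Θ) (hgrowth : InformationGrowth G ν Θ)
    (hconv : InformationConvergence G ν Θ) (hstab : InformationStability G ν Θ) (u : Param p)
    {δ : ℝ} (hδ : 0 < δ) : ∀ᶠ N in atTop, ∀ r ∈ Set.Ioc (0 : ℝ) 1,
      ∫⁻ C, ENNReal.ofReal |bernInfo
        (logitDir C φ + r • logitDir C (invSqrt (G N) (ν N) φ u))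
        (logitDir C (invSqrt (G N) (ν N) φ u)) - blockForm G ν φ {2} N u| ∂(ν N)
      ≤ ENNReal.ofReal δ := by
  have hφΘ := interior_subset hφ
  have hpos := hvar φ hφΘ
  -- Comparing B(ψ) with B(φ) costs 3η‖u‖² and the information error at ψ costs 4η‖u‖²; together
  -- 7η‖u‖² ≤ δ.
  set η := min 1 (δ / (7 * (‖u‖ ^ 2 + 1))) with hη
  have hη0 : 0 < η := by positivity
  have hη1 : η ≤ 1 := min_le_left _ _
  have hη2 : 7 * η * ‖u‖ ^ 2 ≤ δ := by
    have h1 : η ≤ δ / (7 * (‖u‖ ^ 2 + 1)) := min_le_right _ _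
    calc 7 * η * ‖u‖ ^ 2 ≤ 7 * (δ / (7 * (‖u‖ ^ 2 + 1))) * (‖u‖ ^ 2 + 1) := by gcongr; linarith
      _ = δ := by field_simp
  have h0 : (0 : ℝ≥0∞) < ENNReal.ofReal η := ENNReal.ofReal_pos.2 hη0
  -- The stability condition asks for a positive radius, hence the 1 for the case u = 0.
  have hu1 : 0 < ‖u‖ + 1 := by positivity
  filter_upwards [hconv.lintegral_frob_le hη0, hgrowth.posDef, hgrowth.quadForm_nonneg hφΘ,
    hgrowth.quadForm_coordProj_le hφΘ hpos (S := {2}) (Or.inr (Or.inr rfl)),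
    (hstab.fisher (‖u‖ + 1) hu1).eventually (gt_mem_nhds h0),
    hgrowth.eventually_mem_localSet hφ ‖u‖] with N hfrob hB hnn hle hst hmem r hr
  set B := fisherInfo (G N) (ν N) φ with hBdef
  set h := coordProj {2} (invSqrt (G N) (ν N) φ u) with hh
  -- The intermediate parameter moves α only. It lies in Θ because r h has normalized length at most
  -- ‖u‖, so information convergence can be used at ψ.
  set ψ := φ + r • h with hψ
  set B' := fisherInfo (G N) (ν N) ψ with hBdef'
  have hlog : ∀ C : Fin N → Fin p → ℝ, logitDir C (invSqrt (G N) (ν N) φ u) = logitDir C h := fun C => by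
    rw [hh, logitDir_coordProj, if_pos (by decide)]
  have hq0 : 0 ≤ quadForm B h := hnn h
  have hqu : quadForm B h ≤ ‖u‖ ^ 2 := (hle _).trans (quadForm_sqrt_inv (hB φ hφΘ) u).le
  have hψΘ : ψ ∈ Θ := by
    set u' := Matrix.toEuclideanLin (fisherSqrt (G N) (ν N) φ) (r • h) with hu'
    have hT : invSqrt (G N) (ν N) φ u' = r • h := toEuclideanLin_inv_sqrt (hB φ hφΘ) _
    have hn : ‖u'‖ ≤ ‖u‖ := by
      refine (sq_le_sq₀ (norm_nonneg _) (norm_nonneg _)).1 ?_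
      have e : ‖u'‖ ^ 2 = quadForm B (r • h) := (quadForm_eq_norm_sq (hB φ hφΘ) _).symm
      rw [e, quadForm_smul]
      have hr2 : r ^ 2 ≤ 1 := by have := hr.1; have := hr.2; nlinarith
      calc r ^ 2 * quadForm B h ≤ 1 * quadForm B h := by gcongr
        _ ≤ _ := by rw [one_mul]; exact hqu
    have := hmem u' hn
    rwa [hT] at this
  have hdist : ‖Matrix.toEuclideanLin (fisherSqrt (G N) (ν N) φ)ᵀ (φ - ψ)‖ ≤ ‖u‖ + 1 := by
    have e1 : (fisherSqrt (G N) (ν N) φ)ᵀ = CFC.sqrt B := isSymm_sqrt _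
    have e2 : φ - ψ = (-r) • h := by rw [hψ, neg_smul]; abel
    rw [e1]
    refine le_trans ((sq_le_sq₀ (norm_nonneg _) (norm_nonneg u)).1 ?_) (by linarith)
    rw [← quadForm_eq_norm_sq (hB φ hφΘ), e2, quadForm_smul]
    have hr2 : (-r) ^ 2 ≤ 1 := by have := hr.1; have := hr.2; nlinarith
    calc (-r) ^ 2 * quadForm B h ≤ 1 * quadForm B h := by gcongr
      _ ≤ _ := by rw [one_mul]; exact hqu
  have hst' : frob ((CFC.sqrt B)⁻¹ * CFC.sqrt B' - 1) ≤ η := by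
    refine (ENNReal.ofReal_le_ofReal_iff hη0.le).1 (le_trans ?_ hst.le)
    refine le_trans ?_ (le_iSup₂ (f := fun φ (_ : φ ∈ Θ) => ⨆ φ' ∈ Θ,
      ⨆ (_ : ‖Matrix.toEuclideanLin (fisherSqrt (G N) (ν N) φ)ᵀ (φ - φ')‖ ≤ ‖u‖ + 1),
        ENNReal.ofReal (frob ((fisherSqrt (G N) (ν N) φ)⁻¹ * fisherSqrt (G N) (ν N) φ' - 1))) φ hφΘ)
    refine le_trans ?_ (le_iSup₂ (f := fun φ' (_ : φ' ∈ Θ) =>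
      ⨆ (_ : ‖Matrix.toEuclideanLin (fisherSqrt (G N) (ν N) φ)ᵀ (φ - φ')‖ ≤ ‖u‖ + 1),
        ENNReal.ofReal (frob ((fisherSqrt (G N) (ν N) φ)⁻¹ * fisherSqrt (G N) (ν N) φ' - 1))) ψ hψΘ)
    exact le_iSup (f := fun _ : ‖Matrix.toEuclideanLin (fisherSqrt (G N) (ν N) φ)ᵀ (φ - ψ)‖
      ≤ ‖u‖ + 1 => ENNReal.ofReal (frob ((CFC.sqrt B)⁻¹ * CFC.sqrt B' - 1))) hdist
  have hBB := abs_quadForm_sub_quadForm_le (hB φ hφΘ) (hB ψ hψΘ) hst' h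
  have hc1 : η * (2 + η) * quadForm B h ≤ 3 * η * ‖u‖ ^ 2 := by
    calc η * (2 + η) * quadForm B h ≤ η * (2 + 1) * ‖u‖ ^ 2 := by gcongr
      _ = _ := by ring
  have hB'le : quadForm B' h ≤ 4 * ‖u‖ ^ 2 := by
    have h1 := (abs_le.1 hBB).2
    have h2 : 3 * η * ‖u‖ ^ 2 ≤ 3 * ‖u‖ ^ 2 := by
      have := mul_le_mul_of_nonneg_right hη1 (sq_nonneg ‖u‖)
      linarith
    linarith
  have hpt : ∀ x : Data N p, |bernInfo (logitDir x.1 φ + r • logitDir x.1 h) (logitDir x.1 h)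
      - quadForm B h| ≤ frob ((fisherSqrt (G N) (ν N) ψ)⁻¹ * obsInfo (G N) x ψ *
        (fisherSqrt (G N) (ν N) ψ)⁻¹ - 1) * (4 * ‖u‖ ^ 2) + 3 * η * ‖u‖ ^ 2 := fun x => by
    have e : quadForm (obsInfo (G N) x ψ) h
        = bernInfo (logitDir x.1 φ + r • logitDir x.1 h) (logitDir x.1 h) := by
      rw [quadForm_obsInfo_alpha (G N) (hvar ψ hψΘ) (fun k => by simp [hh, coordProj_apply,
        paramClass]) (fun k => by simp [hh, coordProj_apply, paramClass]) (fun k => by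
          rw [hh, coordProj_apply, if_neg]
          fin_cases k <;> simp [paramClass]) x, hψ, map_add, map_smul]
    rw [← e]
    have h1 := abs_quadForm_sub_le (hB ψ hψΘ) (obsInfo (G N) x ψ) h
    have h2 := abs_sub_le (quadForm (obsInfo (G N) x ψ) h) (quadForm B' h) (quadForm B h)
    have h3 := mul_le_mul_of_nonneg_left hB'le (frob_nonneg ((fisherSqrt (G N) (ν N) ψ)⁻¹
      * obsInfo (G N) x ψ * (fisherSqrt (G N) (ν N) ψ)⁻¹ - 1))
    have h4 := h1.trans h3
    linarith
  have hm : Measurable fun C : Fin N → Fin p → ℝ => ENNReal.ofReal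
      |bernInfo (logitDir C φ + r • logitDir C h) (logitDir C h) - quadForm B h| := by
    have h1 : Measurable fun C : Fin N → Fin p → ℝ =>
        bernInfo (logitDir C φ + r • logitDir C h) (logitDir C h) :=
      measurable_bernInfo ((measurable_logitDir φ).add ((measurable_logitDir h).const_smul r))
        (measurable_logitDir h)
    exact (measurable_norm.comp (h1.sub_const _)).ennreal_ofReal
  simp only [hlog]
  change ∫⁻ C, ENNReal.ofReal |bernInfo (logitDir C φ + r • logitDir C h) (logitDir C h)
    - quadForm B h| ∂(ν N) ≤ _
  -- The integrand depends on the confounders only, so the integral may be taken under the law of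
  -- the data with parameter ψ, where information convergence applies.
  rw [← map_fst_dataLaw (G N) (ν N) ψ, lintegral_map hm measurable_fst]
  refine (lintegral_mono fun x => ENNReal.ofReal_le_ofReal (hpt x)).trans ?_
  have hsplit : ∀ x : Data N p, ENNReal.ofReal (frob ((fisherSqrt (G N) (ν N) ψ)⁻¹
        * obsInfo (G N) x ψ * (fisherSqrt (G N) (ν N) ψ)⁻¹ - 1) * (4 * ‖u‖ ^ 2) + 3 * η * ‖u‖ ^ 2)
      = ENNReal.ofReal (3 * η * ‖u‖ ^ 2) + ENNReal.ofReal (4 * ‖u‖ ^ 2)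
        * ENNReal.ofReal (frob ((fisherSqrt (G N) (ν N) ψ)⁻¹ * obsInfo (G N) x ψ *
          (fisherSqrt (G N) (ν N) ψ)⁻¹ - 1)) := fun x => by
    rw [ENNReal.ofReal_add (mul_nonneg (frob_nonneg _) (by positivity)) (by positivity),
      mul_comm (frob _), ENNReal.ofReal_mul (by positivity), add_comm]
  simp_rw [hsplit]
  rw [lintegral_add_left measurable_const, lintegral_const_mul' _ _ ENNReal.ofReal_ne_top]
  simp only [lintegral_const, measure_univ, mul_one]
  calc _ ≤ ENNReal.ofReal (3 * η * ‖u‖ ^ 2) + ENNReal.ofReal (4 * ‖u‖ ^ 2) * ENNReal.ofReal η := by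
        gcongr
        exact hfrob ψ hψΘ
    _ = ENNReal.ofReal (7 * η * ‖u‖ ^ 2) := by
        rw [← ENNReal.ofReal_mul (by positivity), ← ENNReal.ofReal_add (by positivity)
          (by positivity)]
        congr 1; ring
    _ ≤ _ := ENNReal.ofReal_le_ofReal hη2

theorem isBernBlock_exposure (hvar : ∀ φ ∈ Θ, ∀ k, 0 < variances φ k)
    (hφ : φ ∈ interior Θ) (hgrowth : InformationGrowth G ν Θ)
    (hconv : InformationConvergence G ν Θ) (hstab : InformationStability G ν Θ) :
    IsBernBlock ν (fun _ C => logitDir C φ)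
      (fun N C => logitDir C ∘ₗ invSqrt (G N) (ν N) φ) (blockForm G ν φ {2}) := by
  have hφΘ := interior_subset hφ
  have hpos := hvar φ hφΘ
  refine ⟨fun N => measurable_logitDir φ, fun N u => measurable_logitDir _, ?_, ?_, ?_, ?_, ?_⟩
  · filter_upwards [hgrowth.posDef] with N hB u
    have hB := hB φ hφΘ
    set u' := Matrix.toEuclideanLin (fisherSqrt (G N) (ν N) φ)
      (coordProj {2} (invSqrt (G N) (ν N) φ u)) with hu'
    have hT : invSqrt (G N) (ν N) φ u' = coordProj {2} (invSqrt (G N) (ν N) φ u) :=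
      toEuclideanLin_inv_sqrt hB _
    refine ⟨u', (quadForm_eq_norm_sq hB _).symm, ?_, fun C => ?_⟩
    · simp only [blockForm, hT, coordProj_coordProj]
    · simp only [LinearMap.comp_apply, hT, logitDir_coordProj]
      rw [if_pos (by decide)]
  · filter_upwards [hgrowth.posDef, hgrowth.quadForm_coordProj_le hφΘ hpos (S := {2})
      (Or.inr (Or.inr rfl))] with N hB h u
    exact (h _).trans (quadForm_sqrt_inv (hB φ hφΘ) u).le
  · refine Eventually.of_forall fun N c u => ?_
    simp only [blockForm, map_smul, quadForm_smul]
  · filter_upwards [hgrowth.posDef] with N hB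
    have := (convexOn_quadForm (hB φ hφΘ).posSemidef).comp_linearMap
      (coordProj {2} ∘ₗ invSqrt (G N) (ν N) φ)
    rw [Set.preimage_univ] at this
    exact this
  · intro u ε hε δ hδ
    obtain ⟨η, hη0, hη⟩ : ∃ η : ℝ, 0 < η ∧ ENNReal.ofReal η / ENNReal.ofReal ε ≤ δ := by
      have h1 : Tendsto (fun η : ℝ => ENNReal.ofReal η / ENNReal.ofReal ε) (𝓝[>] 0) (𝓝 0) := by
        have h2 : Tendsto (fun η : ℝ => ENNReal.ofReal η) (𝓝[>] 0) (𝓝 0) := by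
          rw [← ENNReal.ofReal_zero]
          exact (ENNReal.continuous_ofReal.tendsto 0).mono_left nhdsWithin_le_nhds
        simpa using ENNReal.Tendsto.div_const h2 (Or.inr (ENNReal.ofReal_pos.2 hε).ne')
      obtain ⟨η, h3, h4⟩ := ((h1.eventually (ge_mem_nhds hδ)).and self_mem_nhdsWithin).exists
      exact ⟨η, h4, h3⟩
    filter_upwards [lintegral_bernInfo_sub_le hvar hφ hgrowth hconv hstab u hη0] with N hN
    set h := invSqrt (G N) (ν N) φ u with hh
    set q := blockForm G ν φ {2} N u with hq
    have hjoint : Measurable fun y : (Fin N → Fin p → ℝ) × ℝ => ENNReal.ofReal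
        |bernInfo (logitDir y.1 φ + y.2 • logitDir y.1 h) (logitDir y.1 h) - q| := by
      have m1 : Measurable fun y : (Fin N → Fin p → ℝ) × ℝ => logitDir y.1 h :=
        (measurable_logitDir h).comp measurable_fst
      have m2 : Measurable fun y : (Fin N → Fin p → ℝ) × ℝ =>
          logitDir y.1 φ + y.2 • logitDir y.1 h :=
        ((measurable_logitDir φ).comp measurable_fst).add (measurable_snd.smul m1)
      exact (measurable_norm.comp ((measurable_bernInfo m2 m1).sub_const q)).ennreal_ofReal
    have hrem : Measurable fun C : Fin N → Fin p → ℝ => bernRem (logitDir C φ) (logitDir C h) := by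
      refine Finset.measurable_sum _ fun i _ => ?_
      exact continuous_softplusRem.measurable.comp
        (((measurable_pi_apply i).comp (measurable_logitDir φ)).prodMk
          ((measurable_pi_apply i).comp (measurable_logitDir h)))
    have hint : ∫⁻ C, ENNReal.ofReal |bernRem (logitDir C φ) (logitDir C h) - q / 2| ∂(ν N)
        ≤ ENNReal.ofReal η := by
      refine (lintegral_mono fun C => enorm_bernRem_sub_le _ _ _).trans ?_
      -- The bound on the integral over confounders is uniform in r, so Tonelli gives a bound in
      -- mean for the remainder, to which Markov's inequality is then applied.
      rw [lintegral_lintegral_swap hjoint.aemeasurable]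
      refine (setLIntegral_mono' measurableSet_Ioc hN).trans ?_
      simp
    have hmk := (meas_ge_le_lintegral_div (μ := ν N)
      (measurable_norm.comp (hrem.sub_const (q / 2))).ennreal_ofReal.aemeasurable
      (ENNReal.ofReal_pos.2 hε).ne' ENNReal.ofReal_ne_top).trans
        ((ENNReal.div_le_div_right hint _).trans hη)
    refine (measure_mono fun C hC => ?_).trans hmk
    rw [Set.mem_compl_iff, Set.mem_ofPred_eq, not_le] at hC
    rw [Set.mem_ofPred_eq]
    exact ENNReal.ofReal_le_ofReal hC.le

end Models

end RENSEM


namespace RENSEM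

/-! ### Scores -/

section Scores

variable {ι : Type*} [Fintype ι] {κ : Type*} [Fintype κ]

theorem IsLANBlock.congr_quad {Ω : ℕ → Type*} [∀ N, MeasurableSpace (Ω N)]
    {P : ∀ N, Measure (Ω N)} {D : ℕ → Set (EuclideanSpace ℝ κ)}
    {ℓ s : ∀ N, Ω N → EuclideanSpace ℝ κ → ℝ} {q q' : ℕ → EuclideanSpace ℝ κ → ℝ}
    (h : IsLANBlock P D ℓ s q) (hq : ∀ᶠ N in atTop, ∀ u, q N u = q' N u) :
    IsLANBlock P D ℓ s q' where
  global δ hδ := by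
    obtain ⟨A, hA⟩ := h.global δ hδ
    refine ⟨A, hA.mono ?_⟩
    filter_upwards [hq] with N hN w hw u hu
    rw [← hN]
    exact hw u hu
  local' R hR ε hε := by
    refine (h.local' R hR ε hε).mono ?_
    filter_upwards [hq] with N hN w hw u hu
    rw [← hN]
    exact hw u hu

theorem gscore_linear [DecidableEq κ] (w x : EuclideanSpace ℝ κ →ₗ[ℝ] (ι → ℝ)) (z : ι → ℝ)
    (u : EuclideanSpace ℝ κ) :
    gscore (w u) (x u) z = ∑ j, gscore (w (EuclideanSpace.single j 1))
      (x (EuclideanSpace.single j 1)) z * u j := by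
  simp only [gscore, Finset.sum_mul]
  rw [Finset.sum_comm]
  refine Finset.sum_congr rfl fun i _ => ?_
  have e : ∀ L : EuclideanSpace ℝ κ →ₗ[ℝ] (ι → ℝ),
      L u i = ∑ j, L (EuclideanSpace.single j 1) i * u j := fun L => by
    rw [linearMap_apply_eq_sum L u, Finset.sum_apply]
    exact Finset.sum_congr rfl fun j _ => by rw [Pi.smul_apply, smul_eq_mul, mul_comm]
  rw [e w, e x, Finset.mul_sum, Finset.mul_sum, ← Finset.sum_add_distrib]
  exact Finset.sum_congr rfl fun j _ => by ring

theorem bernScore_linear [DecidableEq κ] (θ : ι → ℝ) (x : EuclideanSpace ℝ κ →ₗ[ℝ] (ι → ℝ))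
    (U : ι → unitInterval) (u : EuclideanSpace ℝ κ) :
    bernScore θ (x u) U = ∑ j, bernScore θ (x (EuclideanSpace.single j 1)) U * u j := by
  simp only [bernScore, Finset.sum_mul]
  rw [Finset.sum_comm]
  refine Finset.sum_congr rfl fun i _ => ?_
  rw [linearMap_apply_eq_sum x u, Finset.sum_apply, Finset.mul_sum]
  refine Finset.sum_congr rfl fun j _ => ?_
  rw [Pi.smul_apply, smul_eq_mul]
  ring

theorem measurable_gscore {Ω : Type*} [MeasurableSpace Ω] (w : ι → ℝ) {x : Ω → ι → ℝ}
    (hx : Measurable x) : Measurable fun ω : Ω × (ι → ℝ) => gscore w (x ω.1) ω.2 := by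
  unfold gscore
  fun_prop

end Scores

/-- A conditionally normal summand is added to an asymptotically normal variable. -/
theorem CondNormal.tendsto_add {Ω Z : ℕ → Type*} [∀ N, MeasurableSpace (Ω N)]
    [∀ N, MeasurableSpace (Z N)] {P : ∀ N, Measure (Ω N)} {Q : ∀ N, Measure (Z N)}
    [∀ N, IsProbabilityMeasure (P N)] [∀ N, IsProbabilityMeasure (Q N)]
    {s : ∀ N, Ω N → Z N → ℝ} {q r : ℕ → ℝ} (h : CondNormal P Q s q)
    (hs : ∀ N, Measurable (Function.uncurry (s N))) (hq : ∀ᶠ N in atTop, 0 ≤ q N)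
    {t : ∀ N, Ω N → ℝ} (ht : ∀ N, Measurable (t N))
    (hlim : Tendsto (fun N => ∫ ω, Complex.exp (t N ω * Complex.I) ∂(P N)
      - Real.exp (-r N / 2)) atTop (𝓝 0)) :
    Tendsto (fun N => ∫ ω, Complex.exp ((t N ω.1 + s N ω.1 ω.2 : ℝ) * Complex.I)
      ∂((P N).prod (Q N)) - Real.exp (-(q N + r N) / 2)) atTop (𝓝 0) := by
  refine tendsto_of_sub_mul_exp hq ?_ hlim
  refine (h.tendsto hs hq (Φ := fun N ω => Complex.exp (t N ω * Complex.I))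
    (fun N => by have := ht N; fun_prop)
    (fun N ω => (Complex.norm_exp_ofReal_mul_I _).le)).congr fun N => ?_
  congr 1
  refine integral_congr_ae (ae_of_all _ fun ω => ?_)
  simp only [← Complex.exp_add]
  push_cast
  rw [add_mul]

/-! ### Local asymptotic normality of the model -/

section LAN

variable {p : ℕ} {G : ∀ N, SimpleGraph (Fin N)} {ν : ∀ N, Measure (Fin N → Fin p → ℝ)}
  {Θ : Set (Param p)} {φ : Param p}

/-- The score in a local direction. -/
noncomputable def score (G : ∀ N, SimpleGraph (Fin N)) (ν : ∀ N, Measure (Fin N → Fin p → ℝ))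
    (φ : Param p) (N : ℕ)
    (ω : (((Fin N → Fin p → ℝ) × (Fin N → unitInterval)) × (Fin N → ℝ)) × (Fin N → ℝ))
    (u : Param p) : ℝ :=
  bernScore (logitDir ω.1.1.1 φ) ((logitDir ω.1.1.1 ∘ₗ invSqrt (G N) (ν N) φ) u) ω.1.1.2
    + gscore ((covDir (G N) (varIdx 2) (varIdx 3) φ ∘ₗ invSqrt (G N) (ν N) φ) u)
      ((meanM (G N) φ ω.1.1 ∘ₗ invSqrt (G N) (ν N) φ) u) ω.1.2
    + gscore ((covDir (G N) (varIdx 0) (varIdx 1) φ ∘ₗ invSqrt (G N) (ν N) φ) u)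
      ((meanY (G N) φ ω.1 ∘ₗ invSqrt (G N) (ν N) φ) u) ω.2

/-- The gradient of the local log-likelihood at the origin. -/
noncomputable def scoreVec (G : ∀ N, SimpleGraph (Fin N)) (ν : ∀ N, Measure (Fin N → Fin p → ℝ))
    (φ : Param p) (N : ℕ)
    (ω : (((Fin N → Fin p → ℝ) × (Fin N → unitInterval)) × (Fin N → ℝ)) × (Fin N → ℝ)) : Param p :=
  WithLp.toLp 2 fun j => score G ν φ N ω (EuclideanSpace.single j 1)

/-- The log-likelihood ratio at a local parameter. -/
noncomputable def logLikRatio (G : ∀ N, SimpleGraph (Fin N))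
    (ν : ∀ N, Measure (Fin N → Fin p → ℝ)) (φ : Param p) (N : ℕ)
    (ω : (((Fin N → Fin p → ℝ) × (Fin N → unitInterval)) × (Fin N → ℝ)) × (Fin N → ℝ))
    (u : Param p) : ℝ :=
  (bernScore (logitDir ω.1.1.1 φ) ((logitDir ω.1.1.1 ∘ₗ invSqrt (G N) (ν N) φ) u) ω.1.1.2
      - bernRem (logitDir ω.1.1.1 φ) ((logitDir ω.1.1.1 ∘ₗ invSqrt (G N) (ν N) φ) u))
    + gdev ((covDir (G N) (varIdx 2) (varIdx 3) φ ∘ₗ invSqrt (G N) (ν N) φ) u)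
      ((meanM (G N) φ ω.1.1 ∘ₗ invSqrt (G N) (ν N) φ) u) ω.1.2
    + gdev ((covDir (G N) (varIdx 0) (varIdx 1) φ ∘ₗ invSqrt (G N) (ν N) φ) u)
      ((meanY (G N) φ ω.1 ∘ₗ invSqrt (G N) (ν N) φ) u) ω.2

theorem score_eq_inner (N : ℕ)
    (ω : (((Fin N → Fin p → ℝ) × (Fin N → unitInterval)) × (Fin N → ℝ)) × (Fin N → ℝ))
    (u : Param p) : score G ν φ N ω u = inner ℝ (scoreVec G ν φ N ω) u := by
  have h : inner ℝ (scoreVec G ν φ N ω) u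
      = ∑ j, score G ν φ N ω (EuclideanSpace.single j 1) * u j := by
    rw [PiLp.inner_apply]
    refine Finset.sum_congr rfl fun j _ => ?_
    simp [scoreVec, mul_comm]
  rw [h]
  simp only [score, add_mul, Finset.sum_add_distrib]
  rw [← bernScore_linear, ← gscore_linear, ← gscore_linear]

theorem logLikRatio_eq (hφ : ∀ k, 0 < variances φ k) {N : ℕ} {u : Param p}
    (hu : ∀ k, 0 < variances (φ + invSqrt (G N) (ν N) φ u) k)
    (ω : (((Fin N → Fin p → ℝ) × (Fin N → unitInterval)) × (Fin N → ℝ)) × (Fin N → ℝ)) :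
    logLikRatio G ν φ N ω u = logLik (G N) (whiteData (G N) φ ω) (φ + invSqrt (G N) (ν N) φ u)
      - logLik (G N) (whiteData (G N) φ ω) φ := by
  rw [logLik_whiteData_sub (G N) hφ hu, logLikRatio]
  simp only [LinearMap.comp_apply]
  ring

theorem measurable_exposureScore (N : ℕ) (u : Param p) :
    Measurable fun ω : (Fin N → Fin p → ℝ) × (Fin N → unitInterval) => bernScore
      (logitDir ω.1 φ) ((logitDir ω.1 ∘ₗ invSqrt (G N) (ν N) φ) u) ω.2 :=
  measurable_bernScore (θ := fun C : Fin N → Fin p → ℝ => logitDir C φ)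
    (x := fun C => logitDir C (invSqrt (G N) (ν N) φ u)) (measurable_logitDir φ)
    (measurable_logitDir _)

theorem measurable_mediatorScore (N : ℕ) (u : Param p) :
    Measurable fun ω : ((Fin N → Fin p → ℝ) × (Fin N → unitInterval)) × (Fin N → ℝ) =>
      gscore ((covDir (G N) (varIdx 2) (varIdx 3) φ ∘ₗ invSqrt (G N) (ν N) φ) u)
        ((meanM (G N) φ ω.1 ∘ₗ invSqrt (G N) (ν N) φ) u) ω.2 :=
  measurable_gscore _ (measurable_meanM (G N) φ (invSqrt (G N) (ν N) φ u))

theorem measurable_outcomeScore (N : ℕ) (u : Param p) :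
    Measurable fun ω : (((Fin N → Fin p → ℝ) × (Fin N → unitInterval)) × (Fin N → ℝ))
        × (Fin N → ℝ) =>
      gscore ((covDir (G N) (varIdx 0) (varIdx 1) φ ∘ₗ invSqrt (G N) (ν N) φ) u)
        ((meanY (G N) φ ω.1 ∘ₗ invSqrt (G N) (ν N) φ) u) ω.2 :=
  measurable_gscore _ (measurable_meanY (G N) φ (invSqrt (G N) (ν N) φ u))

theorem measurable_score (N : ℕ) (u : Param p) : Measurable fun ω => score G ν φ N ω u :=
  (((measurable_exposureScore N u).comp measurable_fst.fst).add
    ((measurable_mediatorScore N u).comp measurable_fst)).add (measurable_outcomeScore N u)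

theorem measurable_scoreVec (N : ℕ) : Measurable (scoreVec G ν φ N) :=
  (WithLp.measurable_toLp 2 _).comp (measurable_pi_lambda _ fun _ => measurable_score N _)

variable [∀ N, IsProbabilityMeasure (ν N)]

/-- Each block is lifted to the full noise space by ignoring the later noises. The quadratic forms
of the three blocks add up to ‖u‖² because the information is block diagonal. -/
theorem isLANBlock_logLikRatio (hΘ : IsCompact Θ) (hvar : ∀ φ ∈ Θ, ∀ k, 0 < variances φ k)
    (hφ : φ ∈ interior Θ) (hgrowth : InformationGrowth G ν Θ)
    (hconv : InformationConvergence G ν Θ) (hstab : InformationStability G ν Θ) :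
    IsLANBlock (fun N => whiteLaw (ν N)) (localSet G ν Θ φ) (logLikRatio G ν φ) (score G ν φ)
      fun _ u => ‖u‖ ^ 2 := by
  have hφΘ := interior_subset hφ
  have hY := (isGaussBlock_outcome hΘ hvar hφ hgrowth hconv).isLANBlock
  have hM := (isGaussBlock_mediator hΘ hvar hφ hgrowth hconv).isLANBlock.prod_fst
    fun N => stdNormals N
  have hA := (((isBernBlock_exposure hvar hφ hgrowth hconv hstab).isLANBlock
    (localSet G ν Θ φ)).prod_fst fun N => stdNormals N).prod_fst fun N => stdNormals N
  have hAM := hA.add hM (hgrowth.blockForm_nonneg hφΘ _) (hgrowth.blockForm_nonneg hφΘ _)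
  have hAM0 : ∀ᶠ N in atTop, ∀ u, 0 ≤ blockForm G ν φ {2} N u + blockForm G ν φ {1, 4} N u := by
    filter_upwards [hgrowth.blockForm_nonneg hφΘ {2}, hgrowth.blockForm_nonneg hφΘ {1, 4}]
      with N h1 h2 u using add_nonneg (h1 u) (h2 u)
  refine (hAM.add hY hAM0 (hgrowth.blockForm_nonneg hφΘ _)).congr_quad ?_
  filter_upwards [hgrowth.blockForm_add hφΘ (hvar φ hφΘ)] with N hN u
  rw [← hN u]
  ring

/-- Conditioning follows the causal order: exposures given confounders, then mediators, then
outcomes. Each step multiplies by a deterministic Gaussian factor, although the three variances may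
fluctuate with N. -/
theorem tendsto_integral_cexp_score (hΘ : IsCompact Θ)
    (hvar : ∀ φ ∈ Θ, ∀ k, 0 < variances φ k)
    (hφ : φ ∈ interior Θ) (hgrowth : InformationGrowth G ν Θ)
    (hconv : InformationConvergence G ν Θ) (hstab : InformationStability G ν Θ) (a : Param p) :
    Tendsto (fun N => ∫ ω, Complex.exp (inner ℝ (scoreVec G ν φ N ω) a * Complex.I)
      ∂(whiteLaw (ν N))) atTop (𝓝 (Real.exp (-‖a‖ ^ 2 / 2) : ℝ)) := by
  have hφΘ := interior_subset hφ
  have h0 := fun S => hgrowth.blockForm_nonneg hφΘ S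
  have hA := (isBernBlock_exposure hvar hφ hgrowth hconv hstab).condNormal a
  have h1 := hA.tendsto (measurable_exposureScore (G := G) (ν := ν) · a)
    ((h0 {2}).mono fun N h => h a) (Φ := fun _ _ => 1) (fun N => measurable_const)
    (fun N ω => by simp)
  simp only [one_mul, integral_const, probReal_univ, one_smul] at h1
  have h2 := ((isGaussBlock_mediator hΘ hvar hφ hgrowth hconv).condNormal a).tendsto_add
    (measurable_mediatorScore (G := G) (ν := ν) · a) ((h0 {1, 4}).mono fun N h => h a)
    (measurable_exposureScore (G := G) (ν := ν) · a) h1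
  have h3 := ((isGaussBlock_outcome hΘ hvar hφ hgrowth hconv).condNormal a).tendsto_add
    (measurable_outcomeScore (G := G) (ν := ν) · a) ((h0 {0, 3}).mono fun N h => h a)
    (fun N => ((measurable_exposureScore (G := G) (ν := ν) N a).comp measurable_fst).add
      (measurable_mediatorScore (G := G) (ν := ν) N a)) h2
  rw [tendsto_iff_norm_sub_tendsto_zero]
  refine (tendsto_zero_iff_norm_tendsto_zero.1 h3).congr' ?_
  filter_upwards [hgrowth.blockForm_add hφΘ (hvar φ hφΘ)] with N hN
  have e : -(blockForm G ν φ {0, 3} N a + (blockForm G ν φ {1, 4} N a + blockForm G ν φ {2} N a)) / 2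
      = -‖a‖ ^ 2 / 2 := by rw [← hN a]; ring
  rw [e]
  simp only [← score_eq_inner]
  rfl

end LAN

end RENSEM


namespace RENSEM

/-! ### The maximum likelihood estimator -/

section Estimator

variable {p : ℕ} {G : ∀ N, SimpleGraph (Fin N)} {ν : ∀ N, Measure (Fin N → Fin p → ℝ)}
  {Θ : Set (Param p)} {φ : Param p}
  {φhat : ∀ N : ℕ, Data N p → Param p}

/-- The normalized error of an estimator. -/
noncomputable def localError (G : ∀ N, SimpleGraph (Fin N))
    (ν : ∀ N, Measure (Fin N → Fin p → ℝ)) (φ : Param p) (φhat : ∀ N : ℕ, Data N p → Param p)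
    (N : ℕ) (x : Data N p) : Param p :=
  Matrix.toEuclideanLin (fisherSqrt (G N) (ν N) φ) (φhat N x - φ)

theorem InformationGrowth.invSqrt_localError (h : InformationGrowth G ν Θ) (hφ : φ ∈ Θ) :
    ∀ᶠ N in atTop, ∀ x, invSqrt (G N) (ν N) φ (localError G ν φ φhat N x) = φhat N x - φ := by
  filter_upwards [h.posDef] with N hB x
  exact toEuclideanLin_inv_sqrt (hB φ hφ) _

theorem logLikRatio_zero (hφ : ∀ k, 0 < variances φ k) (N : ℕ)
    (ω : (((Fin N → Fin p → ℝ) × (Fin N → unitInterval)) × (Fin N → ℝ)) × (Fin N → ℝ)) :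
    logLikRatio G ν φ N ω 0 = 0 := by
  rw [logLikRatio_eq hφ (by simpa using hφ)]
  simp

variable [∀ N, IsProbabilityMeasure (ν N)]

theorem whp_isMaxOn_localError (hvar : ∀ φ ∈ Θ, ∀ k, 0 < variances φ k) (hφ : φ ∈ Θ)
    (hgrowth : InformationGrowth G ν Θ)
    (hmle : ∀ N, ∀ᵐ x ∂(dataLaw (G N) (ν N) φ), IsMLE (G N) Θ x (φhat N x)) :
    Whp (fun N => whiteLaw (ν N)) fun N =>
      {ω | localError G ν φ φhat N (whiteData (G N) φ ω) ∈ localSet G ν Θ φ N ∧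
        ∀ v ∈ localSet G ν Θ φ N, logLikRatio G ν φ N ω v
          ≤ logLikRatio G ν φ N ω (localError G ν φ φhat N (whiteData (G N) φ ω))} := by
  intro δ _
  filter_upwards [hgrowth.invSqrt_localError (φhat := φhat) hφ] with N hN
  have h1 := hmle N
  rw [← map_whiteData (G N) (ν N) (hvar φ hφ)] at h1
  have h2 := ae_of_ae_map (measurable_whiteData (G N) φ).aemeasurable h1
  refine (measure_mono (t := {ω | ¬IsMLE (G N) Θ (whiteData (G N) φ ω)
    (φhat N (whiteData (G N) φ ω))}) (Set.compl_subset_comm.1 fun ω hω => ?_)).trans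
      ((ae_iff.1 h2).le.trans zero_le)
  have hmax : IsMLE (G N) Θ (whiteData (G N) φ ω) (φhat N (whiteData (G N) φ ω)) :=
    not_not.1 hω
  have e : φ + invSqrt (G N) (ν N) φ (localError G ν φ φhat N (whiteData (G N) φ ω))
      = φhat N (whiteData (G N) φ ω) := by rw [hN]; abel
  have hmem : φ + invSqrt (G N) (ν N) φ (localError G ν φ φhat N (whiteData (G N) φ ω)) ∈ Θ := by
    rw [e]; exact hmax.1
  refine ⟨hmem, fun v hv => ?_⟩
  rw [logLikRatio_eq (hvar φ hφ) (hvar _ hv), logLikRatio_eq (hvar φ hφ) (hvar _ hmem), e]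
  exact sub_le_sub_right (hmax.2 _ hv) _

/-- The normalized error is stochastically bounded by the global bound on the likelihood, and
B_N^{-1/2} tends to 0. -/
theorem tendsto_measure_le_norm_sub (hΘ : IsCompact Θ)
    (hvar : ∀ φ ∈ Θ, ∀ k, 0 < variances φ k) (hφ : φ ∈ interior Θ)
    (hgrowth : InformationGrowth G ν Θ) (hconv : InformationConvergence G ν Θ)
    (hstab : InformationStability G ν Θ)
    (hmeas : ∀ N, AEMeasurable (φhat N) (dataLaw (G N) (ν N) φ))
    (hmle : ∀ N, ∀ᵐ x ∂(dataLaw (G N) (ν N) φ), IsMLE (G N) Θ x (φhat N x)) {ε : ℝ}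
    (hε : 0 < ε) :
    Tendsto (fun N => dataLaw (G N) (ν N) φ {x | ε ≤ ‖φhat N x - φ‖}) atTop (𝓝 0) := by
  have hφΘ := interior_subset hφ
  have hpos := hvar φ hφΘ
  rw [ENNReal.tendsto_nhds_zero]
  intro δ hδ
  have hmax : Whp (fun N => whiteLaw (ν N)) fun N =>
      {ω | localError G ν φ φhat N (whiteData (G N) φ ω) ∈ localSet G ν Θ φ N ∧
        0 ≤ logLikRatio G ν φ N ω (localError G ν φ φhat N (whiteData (G N) φ ω))} := by
    refine (whp_isMaxOn_localError hvar hφΘ hgrowth hmle).mono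
      (Eventually.of_forall fun N ω hω => ⟨hω.1, ?_⟩)
    have := hω.2 0 (by simpa [localSet] using hφΘ)
    rwa [logLikRatio_zero hpos] at this
  obtain ⟨R, hR⟩ := (isLANBlock_logLikRatio hΘ hvar hφ hgrowth hconv hstab).exists_norm_argmax_le
    hmax hδ
  filter_upwards [hR, hgrowth.invSqrt_localError (φhat := φhat) hφΘ,
    hgrowth.norm_invSqrt_le hφΘ (ε := ε / (2 * (|R| + 1))) (by positivity)] with N h1 h2 h3
  have hms : NullMeasurableSet {x | ε ≤ ‖φhat N x - φ‖}
      ((whiteLaw (ν N)).map (whiteData (G N) φ)) := by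
    rw [map_whiteData (G N) (ν N) hpos]
    exact nullMeasurableSet_le aemeasurable_const ((hmeas N).sub_const φ).norm
  rw [← map_whiteData (G N) (ν N) hpos,
    Measure.map_apply₀ (measurable_whiteData (G N) φ).aemeasurable hms]
  refine (measure_mono fun ω hω hle => ?_).trans h1
  have hω' : ε ≤ ‖φhat N (whiteData (G N) φ ω) - φ‖ := hω
  have hle' : ‖localError G ν φ φhat N (whiteData (G N) φ ω)‖ ≤ |R| + 1 :=
    le_trans (le_trans hle (le_abs_self R)) (by linarith)
  rw [← h2] at hω'
  have h4 := hω'.trans (h3 _)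
  have h5 : ε / (2 * (|R| + 1)) * ‖localError G ν φ φhat N (whiteData (G N) φ ω)‖ ≤ ε / 2 := by
    calc _ ≤ ε / (2 * (|R| + 1)) * (|R| + 1) := by gcongr
      _ = ε / 2 := by field_simp
  linarith

/-- On the white-noise space the normalized error differs from the score by o(1), so it inherits the
limiting characteristic function. That function depends only on the law of the data, so the limit
carries over. -/
theorem tendstoInDistribution_localError (hΘ : IsCompact Θ)
    (hvar : ∀ φ ∈ Θ, ∀ k, 0 < variances φ k) (hφ : φ ∈ interior Θ)
    (hgrowth : InformationGrowth G ν Θ) (hconv : InformationConvergence G ν Θ)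
    (hstab : InformationStability G ν Θ)
    (hmeas : ∀ N, AEMeasurable (φhat N) (dataLaw (G N) (ν N) φ))
    (hmle : ∀ N, ∀ᵐ x ∂(dataLaw (G N) (ν N) φ), IsMLE (G N) Θ x (φhat N x)) :
    TendstoInDistribution (localError G ν φ φhat) atTop (id : Param p → Param p)
      (fun N => dataLaw (G N) (ν N) φ) (stdGaussian (Param p)) := by
  have hφΘ := interior_subset hφ
  have hpos := hvar φ hφΘ
  have hX : ∀ N, AEMeasurable (localError G ν φ φhat N) (dataLaw (G N) (ν N) φ) := fun N =>
    (Matrix.toEuclideanLin (fisherSqrt (G N) (ν N) φ)).continuous_of_finiteDimensional.measurable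
      |>.comp_aemeasurable ((hmeas N).sub_const φ)
  refine tendstoInDistribution_stdGaussian hX fun a => ?_
  have hX' : ∀ N, AEMeasurable (fun ω => localError G ν φ φhat N (whiteData (G N) φ ω))
      (whiteLaw (ν N)) := fun N => by
    have := hX N
    rw [← map_whiteData (G N) (ν N) hpos] at this
    exact this.comp_measurable (measurable_whiteData (G N) φ)
  have key := tendsto_integral_cexp_of_whp hX' (fun N => (measurable_scoreVec N).aemeasurable)
    (fun ε hε => (isLANBlock_logLikRatio hΘ hvar hφ hgrowth hconv
      hstab).whp_norm_argmax_sub_score_le score_eq_inner (hgrowth.eventually_mem_localSet hφ)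
      (whp_isMaxOn_localError hvar hφΘ hgrowth hmle)
      (Eventually.of_forall fun N => logLikRatio_zero hpos N) hε)
    (tendsto_integral_cexp_score hΘ hvar hφ hgrowth hconv hstab a)
  refine key.congr fun N => ?_
  have hm : AEStronglyMeasurable (fun x => Complex.exp
      (inner ℝ (localError G ν φ φhat N x) a * Complex.I))
      ((whiteLaw (ν N)).map (whiteData (G N) φ)) := by
    rw [map_whiteData (G N) (ν N) hpos]
    have h1 := hX N
    have h2 : AEMeasurable (fun x => inner ℝ (localError G ν φ φhat N x) a)
      (dataLaw (G N) (ν N) φ) := by fun_prop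
    have h3 : AEMeasurable (fun x => Complex.exp
      (inner ℝ (localError G ν φ φhat N x) a * Complex.I)) (dataLaw (G N) (ν N) φ) := by fun_prop
    exact h3.aestronglyMeasurable
  rw [← map_whiteData (G N) (ν N) hpos,
    integral_map (measurable_whiteData (G N) φ).aemeasurable hm]

end Estimator

end RENSEM

theorem theorem5p1 (p : ℕ) (G : ∀ N : ℕ, SimpleGraph (Fin N))
    (hG : ∀ᶠ N in atTop, ∀ i, ∃ j, (G N).Adj i j)
    (ν : ∀ N : ℕ, Measure (Fin N → Fin p → ℝ)) [∀ N, IsProbabilityMeasure (ν N)]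
    (Θ : Set (RENSEM.Param p)) (hΘ : IsCompact Θ)
    (hvar : ∀ φ ∈ Θ, ∀ k, 0 < RENSEM.variances φ k)
    (φ₀ : RENSEM.Param p) (hφ₀ : φ₀ ∈ interior Θ)
    (hgrowth : RENSEM.InformationGrowth G ν Θ)
    (hconv : RENSEM.InformationConvergence G ν Θ)
    (hstab : RENSEM.InformationStability G ν Θ)
    (φhat : ∀ N : ℕ, RENSEM.Data N p → RENSEM.Param p)
    (hmeas : ∀ N, AEMeasurable (φhat N) (RENSEM.dataLaw (G N) (ν N) φ₀))
    (hmle : ∀ N, ∀ᵐ x ∂(RENSEM.dataLaw (G N) (ν N) φ₀), RENSEM.IsMLE (G N) Θ x (φhat N x)) :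
    (∀ ε : ℝ, 0 < ε → Tendsto
      (fun N => RENSEM.dataLaw (G N) (ν N) φ₀ {x | ε ≤ ‖φhat N x - φ₀‖}) atTop (𝓝 0)) ∧
    TendstoInDistribution
      (fun N x => Matrix.toEuclideanLin (RENSEM.fisherSqrt (G N) (ν N) φ₀) (φhat N x - φ₀))
      atTop (id : RENSEM.Param p → RENSEM.Param p)
      (fun N => RENSEM.dataLaw (G N) (ν N) φ₀) (stdGaussian (RENSEM.Param p)) :=
  ⟨fun _ hε => RENSEM.tendsto_measure_le_norm_sub hΘ hvar hφ₀ hgrowth hconv hstab hmeas hmle hε,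
    RENSEM.tendstoInDistribution_localError hΘ hvar hφ₀ hgrowth hconv hstab hmeas hmle⟩
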